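/- **Theorem 1.1.** Let $S$ be a noetherian scheme and let $\mathrm{Sch}_S$ be the category whose objects are the schemes separated and of finite type over $S$ and whose morphisms are the proper $S$-morphisms. Let $\mathcal F$ be a covariant functor from $\mathrm{Sch}_S$ to the category of chain complexes of abelian groups ($\mathbb Z$-graded, with differential of degree $-1$), for which there is an integer $N$ with $H_i(\mathcal F(X))=0$ for all $X$ and all $i<N$ (for example, $\mathcal F$ takes values in complexes concentrated in non-negative homological degrees). An *abstract blow-up square* is a cartesian square $$\begin{array}{ccc} Z' & \xrightarrow{\ q\ } & X'\\ {\scriptstyle p}\downarrow & & \downarrow{\scriptstyle \pi}\\ Z & \xrightarrow{\ i\ } & X\end{array}$$ in $\mathrm{Sch}_S$ with $\pi$ proper, $i$ a closed immersion, and such that $\pi$ induces an isomorphism $X'\setminus Z'\to X\setminus Z$. Assume that for every abstract blow-up square the induced sequence of complexes $$\mathcal F(Z')\xrightarrow{(q_*,\,-p_*)}\mathcal F(X')\oplus\mathcal F(Z)\xrightarrow{\pi_*+i_*}\mathcal F(X)$$ is part of a distinguished triangle, in the sense that the canonical morphism from the mapping cone of the first map to $\mathcal F(X)$, which is induced by the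 second map, is a quasi-isomorphism. A *proper cdh-cover* is a proper morphism $p:X'\to X$ such that every point $x\in X$ is the image of a point $x'\in X'$ for which $k(x)\to k(x')$ is an isomorphism. A *hyperenvelope* of $X\in\mathrm{Sch}_S$ is an augmented simplicial scheme $a:X_\bullet\to X$ such that $X_{n+1}\to(\mathrm{cosk}_nX_\bullet)_{n+1}$ is a proper cdh-cover for every $n\ge -1$. Here the coskeleta are formed in schemes over $X$, and for $n=-1$ the map is $a_0:X_0\to X$. (All $X_n$ are then proper over $X$, and all structure maps are proper.) Let $\mathcal F(X_\bullet)$ be the (direct sum) total complex of the double complex associated with the simplicial complex $n\mapsto\mathcal F(X_n)$. Then for every $X\in\mathrm{Sch}_S$ and every hyperenvelope $a:X_\bullet\to X$ the augmentation map $$\mathcal F(X_\bullet)\to\mathcal F(X)$$ is a quasi-isomorphism. -/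

import Mathlib

open CategoryTheory CategoryTheory.Limits Opposite AlgebraicGeometry

universe v u

noncomputable section

namespace HomologicalDescent

/-! ### Schemes of finite type and proper morphisms -/

/-- The property of a morphism of schemes of being separated and of finite type. -/
def sepFiniteType : MorphismProperty Scheme.{u} :=
  @IsSeparated ⊓ @LocallyOfFiniteType ⊓ @QuasiCompact

/-- The category of schemes separated and of finite type over `S`, with proper `S`-morphisms. -/
abbrev SchProper (S : Scheme.{u}) :=
  MorphismProperty.Over sepFiniteType.{u} (@IsProper : MorphismProperty Scheme.{u}) S

instance instCategorySchProper (S : Scheme.{u}) : Category.{u} (SchProper S) :=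
  MorphismProperty.Comma.instCategory _ _ _ _ _

/-- An abstract blow-up square
```
Z' --q--> X'
|         |
p         π
v         v
Z  --i--> X
```
of schemes separated and of finite type over `S`: a cartesian square with `π` proper (as all
morphisms of `SchProper S` are), `i` a closed immersion, and `π` an isomorphism over the open
complement of `i`. -/
structure IsAbstractBlowup {S : Scheme.{u}} {X X' Z Z' : SchProper S}
    (q : Z' ⟶ X') (p : Z' ⟶ Z) (π : X' ⟶ X) (i : Z ⟶ X) : Prop where
  isPullback : IsPullback q.left p.left π.left i.left
  isClosedImmersion : IsClosedImmersion i.left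
  isIso_compl : IsIso (π.left ∣_
    (⟨(Set.range i.left)ᶜ, i.left.isClosedEmbedding.isClosed_range.isOpen_compl⟩ :
      X.left.Opens))

lemma IsAbstractBlowup.w {S : Scheme.{u}} {X X' Z Z' : SchProper S}
    {q : Z' ⟶ X'} {p : Z' ⟶ Z} {π : X' ⟶ X} {i : Z ⟶ X} (h : IsAbstractBlowup q p π i) :
    q ≫ π = p ≫ i :=
  MorphismProperty.Over.Hom.ext h.isPullback.w

/-- A proper cdh-cover: a proper morphism `f : X' ⟶ X` such that every point `x` of `X` is the
image of a point `x'` of `X'` for which `k(x) ⟶ k(x')` is an isomorphism. -/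
structure IsProperCdhCover {X' X : Scheme.{u}} (f : X' ⟶ X) : Prop where
  isProper : IsProper f
  exists_point : ∀ x : X, ∃ x' : X', f x' = x ∧ IsIso (f.residueFieldMap x')

/-! ### Coskeleta and hyperenvelopes -/

/-- Finite limits suffice for the existence of `n`-coskeleta. -/
instance hasRightKanExtension_inclusion {C : Type*} [Category* C] [HasFiniteLimits C] (n : ℕ)
    (F : (SimplexCategory.Truncated n)ᵒᵖ ⥤ C) :
    (SimplexCategory.Truncated.inclusion n).op.HasRightKanExtension F := by
  have hhom (a b : (SimplexCategory.Truncated n)ᵒᵖ) : Finite (a ⟶ b) :=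
    Finite.of_injective (fun f => f.unop.hom) (fun f g h => by
      apply Quiver.Hom.unop_inj
      exact ObjectProperty.hom_ext _ h)
  have hobj : Finite (SimplexCategory.Truncated n)ᵒᵖ :=
    Finite.of_injective (fun a => (⟨a.unop.obj.len, Nat.lt_succ_of_le a.unop.property⟩ : Fin (n + 1)))
      (fun a b h => by
        apply Opposite.unop_injective
        apply ObjectProperty.FullSubcategory.ext
        exact SimplexCategory.ext (by simpa using h))
  have (Y : SimplexCategoryᵒᵖ) :
      (SimplexCategory.Truncated.inclusion n).op.HasPointwiseRightKanExtensionAt F Y := by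
    have (a : (SimplexCategory.Truncated n)ᵒᵖ) :
        Finite (Y ⟶ (SimplexCategory.Truncated.inclusion n).op.obj a) :=
      Finite.of_injective (fun f => f.unop) (fun f g h => Quiver.Hom.unop_inj h)
    have h1 : Finite (StructuredArrow Y (SimplexCategory.Truncated.inclusion n).op) :=
      Finite.of_injective (β := Σ a, (Y ⟶ (SimplexCategory.Truncated.inclusion n).op.obj a))
        (fun x => ⟨x.right, x.hom⟩) (fun x y h => by
          obtain ⟨⟨⟨⟩⟩, x, f⟩ := x
          obtain ⟨⟨⟨⟩⟩, y, g⟩ := y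
          simp only [Sigma.mk.injEq] at h
          obtain ⟨rfl, h⟩ := h
          obtain rfl := eq_of_heq h
          rfl)
    have h2 (x y : StructuredArrow Y (SimplexCategory.Truncated.inclusion n).op) :
        Finite (x ⟶ y) :=
      Finite.of_injective (fun f => f.right) (fun f g h => StructuredArrow.ext _ _ h)
    let : FinCategory (StructuredArrow Y (SimplexCategory.Truncated.inclusion n).op) :=
      { fintypeObj := Fintype.ofFinite _
        fintypeHom := fun _ _ => Fintype.ofFinite _ }
    exact (inferInstance : HasLimit
      (StructuredArrow.proj Y (SimplexCategory.Truncated.inclusion n).op ⋙ F))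
  have : (SimplexCategory.Truncated.inclusion n).op.HasPointwiseRightKanExtension F := this
  infer_instance

/-- The simplicial object of the category of schemes over `X` which underlies an augmented
simplicial scheme `a : Y ⟶ X`. -/
abbrev toOver {S : Scheme.{u}} {X : SchProper S} {Y : SimplicialObject (SchProper S)}
    (a : Y ⟶ (SimplicialObject.const (SchProper S)).obj X) :
    SimplicialObject (Over X.left) :=
  Over.lift (Y ⋙ MorphismProperty.Over.forget _ _ S ⋙ Over.forget S)
    { app := fun n => (a.app n).left
      naturality := fun _ _ f => congrArg (fun g => g.left) (a.naturality f) }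

/-- A hyperenvelope of `X`: an augmented simplicial scheme `a : Y ⟶ X` such that
`Y_{n+1} ⟶ (cosk_n Y)_{n+1}` is a proper cdh-cover for all `n ≥ -1`. Here the coskeleton is that
of simplicial schemes over `X`, and `cosk_{-1} Y` is the constant simplicial scheme `X`. -/
structure IsHyperenvelope {S : Scheme.{u}} {X : SchProper S}
    {Y : SimplicialObject (SchProper S)}
    (a : Y ⟶ (SimplicialObject.const (SchProper S)).obj X) : Prop where
  zero : IsProperCdhCover (a.app (op (SimplexCategory.mk 0))).left
  succ : ∀ n : ℕ, IsProperCdhCover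
    (((SimplicialObject.coskAdj n).unit.app (toOver a)).app
      (op (SimplexCategory.mk (n + 1)))).left

/-! ### Complexes -/

/-- For a commutative square of chain complexes, the canonical morphism
`Cone(A ⟶ B ⊞ C) ⟶ D`, where the first map has components `f` and `-g`. -/
def coneToCorner {A B C D : ChainComplex AddCommGrpCat.{v} ℤ}
    (f : A ⟶ B) (g : A ⟶ C) (h : B ⟶ D) (k : C ⟶ D) (w : f ≫ h = g ≫ k) :
    HomologicalComplex.homotopyCofiber (biprod.lift f (-g)) ⟶ D :=
  HomologicalComplex.homotopyCofiber.desc (biprod.lift f (-g)) (biprod.desc h k)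
    (Homotopy.ofEq (by simp [w]))

/-- The functor `F` turns abstract blow-up squares into distinguished triangles
`F(Z') ⟶ F(X') ⊞ F(Z) ⟶ F(X) ⟶ F(Z')[1]`: the morphism from the cone of
`F(Z') ⟶ F(X') ⊞ F(Z)` to `F(X)` which is induced by the square is a quasi-isomorphism. -/
def HasBlowupTriangles {S : Scheme.{u}}
    (F : SchProper S ⥤ ChainComplex AddCommGrpCat.{v} ℤ) : Prop :=
  ∀ ⦃X X' Z Z' : SchProper S⦄ (q : Z' ⟶ X') (p : Z' ⟶ Z) (π : X' ⟶ X) (i : Z ⟶ X)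
    (h : IsAbstractBlowup q p π i),
    QuasiIso (coneToCorner (F.map q) (F.map p) (F.map π) (F.map i)
      (by rw [← F.map_comp, ← F.map_comp, h.w]))

/-- The indices and signs of the total complex of a chain complex (indexed by `ℕ`) of chain
complexes (indexed by `ℤ`): bidegree `(p, q)` lies in total degree `p + q`, and the differential
is `d₁ + (-1)^p d₂`. -/
instance totalComplexShape :
    TotalComplexShape (ComplexShape.down ℕ) (ComplexShape.down ℤ) (ComplexShape.down ℤ) where
  π := fun ⟨p, q⟩ => (p : ℤ) + q
  ε₁ := fun _ => 1
  ε₂ := fun ⟨p, _⟩ => (p : ℤ).negOnePow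
  rel₁ := by
    rintro p p' h q
    simp only [ComplexShape.down_Rel] at h ⊢
    omega
  rel₂ := by
    rintro p q q' h
    simp only [ComplexShape.down_Rel] at h ⊢
    omega
  ε₂_ε₁ := by
    rintro p p' q q' h -
    simp only [ComplexShape.down_Rel] at h
    subst h
    simp [Int.negOnePow_succ]

/-- The double complex of a simplicial chain complex, with horizontal differential the alternating
sum of the faces. -/
abbrev doubleComplex (K : SimplicialObject (ChainComplex AddCommGrpCat.{v} ℤ)) :
    HomologicalComplex₂ AddCommGrpCat.{v} (ComplexShape.down ℕ) (ComplexShape.down ℤ) :=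
  (AlgebraicTopology.alternatingFaceMapComplex _).obj K

/-- The total complex of a simplicial chain complex `K`: in degree `n` it is the direct sum of
the groups `(K_p)_q` with `p + q = n`. -/
abbrev totalComplex (K : SimplicialObject (ChainComplex AddCommGrpCat.{v} ℤ)) :
    ChainComplex AddCommGrpCat.{v} ℤ :=
  (doubleComplex K).total (ComplexShape.down ℤ)

lemma doubleComplex_d_comp {K : SimplicialObject (ChainComplex AddCommGrpCat.{v} ℤ)}
    {L : ChainComplex AddCommGrpCat.{v} ℤ}
    (ε : K ⟶ (SimplicialObject.const (ChainComplex AddCommGrpCat.{v} ℤ)).obj L) :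
    (doubleComplex K).d 1 0 ≫ ε.app (op (SimplexCategory.mk 0)) = 0 := by
  rw [AlgebraicTopology.alternatingFaceMapComplex_obj_d,
    AlgebraicTopology.AlternatingFaceMapComplex.objD, Fin.sum_univ_two, Fin.val_zero,
    pow_zero, one_smul, Fin.val_one, pow_one, neg_smul, one_smul, Preadditive.add_comp,
    Preadditive.neg_comp, SimplicialObject.δ_naturality, SimplicialObject.δ_naturality]
  exact add_neg_cancel _

/-- The morphism from the total complex of a simplicial chain complex `K` to `L` induced by an
augmentation `ε : K ⟶ L`: it is `ε` on `K_0` and zero on `K_p` for `p > 0`. -/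
def augmentationMap {K : SimplicialObject (ChainComplex AddCommGrpCat.{v} ℤ)}
    {L : ChainComplex AddCommGrpCat.{v} ℤ}
    (ε : K ⟶ (SimplicialObject.const (ChainComplex AddCommGrpCat.{v} ℤ)).obj L) :
    totalComplex K ⟶ L where
  f n := (doubleComplex K).totalDesc fun p q h =>
    match p, h with
    | 0, h => (ε.app (op (SimplexCategory.mk 0))).f q ≫ (L.XIsoOfEq (by
        simpa [ComplexShape.π, TotalComplexShape.π] using h)).hom
    | _ + 1, _ => 0
  comm' := by
    intro n n' hn
    apply HomologicalComplex₂.total.hom_ext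
    intro p q h
    have h' : (p : ℤ) + q = n := h
    have hn' : n' + 1 = n := hn
    have hq : (ComplexShape.down ℤ).Rel q (q - 1) := by simp
    rw [HomologicalComplex₂.ι_totalDesc_assoc, HomologicalComplex₂.total_d,
      Preadditive.add_comp, Preadditive.comp_add, HomologicalComplex₂.ι_D₁_assoc,
      HomologicalComplex₂.ι_D₂_assoc,
      HomologicalComplex₂.d₂_eq (doubleComplex K) _ p hq n' (show (p : ℤ) + (q - 1) = n' by omega)]
    match p, h, h' with
    | 0, h, h' =>
      rw [HomologicalComplex₂.d₁_eq_zero _ _ _ _ _ (by simp)]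
      have hε : ComplexShape.ε₂ (ComplexShape.down ℕ) (ComplexShape.down ℤ)
          (ComplexShape.down ℤ) (0, q) = 1 := Int.negOnePow_zero
      have hq' : q - 1 = n' := by omega
      subst hq'
      rw [hε]
      simp
    | 1, h, h' =>
      rw [HomologicalComplex₂.d₁_eq (doubleComplex K) _
        (show (ComplexShape.down ℕ).Rel 1 0 by simp) q n' (show ((0 : ℕ) : ℤ) + q = n' by omega)]
      simp only [Linear.units_smul_comp, Category.assoc, HomologicalComplex₂.ι_totalDesc]
      have h0 := congrArg (fun φ => φ.f q) (doubleComplex_d_comp ε)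
      simp only [HomologicalComplex.comp_f, HomologicalComplex.zero_f] at h0
      rw [reassoc_of% h0]
      simp
    | p + 2, h, h' =>
      rw [HomologicalComplex₂.d₁_eq (doubleComplex K) _
        (show (ComplexShape.down ℕ).Rel (p + 2) (p + 1) by simp) q n'
          (show ((p + 1 : ℕ) : ℤ) + q = n' by omega)]
      simp only [Linear.units_smul_comp, Category.assoc, HomologicalComplex₂.ι_totalDesc]
      simp

/-- The augmentation map `F(Y) ⟶ F(X)` of an augmented simplicial scheme `a : Y ⟶ X`, where
`F(Y)` is the total complex of the simplicial complex `n ↦ F(Y_n)`. -/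
def descentMap {S : Scheme.{u}} (F : SchProper S ⥤ ChainComplex AddCommGrpCat.{v} ℤ)
    {X : SchProper S} {Y : SimplicialObject (SchProper S)}
    (a : Y ⟶ (SimplicialObject.const (SchProper S)).obj X) :
    totalComplex (Y ⋙ F) ⟶ F.obj X :=
  augmentationMap
    { app := fun n => F.map (a.app n)
      naturality := fun m n f => by
        rw [Functor.comp_map, ← F.map_comp, a.naturality f]
        exact (F.map_comp _ _).trans (congrArg _ (F.map_id X)) }

end HomologicalDescent

end

/-! The augmentation map is a quasi-isomorphism as soon as the total complex of the augmented
sequence `⋯ ⟶ F(Y₁) ⟶ F(Y₀) ⟶ F(X)` is exact (`quasiIso_augmentationMap`). The whole proof is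
therefore about exactness of total complexes, one degree at a time and with finitely supported
families of elements. The main tool is `TotExact.of_double`: if the columns of a double complex of
complexes are exact, then exactness of the zeroth row in degree `m` follows from exactness of row `q
≥ 1` in degree `m + 1 - q`.

Čech descent for a proper cdh-cover `f : V ⟶ X` (`altExact_cech`) is proved by noetherian induction
on the closed subsets of `X`. Blow-up squares with empty upper row allow closed subschemes to be
replaced by their reductions. On a nonempty reduced closed `T`, the local ring at the generic point
of a component is a field. The cdh condition lifts this point to the cover, and spreading out gives
a section over a nonempty open `U`. The scheme-theoretic image `T'` of the section is proper over
`T` and isomorphic to it over `U`, so `T'` and the closed complement `Z` of `U` define an abstract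
blow-up square. Over `T'` and `T' ×_T Z` the nerve is contractible, because both map to `V` over
`X`. Over `Z` the induction hypothesis applies. The blow-up triangles, base changed to every term of
the nerve, give the claim over `T`.

The passage from Čech nerves to hypercovers (`altExact_of_isHypercover`) is an induction on the
degree `m`, which starts below `N`, where the homology vanishes. Consider the fibre powers of the
zeroth face from the décalage of `Y` to `Y`. The columns are Čech nerves of the zeroth faces, which
are split except for `Y₀ ⟶ X`, which is a cover, so Čech descent makes all columns exact. Row zero
is `Y`, and row one is the décalage, which is contractible. The other rows are again hypercovers,
and they are needed only in degrees below `m`.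

Finally, a hyperenvelope is a hypercover in the sense of filling boundaries after a cover
(`IsHyperenvelope.isHypercover`), because a compatible family of faces is a morphism to the
coskeleton. -/

noncomputable section

namespace HomologicalDescent

/-! ### Elementwise total complexes -/

/-- Families of elements of a complex, one in each degree. -/
abbrev Elt (A : ChainComplex AddCommGrpCat.{v} ℤ) : Type v := ∀ i : ℤ, A.X i

namespace Elt

variable {A B C : ChainComplex AddCommGrpCat.{v} ℤ}

/-- The differential on families of elements. -/
def d (A : ChainComplex AddCommGrpCat.{v} ℤ) : Elt A →+ Elt A where
  toFun x i := (A.d (i + 1) i).hom (x (i + 1))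
  map_zero' := by funext i; simp
  map_add' x y := by funext i; simp

/-- The action of a morphism of complexes on families of elements. -/
def map (f : A ⟶ B) : Elt A →+ Elt B where
  toFun x i := (f.f i).hom (x i)
  map_zero' := by funext i; simp
  map_add' x y := by funext i; simp

lemma d_apply (x : Elt A) (i : ℤ) : d A x i = (A.d (i + 1) i).hom (x (i + 1)) := rfl

lemma map_apply (f : A ⟶ B) (x : Elt A) (i : ℤ) : map f x i = (f.f i).hom (x i) := rfl

lemma d_d (x : Elt A) : d A (d A x) = 0 := by
  funext i
  simp only [d_apply]
  rw [← AddCommGrpCat.comp_apply, A.d_comp_d]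
  rfl

lemma map_d (f : A ⟶ B) (x : Elt A) : map f (d A x) = d B (map f x) := by
  funext i
  simp only [d_apply, map_apply]
  rw [← AddCommGrpCat.comp_apply, ← AddCommGrpCat.comp_apply, f.comm]

lemma map_comp (f : A ⟶ B) (g : B ⟶ C) (x : Elt A) : map (f ≫ g) x = map g (map f x) := by
  funext i
  simp [map_apply]

@[simp] lemma map_id (x : Elt A) : map (𝟙 A) x = x := by
  funext i
  simp [map_apply]

@[simp] lemma map_zero_hom (x : Elt A) : map (0 : A ⟶ B) x = 0 := by
  funext i
  simp [map_apply]

lemma map_add_hom (f g : A ⟶ B) (x : Elt A) : map (f + g) x = map f x + map g x := by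
  funext i
  simp [map_apply]

/-- A family of elements is homogeneous of degree `m` if it is concentrated in degree `m`. -/
def HasDegree (m : ℤ) (x : Elt A) : Prop := ∀ i, i ≠ m → x i = 0

namespace HasDegree

lemma congr {m m' : ℤ} {x : Elt A} (h : HasDegree m x) (e : m = m') : HasDegree m' x := e ▸ h

lemma zero (m : ℤ) : HasDegree m (0 : Elt A) := fun _ _ => rfl

lemma add {m : ℤ} {x y : Elt A} (hx : HasDegree m x) (hy : HasDegree m y) :
    HasDegree m (x + y) := fun i hi => by simp [hx i hi, hy i hi]

lemma sub {m : ℤ} {x y : Elt A} (hx : HasDegree m x) (hy : HasDegree m y) :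
    HasDegree m (x - y) := fun i hi => by simp [hx i hi, hy i hi]

lemma zsmul {m : ℤ} {x : Elt A} (hx : HasDegree m x) (k : ℤ) : HasDegree m (k • x) :=
  fun i hi => by simp [hx i hi]

lemma map {m : ℤ} {x : Elt A} (hx : HasDegree m x) (f : A ⟶ B) : HasDegree m (map f x) :=
  fun i hi => by simp [map_apply, hx i hi]

lemma d {m : ℤ} {x : Elt A} (hx : HasDegree m x) : HasDegree (m - 1) (d A x) :=
  fun i hi => by
    rw [d_apply, hx (i + 1) (by omega), _root_.map_zero]

end HasDegree

end Elt

open Elt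

/-- The total complex of a sequence of complexes `⋯ ⟶ K 2 ⟶ K 1 ⟶ K 0` is exact in degree `m`. -/
def TotExact (K : ℕ → ChainComplex AddCommGrpCat.{v} ℤ) (del : ∀ n, K (n + 1) ⟶ K n)
    (m : ℤ) : Prop :=
  ∀ x : ∀ n, Elt (K n), (∃ b, ∀ n, b ≤ n → x n = 0) → (∀ n : ℕ, HasDegree (m - n) (x n)) →
    (∀ n, map (del n) (x (n + 1)) + (-1 : ℤ) ^ n • d _ (x n) = 0) →
    ∃ y : ∀ n, Elt (K n), (∃ b, ∀ n, b ≤ n → y n = 0) ∧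
      (∀ n : ℕ, HasDegree (m + 1 - n) (y n)) ∧
      ∀ n, map (del n) (y (n + 1)) + (-1 : ℤ) ^ n • d _ (y n) = x n

/-! ### Criteria for exactness of a total complex -/

namespace TotExact

variable {K L : ℕ → ChainComplex AddCommGrpCat.{v} ℤ} {del : ∀ n, K (n + 1) ⟶ K n}
  {del' : ∀ n, L (n + 1) ⟶ L n} {m : ℤ}

/-- Rescaling component `n` by a power of `e` absorbs an extra sign in the internal differential.
Such signs occur in the rows of a double complex, and when a complex is compared with its augmented
version, which begins one column earlier. -/
lemma twist (h : TotExact K del m) (e : ℤ) (he : e * e = 1) (x : ∀ n, Elt (K n))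
    (hb : ∃ b, ∀ n, b ≤ n → x n = 0) (hdeg : ∀ n : ℕ, HasDegree (m - n) (x n))
    (hx : ∀ n, map (del n) (x (n + 1)) + ((-1 : ℤ) ^ n * e) • d _ (x n) = 0) :
    ∃ y : ∀ n, Elt (K n), (∃ b, ∀ n, b ≤ n → y n = 0) ∧
      (∀ n : ℕ, HasDegree (m + 1 - n) (y n)) ∧
      ∀ n, map (del n) (y (n + 1)) + ((-1 : ℤ) ^ n * e) • d _ (y n) = x n := by
  have hee (n : ℕ) : e ^ n * e ^ n = 1 := by rw [← mul_pow, he, one_pow]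
  obtain ⟨b, hb⟩ := hb
  obtain ⟨y, ⟨b', hb'⟩, hdeg', hy⟩ := h (fun n => e ^ n • x n) ⟨b, fun n hn => by simp [hb n hn]⟩
    (fun n => (hdeg n).zsmul _) (fun n => by
      have := congrArg (fun t => e ^ (n + 1) • t) (hx n)
      simp only [smul_add, smul_zero, smul_smul, map_zsmul] at this ⊢
      rw [← this]
      congr 2
      rw [pow_succ]
      linear_combination (-(e ^ n * (-1) ^ n)) * he)
  refine ⟨fun n => e ^ (n + 1) • y n, ⟨b', fun n hn => by simp [hb' n hn]⟩,
    fun n => (hdeg' n).zsmul _, fun n => ?_⟩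
  have := congrArg (fun t => e ^ n • t) (hy n)
  simp only [smul_add, smul_smul, map_zsmul, hee, one_smul] at this ⊢
  rw [← this]
  congr 2
  · rw [pow_succ, pow_succ]
    linear_combination (e ^ n) * he
  · rw [pow_succ]
    linear_combination (e ^ n * (-1) ^ n) * he

/-- The contraction raises the column index by one and thus flips the sign of the internal
differential, so that the two terms containing the internal differential cancel. -/
lemma of_contraction (s : ∀ n, K n ⟶ K (n + 1)) (h0 : s 0 ≫ del 0 = 𝟙 _)
    (hs : ∀ n, s (n + 1) ≫ del (n + 1) + del n ≫ s n = 𝟙 _) (m : ℤ) : TotExact K del m := by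
  rintro x ⟨b, hb⟩ hdeg hx
  refine ⟨fun n => match n with
    | 0 => 0
    | n + 1 => map (s n) (x n), ⟨b + 1, ?_⟩, ?_, ?_⟩
  · rintro (_ | n) hn
    · rfl
    · simp [hb n (by omega)]
  · rintro (_ | n)
    · exact HasDegree.zero _
    · exact ((hdeg n).map _).congr (by push_cast; ring)
  · rintro (_ | n)
    · simp [← map_comp, h0]
    · have h1 := congrArg (map (s n)) (hx n)
      simp only [map_add, map_zsmul, map_zero, map_d] at h1
      have h2 := congrArg (fun f => map f (x (n + 1))) (hs n)
      simp only [map_add_hom, map_comp, map_id] at h2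
      simp only
      rw [eq_neg_of_add_eq_zero_left h1] at h2
      simpa [pow_succ] using h2

/-- The component in the last nonzero column is a cycle for the internal differential, hence a
boundary. Subtracting a total boundary removes this column, and finite support makes the process
stop. -/
lemma of_exact (h : ∀ (n : ℕ) (x : Elt (K n)), HasDegree (m - n) x → d _ x = 0 →
    ∃ y : Elt (K n), HasDegree (m - n + 1) y ∧ d _ y = x)
    (hdel : ∀ n, del (n + 1) ≫ del n = 0) : TotExact K del m := by
  rintro x ⟨b, hb⟩ hdeg hx
  induction b generalizing x with
  | zero =>
    refine ⟨fun n => 0, ⟨0, fun _ _ => rfl⟩, fun n => HasDegree.zero _, fun n => ?_⟩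
    simp [hb n (by omega)]
  | succ b ih =>
    obtain ⟨y, hy, hy'⟩ := h b (x b) (hdeg b) (by
      have := hx b
      rw [hb (b + 1) le_rfl, map_zero, zero_add] at this
      have h2 := congrArg (fun t => (-1 : ℤ) ^ b • t) this
      simpa [smul_smul, ← mul_pow] using h2)
    let z : ∀ n, Elt (K n) := Pi.single b ((-1 : ℤ) ^ b • y)
    have hzb : z b = (-1 : ℤ) ^ b • y := Pi.single_eq_same _ _
    have hz {n : ℕ} (hn : n ≠ b) : z n = 0 := Pi.single_eq_of_ne hn _
    have hdegz (n : ℕ) : HasDegree (m + 1 - n) (z n) := by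
      by_cases hn : n = b
      · subst hn
        rw [hzb]
        exact (hy.zsmul _).congr (by ring)
      · rw [hz hn]
        exact HasDegree.zero _
    obtain ⟨w, ⟨b', hb'⟩, hw, hw'⟩ :=
      ih (fun n => x n - (map (del n) (z (n + 1)) + (-1 : ℤ) ^ n • d _ (z n)))
      (fun n hn => by
        rw [hz (by omega : n + 1 ≠ b)]
        obtain rfl | hn' := eq_or_lt_of_le hn
        · rw [hzb]
          simp [smul_smul, ← mul_pow, hy']
        · rw [hz (by omega : n ≠ b), hb n (by omega)]
          simp)
      (fun n => (hdeg n).sub ((((hdegz (n + 1)).map _).congr (by push_cast; ring)).add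
        (((hdegz n).d.zsmul _).congr (by ring))))
      (fun n => by
        have h1 := hx n
        simp only [map_sub, map_add, map_zsmul, ← map_comp, hdel, map_zero_hom, d_d, smul_sub,
          ← map_d, smul_zero, add_zero, zero_add, pow_succ]
        rw [← h1]
        simp)
    refine ⟨w + z, ⟨max b' (b + 1), fun n hn => ?_⟩, fun n => (hw n).add (hdegz n), fun n => ?_⟩
    · simp only [Pi.add_apply]
      rw [hb' n (le_trans (le_max_left _ _) hn), hz (by have := le_trans (le_max_right _ _) hn; omega),
        add_zero]
    · have := hw' n
      simp only [Pi.add_apply, map_add, smul_add]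
      rw [← sub_eq_zero] at this ⊢
      rw [← this]
      abel

lemma of_levelwise_iso (e : ∀ n, K n ≅ L n) (he : ∀ n, (e (n + 1)).hom ≫ del' n = del n ≫ (e n).hom)
    (h : TotExact K del m) : TotExact L del' m := by
  rintro x ⟨b, hb⟩ hdeg hx
  have he' (n : ℕ) : (e (n + 1)).inv ≫ del n = del' n ≫ (e n).inv := by
    rw [Iso.inv_comp_eq, ← Category.assoc, he, Category.assoc, Iso.hom_inv_id, Category.comp_id]
  obtain ⟨y, ⟨b', hb'⟩, hy, hy'⟩ := h (fun n => map (e n).inv (x n))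
    ⟨b, fun n hn => by simp [hb n hn]⟩ (fun n => (hdeg n).map _) (fun n => by
      have := congrArg (map (e n).inv) (hx n)
      simpa [map_zsmul, map_d, ← map_comp, he'] using this)
  refine ⟨fun n => map (e n).hom (y n), ⟨b', fun n hn => by simp [hb' n hn]⟩,
    fun n => (hy n).map _, fun n => ?_⟩
  have := congrArg (map (e n).hom) (hy' n)
  simpa [map_zsmul, map_d, ← map_comp, he] using this

lemma of_isZero (h : ∀ n, IsZero (K n)) : TotExact K del m := by
  have h0 (n : ℕ) (x : Elt (K n)) : x = 0 := by
    rw [← map_id x, (h n).eq_of_src (𝟙 _) 0, map_zero_hom]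
  intro x _ _ _
  exact ⟨fun n => 0, ⟨0, fun _ _ => rfl⟩, fun n => HasDegree.zero _,
    fun n => (h0 _ _).trans (h0 _ _).symm⟩

end TotExact

/-! ### Double complexes of complexes -/

section Double

variable {K : ℕ → ℕ → ChainComplex AddCommGrpCat.{v} ℤ} (h : ∀ n q, K (n + 1) q ⟶ K n q)
  (w : ∀ n q, K n (q + 1) ⟶ K n q)

/-- The differential of the total complex of a double complex of complexes. -/
def doubleD : (∀ n q, Elt (K n q)) →+ (∀ n q, Elt (K n q)) where
  toFun x n q := map (h n q) (x (n + 1) q) +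
    (-1 : ℤ) ^ n • (map (w n q) (x n (q + 1)) + (-1 : ℤ) ^ q • d _ (x n q))
  map_zero' := by funext n q; simp
  map_add' x y := by
    funext n q
    simp only [Pi.add_apply, map_add, smul_add]
    abel

lemma doubleD_apply (x : ∀ n q, Elt (K n q)) (n q : ℕ) :
    doubleD h w x n q = map (h n q) (x (n + 1) q) +
      (-1 : ℤ) ^ n • (map (w n q) (x n (q + 1)) + (-1 : ℤ) ^ q • d _ (x n q)) := rfl

lemma doubleD_doubleD (hh : ∀ n q, h (n + 1) q ≫ h n q = 0)
    (ww : ∀ n q, w n (q + 1) ≫ w n q = 0)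
    (hw : ∀ n q, h n (q + 1) ≫ w n q = w (n + 1) q ≫ h n q) (x : ∀ n q, Elt (K n q)) :
    doubleD h w (doubleD h w x) = 0 := by
  funext n q
  simp only [doubleD_apply, map_add, map_zsmul, map_d, ← map_comp, hh, ww, hw, map_zero_hom,
    smul_add, d_d, smul_zero, zero_add, add_zero, pow_succ, mul_neg, mul_one, neg_smul,
    map_neg, smul_neg]
  simp only [Pi.zero_apply]
  module

lemma doubleD_hasDegree {m : ℤ} {x : ∀ n q, Elt (K n q)}
    (hx : ∀ n q : ℕ, HasDegree (m + 1 - n - q) (x n q)) (n q : ℕ) :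
    HasDegree (m - n - q) (doubleD h w x n q) :=
  (((hx (n + 1) q).map _).congr (by push_cast; ring)).add
    (((((hx n (q + 1)).map _).congr (by push_cast; ring)).add
      (((hx n q).d.zsmul _).congr (by ring))).zsmul _)

/-- The part of a total cycle in its last nonzero column is a cycle of that column. Bounding it
there and subtracting the total boundary lowers the horizontal bound `b`; the vertical support stays
finite. -/
lemma doubleD_exact_of_columns (hh : ∀ n q, h (n + 1) q ≫ h n q = 0)
    (ww : ∀ n q, w n (q + 1) ≫ w n q = 0)
    (hw : ∀ n q, h n (q + 1) ≫ w n q = w (n + 1) q ≫ h n q)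
    (col : ∀ n i, TotExact (K n) (w n) i) (m : ℤ) (b : ℕ) (x : ∀ n q, Elt (K n q))
    (hb : ∀ n q, b ≤ n → x n q = 0) (hc : ∃ c, ∀ n q, c ≤ q → x n q = 0)
    (hdeg : ∀ n q : ℕ, HasDegree (m - n - q) (x n q)) (hx : doubleD h w x = 0) :
    ∃ y : ∀ n q, Elt (K n q), (∀ n q, b ≤ n → y n q = 0) ∧ (∃ c, ∀ n q, c ≤ q → y n q = 0) ∧
      (∀ n q : ℕ, HasDegree (m + 1 - n - q) (y n q)) ∧ doubleD h w y = x := by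
  induction b generalizing x with
  | zero =>
    refine ⟨0, fun _ _ _ => rfl, ⟨0, fun _ _ _ => rfl⟩, fun _ _ => HasDegree.zero _, ?_⟩
    rw [map_zero]
    funext n q
    exact (hb n q (Nat.zero_le _)).symm
  | succ b ih =>
    obtain ⟨c, hc⟩ := hc
    have hs (n : ℕ) : (-1 : ℤ) ^ n * (-1) ^ n = 1 := by simp [← mul_pow]
    obtain ⟨y, ⟨c', hc'⟩, hy, hy'⟩ := col b (m - b) (x b) ⟨c, hc b⟩ (hdeg b) (fun q => by
      have := congrFun (congrFun hx b) q
      rw [doubleD_apply, hb (b + 1) q le_rfl, map_zero, zero_add] at this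
      have h2 := congrArg (fun t => (-1 : ℤ) ^ b • t) this
      simpa only [smul_smul, hs, one_smul, Pi.zero_apply, smul_zero] using h2)
    let z : ∀ n q, Elt (K n q) := Pi.single b ((-1 : ℤ) ^ b • y)
    have hzb (q : ℕ) : z b q = (-1 : ℤ) ^ b • y q :=
      congrFun (show z b = (-1 : ℤ) ^ b • y from Pi.single_eq_same _ _) q
    have hz {n : ℕ} (hn : n ≠ b) (q : ℕ) : z n q = 0 :=
      congrFun (show z n = 0 from Pi.single_eq_of_ne hn _) q
    have hzc (n q : ℕ) (hq : c' ≤ q) : z n q = 0 := by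
      by_cases hn : n = b
      · subst hn
        rw [hzb, hc' q hq, smul_zero]
      · exact hz hn q
    have hdegz (n q : ℕ) : HasDegree (m + 1 - n - q) (z n q) := by
      by_cases hn : n = b
      · subst hn
        rw [hzb]
        exact ((hy q).zsmul _).congr (by ring)
      · rw [hz hn]
        exact HasDegree.zero _
    obtain ⟨u, hub, ⟨c'', hu⟩, hudeg, hux⟩ := ih (x - doubleD h w z)
      (fun n q hn => by
        simp only [Pi.sub_apply]
        rw [doubleD_apply, hz (by omega : n + 1 ≠ b)]
        obtain rfl | hn' := eq_or_lt_of_le hn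
        · simp only [hzb, map_zsmul, smul_smul, hs, map_zero, zero_add, smul_add, one_smul]
          rw [← hy' q, mul_left_comm, hs, mul_one]
          exact sub_self _
        · rw [hz (by omega : n ≠ b), hz (by omega : n ≠ b), hb n q (by omega)]
          simp)
      ⟨max c c', fun n q hq => by
        simp only [Pi.sub_apply]
        rw [doubleD_apply, hzc _ _ (le_trans (le_max_right _ _) hq),
          hzc _ _ (le_trans (le_max_right _ _) hq),
          hzc _ _ (le_trans (le_trans (le_max_right _ _) hq) (Nat.le_succ _)),
          hc _ _ (le_trans (le_max_left _ _) hq)]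
        simp⟩
      (fun n q => (hdeg n q).sub (doubleD_hasDegree h w hdegz n q))
      (by rw [map_sub, doubleD_doubleD h w hh ww hw, hx, sub_zero])
    refine ⟨u + z, fun n q hn => ?_, ⟨max c'' c', fun n q hq => ?_⟩,
      fun n q => (hudeg n q).add (hdegz n q), ?_⟩
    · simp only [Pi.add_apply]
      rw [hub n q (by omega), hz (by omega), add_zero]
    · simp only [Pi.add_apply]
      rw [hu _ _ (le_trans (le_max_left _ _) hq), hzc _ _ (le_trans (le_max_right _ _) hq),
        add_zero]
    · rw [map_add, hux, sub_add_cancel]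

/-- If the total differential of `y` lies in row zero, then the part of `y` in its highest row `r +
1` is a cycle of that row. Bounding it there and subtracting the total boundary pushes `y` down one
row without changing its differential. -/
lemma exists_doubleD_eq_of_rows (hh : ∀ n q, h (n + 1) q ≫ h n q = 0)
    (ww : ∀ n q, w n (q + 1) ≫ w n q = 0)
    (hw : ∀ n q, h n (q + 1) ≫ w n q = w (n + 1) q ≫ h n q) (m : ℤ)
    (row : ∀ q : ℕ, TotExact (fun n => K n (q + 1)) (fun n => h n (q + 1)) (m - q)) (r : ℕ)
    (y : ∀ n q, Elt (K n q)) (hr : ∀ n q, r < q → y n q = 0)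
    (hb : ∃ b, ∀ n q, b ≤ n → y n q = 0)
    (hdeg : ∀ n q : ℕ, HasDegree (m + 1 - n - q) (y n q))
    (hy : ∀ n q, doubleD h w y n (q + 1) = 0) :
    ∃ z : ∀ n q, Elt (K n q), (∀ n q, 0 < q → z n q = 0) ∧ (∃ b, ∀ n q, b ≤ n → z n q = 0) ∧
      (∀ n q : ℕ, HasDegree (m + 1 - n - q) (z n q)) ∧ doubleD h w z = doubleD h w y := by
  induction r generalizing y with
  | zero => exact ⟨y, hr, hb, hdeg, rfl⟩
  | succ r ih =>
    obtain ⟨b, hb⟩ := hb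
    -- In row `r + 1` the internal differential carries the additional sign `(-1) ^ (r + 1)`, whence
    -- the twist.
    obtain ⟨t, ⟨b', hb'⟩, htdeg, ht⟩ := (row r).twist ((-1 : ℤ) ^ (r + 1)) (by simp [← mul_pow])
      (fun n => y n (r + 1)) ⟨b, fun n hn => hb n _ hn⟩
      (fun n => (hdeg n (r + 1)).congr (by push_cast; ring)) (fun n => by
        have := hy n r
        rwa [doubleD_apply, hr n (r + 1 + 1) (by omega), map_zero, zero_add, smul_smul] at this)
    let z : ∀ n q, Elt (K n q) := fun n => Pi.single (r + 1) (t n)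
    have hzr (n : ℕ) : z n (r + 1) = t n := Pi.single_eq_same _ _
    have hz (n : ℕ) {q : ℕ} (hq : q ≠ r + 1) : z n q = 0 := Pi.single_eq_of_ne hq _
    have hzb (n q : ℕ) (hn : b' ≤ n) : z n q = 0 := by
      by_cases hq : q = r + 1
      · subst hq
        rw [hzr, hb' n hn]
      · exact hz n hq
    have hdegz (n q : ℕ) : HasDegree (m + 1 + 1 - n - q) (z n q) := by
      by_cases hq : q = r + 1
      · subst hq
        rw [hzr]
        exact (htdeg n).congr (by push_cast; ring)
      · rw [hz n hq]
        exact HasDegree.zero _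
    obtain ⟨u, hu1, hu2, hu3, hu4⟩ := ih (y - doubleD h w z)
      (fun n q hq => by
        simp only [Pi.sub_apply]
        rw [doubleD_apply, hz _ (by omega : q + 1 ≠ r + 1)]
        obtain rfl | hq' := eq_or_lt_of_le (Nat.succ_le_of_lt hq)
        · have := ht n
          simp only [Nat.succ_eq_add_one, hzr, map_zero, zero_add, smul_smul] at this ⊢
          rw [this, sub_self]
        · rw [hz _ (by omega : q ≠ r + 1), hz _ (by omega : q ≠ r + 1), hr n q (by omega)]
          simp)
      ⟨max b b', fun n q hn => by
        simp only [Pi.sub_apply]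
        rw [doubleD_apply, hzb _ _ (le_trans (le_max_right _ _) hn),
          hzb _ _ (le_trans (le_max_right _ _) hn),
          hzb _ _ (le_trans (le_trans (le_max_right _ _) hn) (Nat.le_succ _)),
          hb _ _ (le_trans (le_max_left _ _) hn)]
        simp⟩
      (fun n q => (hdeg n q).sub (doubleD_hasDegree h w hdegz n q))
      (fun n q => by
        rw [map_sub, doubleD_doubleD h w hh ww hw, sub_zero, hy])
    exact ⟨u, hu1, hu2, hu3, by rw [hu4, map_sub, doubleD_doubleD h w hh ww hw, sub_zero]⟩

/-- In a double complex of complexes with exact columns, the zeroth row is exact in degree `m` if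
the rows of index `q ≥ 1` are exact in degree `m + 1 - q`. -/
theorem TotExact.of_double (hh : ∀ n q, h (n + 1) q ≫ h n q = 0)
    (ww : ∀ n q, w n (q + 1) ≫ w n q = 0)
    (hw : ∀ n q, h n (q + 1) ≫ w n q = w (n + 1) q ≫ h n q)
    (col : ∀ n i, TotExact (K n) (w n) i) (m : ℤ)
    (row : ∀ q : ℕ, TotExact (fun n => K n (q + 1)) (fun n => h n (q + 1)) (m - q)) :
    TotExact (fun n => K n 0) (fun n => h n 0) m := by
  rintro x ⟨b, hb⟩ hdeg hx
  let X : ∀ n q, Elt (K n q) := fun n => Pi.single 0 (x n)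
  have hX0 (n : ℕ) : X n 0 = x n := Pi.single_eq_same _ _
  have hX (n : ℕ) {q : ℕ} (hq : q ≠ 0) : X n q = 0 := Pi.single_eq_of_ne hq _
  -- The cycle `x`, placed in row zero, bounds in the double complex because the columns are exact.
  -- The family `y` may spread over several rows; exactness of these rows then moves it into row
  -- zero.
  obtain ⟨y, hyb, ⟨c, hc⟩, hydeg, hy⟩ := doubleD_exact_of_columns h w hh ww hw col m b X
    (fun n q hn => by
      by_cases hq : q = 0
      · subst hq
        rw [hX0, hb n hn]
      · exact hX n hq)
    ⟨1, fun n q hq => hX n (by omega)⟩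
    (fun n q => by
      by_cases hq : q = 0
      · subst hq
        rw [hX0]
        exact (hdeg n).congr (by simp)
      · rw [hX n hq]
        exact HasDegree.zero _)
    (by
      funext n q
      rw [doubleD_apply, hX _ (by omega : q + 1 ≠ 0), map_zero, zero_add]
      by_cases hq : q = 0
      · subst hq
        rw [hX0, hX0, pow_zero, one_smul]
        exact hx n
      · rw [hX _ hq, hX _ hq]
        simp)
  obtain ⟨z, hz, ⟨b', hzb⟩, hzdeg, hzy⟩ := exists_doubleD_eq_of_rows h w hh ww hw m row c y
    (fun n q hq => hc n q hq.le) ⟨b, hyb⟩ hydeg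
    (fun n q => by rw [hy]; exact hX n (Nat.succ_ne_zero q))
  refine ⟨fun n => z n 0, ⟨b', fun n => hzb n 0⟩, fun n => (hzdeg n 0).congr (by simp),
    fun n => ?_⟩
  have := congrFun (congrFun (hzy.trans hy) n) 0
  rwa [doubleD_apply, hX0, hz n 1 one_pos, map_zero, zero_add, pow_zero, one_smul] at this

end Double

end HomologicalDescent

end

noncomputable section

namespace HomologicalDescent

/-! ### Augmented simplicial objects -/

/-- The opposite of the category of the finite ordinals `Fin n` and monotone maps. Functors
from it are augmented simplicial objects, indexed by the number of vertices. -/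
structure AugSimp : Type where
  /-- The number of vertices. -/
  n : ℕ

namespace AugSimp

instance : Category AugSimp where
  Hom a b := Fin b.n →o Fin a.n
  id _ := OrderHom.id
  comp f g := f.comp g

/-- The monotone map underlying a morphism. -/
def fn {a b : AugSimp} (f : a ⟶ b) : Fin b.n → Fin a.n := OrderHom.toFun f

lemma fn_monotone {a b : AugSimp} (f : a ⟶ b) : Monotone (fn f) := OrderHom.monotone f

/-- The morphism attached to a monotone map. -/
def ofFn {a b : AugSimp} (f : Fin b.n → Fin a.n) (hf : Monotone f) : a ⟶ b :=
  OrderHom.mk f hf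

lemma comp_apply {a b c : AugSimp} (f : a ⟶ b) (g : b ⟶ c) (i : Fin c.n) :
    fn (f ≫ g) i = fn f (fn g i) := rfl

lemma hom_ext {a b : AugSimp} {f g : a ⟶ b} (h : ∀ i, fn f i = fn g i) : f = g :=
  OrderHom.ext _ _ (funext h)

/-- The face which omits the vertex `i`. -/
def face {n : ℕ} (i : Fin (n + 1)) : mk (n + 1) ⟶ mk n :=
  ofFn i.succAbove (Fin.strictMono_succAbove i).monotone

lemma face_apply {n : ℕ} (i : Fin (n + 1)) (j : Fin n) :
    fn (face i) j = i.succAbove j := rfl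

/-- The degeneracy which repeats the first vertex. -/
def degen (n : ℕ) : mk (n + 1) ⟶ mk (n + 2) :=
  ofFn (Fin.predAbove (0 : Fin (n + 1))) (Fin.predAboveOrderHom 0).monotone

lemma degen_apply (n : ℕ) (j : Fin (n + 2)) :
    fn (degen n) j = Fin.predAbove 0 j := rfl

/-- The morphism obtained by adding a new first vertex. -/
def shift {a b : AugSimp} (f : a ⟶ b) : mk (a.n + 1) ⟶ mk (b.n + 1) :=
  ofFn (Fin.cases 0 (fun i => (fn f i).succ)) (by
    intro i j hij
    induction i using Fin.cases with
    | zero => exact Fin.zero_le _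
    | succ i =>
      induction j using Fin.cases with
      | zero => simp at hij
      | succ j => exact Fin.succ_le_succ_iff.mpr (fn_monotone f (Fin.succ_le_succ_iff.mp hij)))

lemma shift_id (a : AugSimp) : shift (𝟙 a) = 𝟙 _ := hom_ext fun i => by
  induction i using Fin.cases with
  | zero => rfl
  | succ i => rfl

lemma shift_comp {a b c : AugSimp} (f : a ⟶ b) (g : b ⟶ c) :
    shift (f ≫ g) = shift f ≫ shift g := hom_ext fun i => by
  induction i using Fin.cases with
  | zero => rfl
  | succ i => rfl

lemma shift_face_zero {a b : AugSimp} (f : a ⟶ b) :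
    shift f ≫ face (0 : Fin (b.n + 1)) = face (0 : Fin (a.n + 1)) ≫ f :=
  hom_ext fun i => by
    change fn (shift f) (Fin.succAbove 0 i) = Fin.succAbove 0 (fn f i)
    rw [Fin.zero_succAbove, Fin.zero_succAbove]
    rfl

lemma shift_face {n : ℕ} (i : Fin (n + 1)) : shift (face i) = face i.succ :=
  hom_ext fun (j : Fin (n + 1)) => by
    induction j using Fin.cases with
    | zero => exact (Fin.succ_succAbove_zero i).symm
    | succ j => exact (Fin.succ_succAbove_succ i j).symm

lemma face_face {n : ℕ} {i j : Fin (n + 1)} (h : i ≤ j) :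
    face j.succ ≫ face i = face i.castSucc ≫ face j :=
  hom_ext fun k => by
    simp only [comp_apply, face_apply]
    ext
    simp only [Fin.succAbove, Fin.lt_def, Fin.val_succ, Fin.val_castSucc]
    rw [Fin.le_def] at h
    split_ifs <;> simp_all <;> omega

lemma degen_face_zero (n : ℕ) : degen n ≫ face 0 = 𝟙 _ :=
  hom_ext fun k => by
    rw [comp_apply, face_apply, degen_apply, Fin.zero_succAbove]
    rfl

lemma degen_face_one (n : ℕ) : degen n ≫ face (Fin.succ 0) = 𝟙 _ :=
  hom_ext fun k => by
    rw [comp_apply, face_apply, degen_apply]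
    induction k using Fin.cases with
    | zero => rfl
    | succ k => rw [Fin.succ_succAbove_succ, Fin.zero_succAbove]; rfl

lemma degen_face_succ_succ {n : ℕ} (i : Fin (n + 1)) :
    degen (n + 1) ≫ face i.succ.succ = face i.succ ≫ degen n :=
  hom_ext fun k => by
    rw [comp_apply, comp_apply, face_apply, face_apply, degen_apply, degen_apply]
    induction k using Fin.cases with
    | zero => rfl
    | succ k =>
      rw [Fin.succ_succAbove_succ]
      rfl

end AugSimp

open AugSimp

/-! ### Alternating face complexes -/

section Preadditive

variable {A : Type*} [Category* A] [Preadditive A]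

/-- The alternating sum of the faces of an augmented simplicial object. -/
def altD (K : AugSimp ⥤ A) (n : ℕ) : K.obj (mk (n + 1)) ⟶ K.obj (mk n) :=
  ∑ i : Fin (n + 1), (-1 : ℤ) ^ (i : ℕ) • K.map (face i)

lemma altD_altD (K : AugSimp ⥤ A) (n : ℕ) : altD K (n + 1) ≫ altD K n = 0 := by
  simp only [altD, Preadditive.comp_sum, Preadditive.sum_comp, ← Finset.sum_product']
  let P := Fin (n + 1) × Fin (n + 2)
  let T : Finset P := {ij : P | (ij.2 : ℕ) ≤ (ij.1 : ℕ)}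
  rw [Finset.univ_product_univ, ← Finset.sum_add_sum_compl T, ← eq_neg_iff_add_eq_zero,
    ← Finset.sum_neg_distrib]
  -- The simplicial identity matches the pair `(i, j)` with `j ≤ i` to the pair `(j, i + 1)` in the
  -- complement, which occurs with the opposite sign.
  refine Finset.sum_bij (fun ij hij =>
    (Fin.castLT ij.2 (lt_of_le_of_lt (Finset.mem_filter.mp hij).right (Fin.is_lt ij.1)),
      ij.1.succ)) ?_ ?_ ?_ ?_
  · intro ij hij
    simp_rw [T, Finset.compl_filter, Finset.mem_filter_univ, Fin.val_succ, Fin.val_castLT] at hij ⊢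
    omega
  · rintro ⟨i, j⟩ hij ⟨i', j'⟩ hij' h
    rw [Prod.mk_inj] at h ⊢
    exact ⟨Fin.succ_injective _ h.2, by
      have := congrArg Fin.castSucc h.1
      simpa [Fin.castSucc_castLT] using this⟩
  · rintro ⟨i', j'⟩ hij'
    simp_rw [T, Finset.compl_filter, Finset.mem_filter_univ, not_le] at hij'
    refine ⟨(j'.pred ?_, Fin.castSucc i'), ?_, ?_⟩
    · rintro rfl
      simp at hij'
    · simpa [T] using Nat.le_sub_one_of_lt hij'
    · simp only [Fin.castLT_castSucc, Fin.succ_pred]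
  · rintro ⟨i, j⟩ hij
    have hij' : (j : ℕ) ≤ i := by simpa [T] using hij
    have hj : j = (Fin.castLT j (lt_of_le_of_lt hij' i.isLt)).castSucc := rfl
    simp only [Preadditive.zsmul_comp, Preadditive.comp_zsmul, smul_smul, ← neg_smul, ← K.map_comp]
    congr 1
    · simp only [Fin.val_succ, pow_add, pow_one, mul_neg, neg_neg, mul_one, Fin.val_castLT]
      apply mul_comm
    · conv_lhs => rw [hj]
      rw [face_face (by simpa [Fin.le_def] using hij')]

lemma altD_naturality {K L : AugSimp ⥤ A} (f : ∀ n, K.obj (mk n) ⟶ L.obj (mk n))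
    (hf : ∀ n (i : Fin (n + 1)), K.map (face i) ≫ f n = f (n + 1) ≫ L.map (face i)) (n : ℕ) :
    altD K n ≫ f n = f (n + 1) ≫ altD L n := by
  simp [altD, Preadditive.comp_sum, Preadditive.sum_comp, hf]

end Preadditive

/-- Exactness in degree `m` of the total complex of an augmented simplicial complex. -/
abbrev AltExact (K : AugSimp ⥤ ChainComplex AddCommGrpCat.{v} ℤ) (m : ℤ) : Prop :=
  TotExact (fun n => K.obj (mk n)) (altD K) m

/-- This is the extra degeneracy argument: the zeroth face contributes the identity, and the
remaining faces cancel against `s` composed after the alternating sum. -/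
lemma AltExact.of_contraction {K : AugSimp ⥤ ChainComplex AddCommGrpCat.{v} ℤ}
    (s : ∀ n, K.obj (mk n) ⟶ K.obj (mk (n + 1))) (h0 : ∀ n, s n ≫ K.map (face 0) = 𝟙 _)
    (hs : ∀ n (i : Fin (n + 1)), s (n + 1) ≫ K.map (face i.succ) = K.map (face i) ≫ s n)
    (m : ℤ) : AltExact K m := by
  refine TotExact.of_contraction s ?_ ?_ m
  · simp [altD, h0]
  · intro n
    simp only [altD]
    rw [Fin.sum_univ_succ, Preadditive.comp_add, Preadditive.comp_sum, Preadditive.sum_comp]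
    simp [h0, hs, pow_succ]

lemma AltExact.of_iso {K L : AugSimp ⥤ ChainComplex AddCommGrpCat.{v} ℤ} {m : ℤ}
    (e : K ≅ L) (h : AltExact K m) : AltExact L m :=
  TotExact.of_levelwise_iso (fun n => e.app (mk n))
    (fun n => (altD_naturality (fun n => e.hom.app (mk n)) (by simp) n).symm) h

end HomologicalDescent

end

noncomputable section

namespace HomologicalDescent

open AugSimp Elt

/-! ### Fibre powers -/

section FibrePower

variable {C : Type*} [Category* C]

/-- A `q`-fold fibre power of a morphism `f`. -/
structure FibrePower {V U : C} (f : V ⟶ U) (q : ℕ) where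
  /-- The underlying object. -/
  pt : C
  /-- The structure morphism. -/
  base : pt ⟶ U
  /-- The projections. -/
  π : Fin q → (pt ⟶ V)
  w : ∀ j, π j ≫ f = base
  /-- The morphism to the fibre power given by its components. -/
  lift : ∀ {T : C} (t : T ⟶ U) (g : Fin q → (T ⟶ V)), (∀ j, g j ≫ f = t) → (T ⟶ pt)
  lift_base : ∀ {T : C} (t : T ⟶ U) (g : Fin q → (T ⟶ V)) (h : ∀ j, g j ≫ f = t),
    lift t g h ≫ base = t
  lift_π : ∀ {T : C} (t : T ⟶ U) (g : Fin q → (T ⟶ V)) (h : ∀ j, g j ≫ f = t) (j : Fin q),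
    lift t g h ≫ π j = g j
  hom_ext : ∀ {T : C} {g h : T ⟶ pt}, g ≫ base = h ≫ base → (∀ j, g ≫ π j = h ≫ π j) → g = h

attribute [simp] FibrePower.lift_base FibrePower.lift_π

lemma nonempty_fibrePower [HasPullbacks C] {V U : C} (f : V ⟶ U) (q : ℕ) :
    Nonempty (FibrePower f q) := by
  induction q with
  | zero =>
    exact ⟨{
      pt := U
      base := 𝟙 U
      π := fun j => j.elim0
      w := fun j => j.elim0
      lift := fun t _ _ => t
      lift_base := by simp
      lift_π := fun _ _ _ j => j.elim0
      hom_ext := by simp }⟩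
  | succ q ih =>
    obtain ⟨P⟩ := ih
    exact ⟨{
      pt := pullback f P.base
      base := pullback.snd _ _ ≫ P.base
      π := Fin.cons (pullback.fst _ _) (fun j => pullback.snd _ _ ≫ P.π j)
      w := fun j => by
        induction j using Fin.cases with
        | zero => exact pullback.condition
        | succ j => rw [Fin.cons_succ, Category.assoc, P.w]
      lift := fun t g h => pullback.lift (g 0) (P.lift t (fun j => g j.succ) (fun j => h _))
        (by simp [h])
      lift_base := fun t g h => by
        rw [← Category.assoc, pullback.lift_snd, P.lift_base]
      lift_π := fun t g h j => by
        induction j using Fin.cases with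
        | zero => exact pullback.lift_fst _ _ _
        | succ j =>
          rw [Fin.cons_succ, ← Category.assoc, pullback.lift_snd, P.lift_π]
      hom_ext := fun {T g h} hb hπ => by
        refine pullback.hom_ext (by simpa using hπ 0) (P.hom_ext (by simpa using hb) fun j => ?_)
        simpa using hπ j.succ }⟩

variable [HasPullbacks C]

/-- A choice of the `q`-fold fibre power of a morphism. -/
def fibrePower {V U : C} (f : V ⟶ U) (q : ℕ) : FibrePower f q := (nonempty_fibrePower f q).some

/-- The augmented Čech nerve of a morphism. -/
def cech {V U : C} (f : V ⟶ U) : AugSimp ⥤ C where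
  obj a := (fibrePower f a.n).pt
  map {a b} g := (fibrePower f b.n).lift (fibrePower f a.n).base
    (fun j => (fibrePower f a.n).π (fn g j)) (fun j => (fibrePower f a.n).w _)
  map_id a := (fibrePower f a.n).hom_ext (by simp) (fun j => by simp; rfl)
  map_comp g h := (fibrePower f _).hom_ext (by simp) (fun j => by simp; rfl)

section

variable {V U : C} {f : V ⟶ U}

variable (f) in
/-- The structure morphism of the Čech nerve. -/
def cechBase (a : AugSimp) : (cech f).obj a ⟶ U := (fibrePower f a.n).base

variable (f) in
/-- The projections of the Čech nerve. -/
def cechπ (a : AugSimp) (j : Fin a.n) : (cech f).obj a ⟶ V := (fibrePower f a.n).π j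

lemma cechπ_comp (a : AugSimp) (j : Fin a.n) : cechπ f a j ≫ f = cechBase f a :=
  FibrePower.w _ _

lemma cech_map_base {a b : AugSimp} (g : a ⟶ b) :
    (cech f).map g ≫ cechBase f b = cechBase f a := FibrePower.lift_base _ _ _ _

lemma cech_map_π {a b : AugSimp} (g : a ⟶ b) (j : Fin b.n) :
    (cech f).map g ≫ cechπ f b j = cechπ f a (fn g j) := FibrePower.lift_π _ _ _ _ j

lemma cech_hom_ext {T : C} {a : AugSimp} {g h : T ⟶ (cech f).obj a}
    (hb : g ≫ cechBase f a = h ≫ cechBase f a)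
    (hπ : ∀ j, g ≫ cechπ f a j = h ≫ cechπ f a j) : g = h := FibrePower.hom_ext _ hb hπ

/-- Prefixing a coordinate is the extra degeneracy of a Čech nerve. -/
lemma exists_cech_cons {T : C} (n : ℕ) (t : T ⟶ (cech f).obj (mk n)) (s : T ⟶ V)
    (hs : s ≫ f = t ≫ cechBase f _) :
    ∃ e : T ⟶ (cech f).obj (mk (n + 1)), e ≫ cechBase f _ = t ≫ cechBase f _ ∧
      e ≫ cechπ f _ (0 : Fin (n + 1)) = s ∧
      ∀ j : Fin n, e ≫ cechπ f _ j.succ = t ≫ cechπ f _ j := by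
  have hw : ∀ j, (Fin.cons s (fun j => t ≫ cechπ f (mk n) j) : Fin (n + 1) → (T ⟶ V)) j ≫ f =
      t ≫ cechBase f _ := fun j => by
    induction j using Fin.cases with
    | zero => exact hs
    | succ j => rw [Fin.cons_succ, Category.assoc, cechπ_comp]
  exact ⟨_, FibrePower.lift_base _ _ _ hw, FibrePower.lift_π _ _ _ hw 0,
    fun j => FibrePower.lift_π _ _ _ hw j.succ⟩

end

/-- The augmented simplicial object which, in degree `n`, is the `q`-fold fibre power of the zeroth
face `Y (n + 1) ⟶ Y n`. -/
def decPower (Y : AugSimp ⥤ C) (q : ℕ) : AugSimp ⥤ C where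
  obj a := (fibrePower (Y.map (face (0 : Fin (a.n + 1)))) q).pt
  map {a b} g := (fibrePower (Y.map (face (0 : Fin (b.n + 1)))) q).lift
    ((fibrePower (Y.map (face (0 : Fin (a.n + 1)))) q).base ≫ Y.map g)
    (fun j => (fibrePower (Y.map (face (0 : Fin (a.n + 1)))) q).π j ≫ Y.map (shift g))
    (fun j => by
      rw [Category.assoc, ← Y.map_comp, shift_face_zero, Y.map_comp,
        ← Category.assoc, FibrePower.w])
  map_id a := (fibrePower _ _).hom_ext (by simp) (fun j => by simp [shift_id])
  map_comp g h := (fibrePower _ _).hom_ext (by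
      rw [FibrePower.lift_base, Category.assoc, FibrePower.lift_base, ← Category.assoc,
        FibrePower.lift_base, Category.assoc, Y.map_comp]) (fun j => by
      rw [FibrePower.lift_π, Category.assoc, FibrePower.lift_π, ← Category.assoc,
        FibrePower.lift_π, Category.assoc, shift_comp, Y.map_comp])

section

variable (Y : AugSimp ⥤ C) (q : ℕ)

/-- The projection of `decPower Y q` to `Y`. -/
def decBase (a : AugSimp) : (decPower Y q).obj a ⟶ Y.obj a :=
  (fibrePower (Y.map (face (0 : Fin (a.n + 1)))) q).base

/-- The projections of `decPower Y q` to the décalage of `Y`. -/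
def decπ (a : AugSimp) (j : Fin q) : (decPower Y q).obj a ⟶ Y.obj (mk (a.n + 1)) :=
  (fibrePower (Y.map (face (0 : Fin (a.n + 1)))) q).π j

variable {Y q}

lemma decπ_face (a : AugSimp) (j : Fin q) :
    decπ Y q a j ≫ Y.map (face 0) = decBase Y q a := FibrePower.w _ _

lemma decPower_map_base {a b : AugSimp} (g : a ⟶ b) :
    (decPower Y q).map g ≫ decBase Y q b = decBase Y q a ≫ Y.map g := FibrePower.lift_base _ _ _ _

lemma decPower_map_π {a b : AugSimp} (g : a ⟶ b) (j : Fin q) :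
    (decPower Y q).map g ≫ decπ Y q b j = decπ Y q a j ≫ Y.map (shift g) :=
  FibrePower.lift_π _ _ _ _ _

lemma decPower_hom_ext {T : C} {a : AugSimp} {g h : T ⟶ (decPower Y q).obj a}
    (hb : g ≫ decBase Y q a = h ≫ decBase Y q a)
    (hπ : ∀ j, g ≫ decπ Y q a j = h ≫ decπ Y q a j) : g = h := FibrePower.hom_ext _ hb hπ

lemma exists_decPower_lift {T : C} {a : AugSimp} (t : T ⟶ Y.obj a)
    (g : Fin q → (T ⟶ Y.obj (mk (a.n + 1)))) (h : ∀ j, g j ≫ Y.map (face 0) = t) :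
    ∃ l : T ⟶ (decPower Y q).obj a, l ≫ decBase Y q a = t ∧ ∀ j, l ≫ decπ Y q a j = g j :=
  ⟨_, FibrePower.lift_base _ t g h, FibrePower.lift_π _ t g h⟩

end

end FibrePower

/-! ### Contractible nerves and the décalage -/

section Contractions

variable {C : Type*} [Category* C] [HasPullbacks C]
  (F : C ⥤ ChainComplex AddCommGrpCat.{v} ℤ)

/-- The section, inserted as a new first coordinate, contracts the nerve. -/
lemma altExact_cech_of_section {V U : C} (f : V ⟶ U) (s : U ⟶ V) (hs : s ≫ f = 𝟙 U) (m : ℤ) :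
    AltExact (cech f ⋙ F) m := by
  have h (n : ℕ) := exists_cech_cons n (𝟙 ((cech f).obj (mk n))) (cechBase f (mk n) ≫ s)
    (by rw [Category.assoc, hs, Category.comp_id, Category.id_comp])
  simp only [Category.id_comp] at h
  choose e he he0 heπ using h
  refine AltExact.of_contraction (fun n => F.map (e n)) (fun n => ?_) (fun n i => ?_) m
  · refine (F.map_comp _ _).symm.trans ((congrArg F.map ?_).trans (F.map_id _))
    refine cech_hom_ext ?_ (fun j => ?_)
    · rw [Category.assoc, cech_map_base, he, Category.id_comp]
    · rw [Category.assoc, cech_map_π, Category.id_comp]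
      exact heπ n j
  · rw [Functor.comp_map, Functor.comp_map, ← F.map_comp, ← F.map_comp]
    congr 1
    refine cech_hom_ext ?_ (fun j => ?_)
    · rw [Category.assoc, Category.assoc, cech_map_base, he, he, cech_map_base]
    · rw [Category.assoc, Category.assoc, cech_map_π]
      change Fin (n + 1) at j
      induction j using Fin.cases with
      | zero =>
        have : fn (face i.succ) 0 = 0 := Fin.succ_succAbove_zero i
        rw [this, he0, he0, ← Category.assoc, cech_map_base]
      | succ j =>
        have : fn (face i.succ) j.succ = (fn (face i) j).succ := Fin.succ_succAbove_succ i j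
        rw [this, heπ, heπ, cech_map_π]

/-- The first fibre power is the décalage of `Y`. Its faces are those of `Y` other than the zeroth,
so the degeneracy of `Y` that repeats the first vertex is an extra degeneracy. -/
lemma altExact_decPower_one (Y : AugSimp ⥤ C) (m : ℤ) : AltExact (decPower Y 1 ⋙ F) m := by
  have h (n : ℕ) := exists_decPower_lift (Y := Y) (q := 1) (a := mk (n + 1))
    (decπ Y 1 (mk n) 0) (fun _ => decπ Y 1 (mk n) 0 ≫ Y.map (degen n))
    (fun _ => by rw [Category.assoc, ← Y.map_comp, degen_face_zero, Y.map_id, Category.comp_id])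
  choose e he heπ using h
  refine AltExact.of_contraction (fun n => F.map (e n)) (fun n => ?_) (fun n i => ?_) m
  · refine (F.map_comp _ _).symm.trans ((congrArg F.map ?_).trans (F.map_id _))
    refine decPower_hom_ext ?_ (fun j => ?_)
    · rw [Category.assoc, decPower_map_base, reassoc_of% he, Category.id_comp, decπ_face]
    · rw [Category.assoc, decPower_map_π, reassoc_of% heπ, Category.id_comp, ← Y.map_comp,
        shift_face, degen_face_one, Y.map_id, Category.comp_id, Subsingleton.elim j 0]
  · rw [Functor.comp_map, Functor.comp_map, ← F.map_comp, ← F.map_comp]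
    congr 1
    refine decPower_hom_ext ?_ (fun j => ?_)
    · rw [Category.assoc, Category.assoc, decPower_map_base, reassoc_of% he, he, decPower_map_π,
        shift_face]
    · rw [Category.assoc, Category.assoc, decPower_map_π, reassoc_of% heπ, heπ,
        reassoc_of% decPower_map_π, ← Y.map_comp, ← Y.map_comp, shift_face, shift_face,
        degen_face_succ_succ]

lemma altExact_of_decPower_zero (Y : AugSimp ⥤ C) {m : ℤ} (h : AltExact (decPower Y 0 ⋙ F) m) :
    AltExact (Y ⋙ F) m := by
  have h (a : AugSimp) := exists_decPower_lift (Y := Y) (q := 0) (𝟙 (Y.obj a)) (fun j => j.elim0)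
    (fun j => j.elim0)
  choose l hl _ using h
  let e : decPower Y 0 ≅ Y := NatIso.ofComponents
    (fun a => ⟨decBase Y 0 a, l a, decPower_hom_ext (by simp [hl]) (fun j => j.elim0), hl a⟩)
    (fun g => decPower_map_base g)
  exact AltExact.of_iso (Functor.isoWhiskerRight e F) h

end Contractions

end HomologicalDescent

end

noncomputable section

namespace HomologicalDescent

open AugSimp Elt

/-! ### Hypercovers -/

section Hypercover

variable {C : Type*} [Category* C]

/-- A family of `n + 1` morphisms to `Y n` which satisfies the relations of the faces of a morphism
to `Y (n + 1)`. -/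
def IsBoundary (Y : AugSimp ⥤ C) {U : C} : ∀ n : ℕ, (Fin (n + 1) → (U ⟶ Y.obj (mk n))) → Prop
  -- A single morphism to `Y 0`, the target of the augmentation, is subject to no relation.
  | 0, _ => True
  | _ + 1, y => ∀ i j, i ≤ j →
      y (Fin.succ j) ≫ Y.map (face i) = y (Fin.castSucc i) ≫ Y.map (face j)

lemma IsBoundary.comp {Y : AugSimp ⥤ C} {U V : C} {n : ℕ} {y : Fin (n + 1) → (U ⟶ Y.obj (mk n))}
    (h : IsBoundary Y n y) (c : V ⟶ U) : IsBoundary Y n (fun i => c ≫ y i) := by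
  cases n with
  | zero => trivial
  | succ n =>
    intro i j hij
    rw [Category.assoc, Category.assoc, h i j hij]

/-- An augmented simplicial object is a hypercover with respect to a class of morphisms `J` if
every boundary with values in it can be filled after composition with a morphism in `J`. -/
def IsHypercover (J : MorphismProperty C) (Y : AugSimp ⥤ C) : Prop :=
  ∀ (n : ℕ) (U : C) (y : Fin (n + 1) → (U ⟶ Y.obj (mk n))), IsBoundary Y n y →
    ∃ (V : C) (c : V ⟶ U) (_ : J c) (z : V ⟶ Y.obj (mk (n + 1))),
      ∀ i, z ≫ Y.map (face i) = c ≫ y i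

variable {J : MorphismProperty C} {Y : AugSimp ⥤ C}

/-- The boundaries are filled one after the other, each time on a further cover; this needs closure
of `J` under composition. -/
lemma IsHypercover.exists_fillers [J.IsMultiplicative] (hY : IsHypercover J Y) {n q : ℕ} {U : C}
    (y : Fin q → Fin (n + 1) → (U ⟶ Y.obj (mk n))) (hy : ∀ k, IsBoundary Y n (y k)) :
    ∃ (V : C) (c : V ⟶ U) (_ : J c) (z : Fin q → (V ⟶ Y.obj (mk (n + 1)))),
      ∀ k i, z k ≫ Y.map (face i) = c ≫ y k i := by
  induction q with
  | zero => exact ⟨U, 𝟙 U, J.id_mem U, fun k => k.elim0, fun k => k.elim0⟩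
  | succ q ih =>
    obtain ⟨V, c, hc, z, hz⟩ := ih (fun k => y k.succ) (fun k => hy k.succ)
    obtain ⟨W, c', hc', z', hz'⟩ := hY n V (fun i => c ≫ y 0 i) ((hy 0).comp c)
    refine ⟨W, c' ≫ c, J.comp_mem _ _ hc' hc, Fin.cons z' (fun k => c' ≫ z k), fun k i => ?_⟩
    induction k using Fin.cases with
    | zero => rw [Fin.cons_zero, hz', Category.assoc]
    | succ k => rw [Fin.cons_succ, Category.assoc, hz, Category.assoc]

variable [HasPullbacks C]

/-- A boundary in the fibre power consists of a boundary in `Y` and, for each of the `q` factors,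
the positive faces of a simplex of one dimension more. Filling the base first supplies the missing
zeroth face of these `q` boundaries. Their fillers share this face and thus define a point of the
fibre power. -/
lemma IsHypercover.decPower [J.IsMultiplicative] (hY : IsHypercover J Y) (q : ℕ) :
    IsHypercover J (decPower Y q) := by
  intro n U e he
  obtain ⟨V, c, hc, y, hy⟩ := hY n U (fun i => e i ≫ decBase Y q (mk n)) (by
    cases n with
    | zero => trivial
    | succ n =>
      intro i j hij
      have := he i j hij
      simp only [Category.assoc, ← decPower_map_base]
      rw [reassoc_of% this])
  -- For each factor, the filler `y` of the base is the zeroth face and the given components are the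
  -- other faces.
  obtain ⟨W, c', hc', t, ht⟩ := hY.exists_fillers (n := n + 1) (q := q)
    (fun k => Fin.cons y (fun i => c ≫ e i ≫ decπ Y q (mk n) k)) (fun k => by
      intro i j hij
      rw [Fin.cons_succ]
      induction i using Fin.cases with
      | zero =>
        rw [Fin.castSucc_zero, Fin.cons_zero, hy, Category.assoc, Category.assoc, decπ_face]
      | succ i =>
        induction j using Fin.cases with
        | zero => simp at hij
        | succ j =>
          cases n with
          | zero => exact i.elim0
          | succ n =>
            have := he i j (Fin.succ_le_succ_iff.mp hij)
            rw [← Fin.succ_castSucc, Fin.cons_succ]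
            simp only [Category.assoc, ← shift_face, ← decPower_map_π]
            rw [reassoc_of% this])
  obtain ⟨l, hl, hlπ⟩ := exists_decPower_lift (Y := Y) (a := mk (n + 1)) (c' ≫ y) t
    (fun k => by rw [ht, Fin.cons_zero])
  refine ⟨W, c' ≫ c, J.comp_mem _ _ hc' hc, l, fun i => decPower_hom_ext ?_ (fun k => ?_)⟩
  · rw [Category.assoc, decPower_map_base, reassoc_of% hl, hy, Category.assoc, Category.assoc]
  · rw [Category.assoc, decPower_map_π, reassoc_of% hlπ, shift_face]
    exact (ht k i.succ).trans (by rw [Fin.cons_succ, Category.assoc, Category.assoc])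

section

variable (Y)

/-- The functoriality of `decPower Y q` in the number `q` of factors. -/
def decPowerMap (a : AugSimp) {p q : ℕ} (g : mk p ⟶ mk q) :
    (HomologicalDescent.decPower Y p).obj a ⟶ (HomologicalDescent.decPower Y q).obj a :=
  (cech (Y.map (face (0 : Fin (a.n + 1))))).map g

lemma decPowerMap_base (a : AugSimp) {p q : ℕ} (g : mk p ⟶ mk q) :
    decPowerMap Y a g ≫ decBase Y q a = decBase Y p a :=
  cech_map_base (f := Y.map (face (0 : Fin (a.n + 1)))) g

lemma decPowerMap_π (a : AugSimp) {p q : ℕ} (g : mk p ⟶ mk q) (j : Fin q) :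
    decPowerMap Y a g ≫ decπ Y q a j = decπ Y p a (fn g j) :=
  cech_map_π (f := Y.map (face (0 : Fin (a.n + 1)))) g j

lemma decPowerMap_naturality {a b : AugSimp} (f : a ⟶ b) {p q : ℕ} (g : mk p ⟶ mk q) :
    (HomologicalDescent.decPower Y p).map f ≫ decPowerMap Y b g =
      decPowerMap Y a g ≫ (HomologicalDescent.decPower Y q).map f := by
  refine decPower_hom_ext ?_ (fun k => ?_)
  · rw [Category.assoc, Category.assoc, decPowerMap_base, decPower_map_base, decPower_map_base,
      reassoc_of% decPowerMap_base]
  · rw [Category.assoc, Category.assoc, decPowerMap_π, decPower_map_π, decPower_map_π,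
      reassoc_of% decPowerMap_π]

lemma decPower_comm (F : C ⥤ ChainComplex AddCommGrpCat.{v} ℤ) (n q : ℕ) :
    altD (HomologicalDescent.decPower Y (q + 1) ⋙ F) n ≫
        altD (cech (Y.map (face (0 : Fin (n + 1)))) ⋙ F) q =
      altD (cech (Y.map (face (0 : Fin (n + 2)))) ⋙ F) q ≫
        altD (HomologicalDescent.decPower Y q ⋙ F) n := by
  refine altD_naturality (K := HomologicalDescent.decPower Y (q + 1) ⋙ F)
    (L := HomologicalDescent.decPower Y q ⋙ F)
    (fun n => altD (cech (Y.map (face (0 : Fin (n + 1)))) ⋙ F) q) (fun n i => ?_) n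
  refine (altD_naturality (K := cech (Y.map (face (0 : Fin (n + 2)))) ⋙ F)
    (L := cech (Y.map (face (0 : Fin (n + 1)))) ⋙ F)
    (fun q => F.map ((HomologicalDescent.decPower Y q).map (face i))) (fun q j => ?_) q).symm
  exact (F.map_comp _ _).symm.trans ((congrArg F.map
    (decPowerMap_naturality Y (face i) (face j)).symm).trans (F.map_comp _ _))

end

/-- A functor to complexes with uniformly bounded below homology which satisfies Čech descent
satisfies descent for hypercovers. -/
theorem altExact_of_isHypercover [J.IsMultiplicative]
    (hJ : ∀ {X Y Z : C} (f : X ⟶ Y) (g : Y ⟶ Z), J (f ≫ g) → J g)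
    (F : C ⥤ ChainComplex AddCommGrpCat.{v} ℤ) (N : ℤ)
    (hN : ∀ (X : C) (i : ℤ), i < N → ∀ x : Elt (F.obj X), HasDegree i x → d _ x = 0 →
      ∃ y : Elt (F.obj X), HasDegree (i + 1) y ∧ d _ y = x)
    (hF : ∀ {V U : C} (f : V ⟶ U), J f → ∀ m, AltExact (cech f ⋙ F) m)
    (hY : IsHypercover J Y) (m : ℤ) : AltExact (Y ⋙ F) m := by
  -- The induction is on the height of `m` above `N`; `Y` has to vary, since the higher rows are
  -- different hypercovers.
  obtain ⟨k, hk⟩ : ∃ k : ℕ, m < N + k := ⟨(m - N + 1).toNat, by omega⟩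
  induction k generalizing Y m with
  | zero =>
    -- Column `n` enters in degree `m - n ≤ m < N`, where all homology vanishes.
    exact TotExact.of_exact (fun n => hN _ _ (by omega)) (altD_altD _)
  | succ k ih =>
    apply altExact_of_decPower_zero
    refine TotExact.of_double
      (K := fun n q => F.obj ((HomologicalDescent.decPower Y q).obj (mk n)))
      (fun n q => altD (HomologicalDescent.decPower Y q ⋙ F) n)
      (fun n q => altD (cech (Y.map (face (0 : Fin (n + 1)))) ⋙ F) q)
      (fun n q => altD_altD _ _) (fun n q => altD_altD _ _) (fun n q => decPower_comm Y F n q)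
      (fun n i => ?_) m (fun q => ?_)
    · cases n with
      | zero =>
        -- Filling the identity of `Y 0` factors a cover through the zeroth face, which is then
        -- itself in `J`.
        obtain ⟨V, c, hc, z, hz⟩ := hY 0 _ (fun _ => 𝟙 _) trivial
        refine hF _ (hJ z _ ?_) i
        rw [hz, Category.comp_id]
        exact hc
      | succ n =>
        -- All later zeroth faces are split by a degeneracy.
        exact altExact_cech_of_section F _ (Y.map (degen n))
          (by rw [← Y.map_comp, degen_face_zero, Y.map_id]) i
    · cases q with
      | zero => exact altExact_decPower_one F Y _
      -- Row `q + 2` is needed in degree `m - (q + 1) < m` only, which is why the induction closes.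
      | succ q => exact ih (hY.decPower _) _ (by push_cast at hk ⊢; omega)

end Hypercover

end HomologicalDescent

end

noncomputable section

namespace HomologicalDescent

open Elt

/-! ### Quasi-isomorphisms and elements -/

namespace Elt

variable {A B : ChainComplex AddCommGrpCat.{v} ℤ}

/-- An element of degree `m`, as a homogeneous family of elements. -/
def single (m : ℤ) (a : A.X m) : Elt A := Pi.single m a

lemma single_same (m : ℤ) (a : A.X m) : single m a m = a := Pi.single_eq_same _ _

lemma single_hasDegree (m : ℤ) (a : A.X m) : HasDegree m (single m a) :=
  fun _ hi => Pi.single_eq_of_ne hi _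

lemma HasDegree.ext {m : ℤ} {x y : Elt A} (hx : HasDegree m x) (hy : HasDegree m y)
    (h : x m = y m) : x = y := by
  funext i
  by_cases hi : i = m
  · subst hi
    exact h
  · rw [hx i hi, hy i hi]

lemma d_apply' (x : Elt A) {i j : ℤ} (h : j + 1 = i) : d A x j = (A.d i j).hom (x i) := by
  subst h
  rfl

end Elt

open Elt

section

variable {K L : ChainComplex AddCommGrpCat.{v} ℤ} (f : K ⟶ L)

/-- The criterion up to refinements is tested on elements, that is, on morphisms from `ℤ`; `1` can
be lifted along any epimorphism onto `ℤ`. Conversely, the solutions of the element-wise problem form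
a fibre product `P` which serves as the refinement. -/
lemma mono_homologyMap_iff {i m k : ℤ} (hi : m + 1 = i) (hk : k + 1 = m) :
    Mono (HomologicalComplex.homologyMap f m) ↔
    ∀ (x : K.X m) (y : L.X i), (K.d m k).hom x = 0 →
      (f.f m).hom x = (L.d i m).hom y → ∃ z : K.X i, (K.d i m).hom z = x := by
  rw [HomologicalComplex.mono_homologyMap_iff_up_to_refinements f i m k
    ((ComplexShape.down ℤ).prev_eq' hi) ((ComplexShape.down ℤ).next_eq' hk)]
  constructor
  · intro h x y hx hxy
    let gx := AddCommGrpCat.ofHom (((zmultiplesHom (K.X m)) x).comp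
      (AddEquiv.ulift : ULift.{v} ℤ ≃+ ℤ).toAddMonoidHom)
    let gy := AddCommGrpCat.ofHom (((zmultiplesHom (L.X i)) y).comp
      (AddEquiv.ulift : ULift.{v} ℤ ≃+ ℤ).toAddMonoidHom)
    obtain ⟨A', π, hπ, x₁, hx₁⟩ := h gx (by ext t; simp [gx, hx]) gy (by ext t; simp [gx, gy, hxy])
    obtain ⟨a, ha⟩ := (AddCommGrpCat.epi_iff_surjective π).1 hπ (ULift.up 1)
    refine ⟨x₁.hom a, ?_⟩
    have := congrArg (fun g => g.hom a) hx₁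
    simp only [AddCommGrpCat.hom_comp, AddMonoidHom.comp_apply] at this
    rw [← this]
    exact (congrArg gx.hom ha).trans (one_zsmul x)
  · intro h A x₂ hx₂ y₁ hy₁
    let P : AddSubgroup (A × K.X i) := AddMonoidHom.ker
      ((x₂.hom.comp (AddMonoidHom.fst _ _)) - (K.d i m).hom.comp (AddMonoidHom.snd _ _))
    have hP (p : P) : x₂.hom p.1.1 = (K.d i m).hom p.1.2 := sub_eq_zero.mp p.2
    refine ⟨AddCommGrpCat.of P,
      AddCommGrpCat.ofHom ((AddMonoidHom.fst A (K.X i)).comp P.subtype), ?_,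
      AddCommGrpCat.ofHom ((AddMonoidHom.snd A (K.X i)).comp P.subtype), ?_⟩
    · rw [AddCommGrpCat.epi_iff_surjective]
      intro a
      obtain ⟨z, hz⟩ := h (x₂.hom a) (y₁.hom a) (congrArg (fun g => g.hom a) hx₂)
        (congrArg (fun g => g.hom a) hy₁)
      exact ⟨⟨(a, z), sub_eq_zero.mpr hz.symm⟩, rfl⟩
    · ext p
      exact hP p

lemma epi_homologyMap_iff {i m k : ℤ} (hi : m + 1 = i) (hk : k + 1 = m) :
    Epi (HomologicalComplex.homologyMap f m) ↔
    ∀ (y : L.X m), (L.d m k).hom y = 0 → ∃ (x : K.X m) (z : L.X i),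
      (K.d m k).hom x = 0 ∧ y = (f.f m).hom x + (L.d i m).hom z := by
  rw [HomologicalComplex.epi_homologyMap_iff_up_to_refinements f i m k
    ((ComplexShape.down ℤ).prev_eq' hi) ((ComplexShape.down ℤ).next_eq' hk)]
  constructor
  · intro h y hy
    let gy := AddCommGrpCat.ofHom (((zmultiplesHom (L.X m)) y).comp
      (AddEquiv.ulift : ULift.{v} ℤ ≃+ ℤ).toAddMonoidHom)
    obtain ⟨A', π, hπ, x, hx, z, hz⟩ := h gy (by ext t; simp [gy, hy])
    obtain ⟨a, ha⟩ := (AddCommGrpCat.epi_iff_surjective π).1 hπ (ULift.up 1)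
    refine ⟨x.hom a, z.hom a, congrArg (fun g => g.hom a) hx, ?_⟩
    have := congrArg (fun g => g.hom a) hz
    simp only [AddCommGrpCat.hom_comp, AddCommGrpCat.hom_add, AddMonoidHom.comp_apply,
      AddMonoidHom.add_apply] at this
    rw [← this]
    exact ((congrArg gy.hom ha).trans (one_zsmul y)).symm
  · intro h A y hy
    let P : AddSubgroup (A × K.X m × L.X i) := AddMonoidHom.ker
      ((y.hom.comp (AddMonoidHom.fst _ _)) -
        ((f.f m).hom.comp (AddMonoidHom.fst _ _) +
          (L.d i m).hom.comp (AddMonoidHom.snd _ _)).comp (AddMonoidHom.snd _ _)) ⊓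
      AddMonoidHom.ker ((K.d m k).hom.comp
        ((AddMonoidHom.fst _ _).comp (AddMonoidHom.snd _ _)))
    have hP (p : P) : y.hom p.1.1 = (f.f m).hom p.1.2.1 + (L.d i m).hom p.1.2.2 :=
      sub_eq_zero.mp p.2.1
    refine ⟨AddCommGrpCat.of P,
      AddCommGrpCat.ofHom ((AddMonoidHom.fst _ _).comp P.subtype), ?_,
      AddCommGrpCat.ofHom (((AddMonoidHom.fst _ _).comp (AddMonoidHom.snd _ _)).comp P.subtype), ?_,
      AddCommGrpCat.ofHom (((AddMonoidHom.snd _ _).comp (AddMonoidHom.snd _ _)).comp P.subtype), ?_⟩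
    · rw [AddCommGrpCat.epi_iff_surjective]
      intro a
      obtain ⟨x, z, hx, hz⟩ := h (y.hom a) (congrArg (fun g => g.hom a) hy)
      exact ⟨⟨(a, x, z), sub_eq_zero.mpr hz, hx⟩, rfl⟩
    · ext p
      exact p.2.2
    · ext p
      exact hP p

lemma quasiIso_iff_mono_epi : QuasiIso f ↔
    (∀ m, Mono (HomologicalComplex.homologyMap f m)) ∧
      ∀ m, Epi (HomologicalComplex.homologyMap f m) := by
  rw [quasiIso_iff]
  constructor
  · intro h
    have h' (m : ℤ) : IsIso (HomologicalComplex.homologyMap f m) :=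
      (quasiIsoAt_iff_isIso_homologyMap f m).1 (h m)
    exact ⟨fun m => inferInstance, fun m => inferInstance⟩
  · rintro ⟨h1, h2⟩ m
    rw [quasiIsoAt_iff_isIso_homologyMap]
    have := h1 m
    have := h2 m
    exact isIso_of_mono_of_epi _

end

/-- If the homology vanishes, the zero endomorphism is injective on it, and the element-wise
criterion for injectivity says that cycles are boundaries. -/
lemma exists_d_eq_of_isZero_homology {A : ChainComplex AddCommGrpCat.{v} ℤ} {i : ℤ}
    (h : IsZero (A.homology i)) (x : Elt A) (hx : HasDegree i x) (hdx : d _ x = 0) :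
    ∃ y : Elt A, HasDegree (i + 1) y ∧ d _ y = x := by
  have hmono : Mono (HomologicalComplex.homologyMap (0 : A ⟶ A) i) :=
    ⟨fun _ _ _ => h.eq_of_tgt _ _⟩
  obtain ⟨z, hz⟩ := (mono_homologyMap_iff (0 : A ⟶ A) rfl (sub_add_cancel i 1)).1 hmono (x i) 0
    (by rw [← d_apply' x (by omega), hdx]; rfl) (by simp)
  refine ⟨single (i + 1) z, single_hasDegree _ _, HasDegree.ext
    ((single_hasDegree _ _).d.congr (by ring)) hx ?_⟩
  rw [d_apply, single_same, hz]

/-! ### Three term sequences -/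

/-- The sequence of complexes `⋯ ⟶ 0 ⟶ A ⟶ B ⟶ D`. -/
def threeTerm (A B D : ChainComplex AddCommGrpCat.{v} ℤ) : ℕ → ChainComplex AddCommGrpCat.{v} ℤ
  | 0 => D
  | 1 => B
  | 2 => A
  | _ + 3 => HomologicalComplex.zero

/-- The maps in the sequence `⋯ ⟶ 0 ⟶ A ⟶ B ⟶ D`. -/
def threeTermD {A B D : ChainComplex AddCommGrpCat.{v} ℤ} (f : A ⟶ B) (g : B ⟶ D) :
    ∀ n, threeTerm A B D (n + 1) ⟶ threeTerm A B D n
  | 0 => g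
  | 1 => f
  | _ + 2 => 0

lemma threeTermD_comp {A B D : ChainComplex AddCommGrpCat.{v} ℤ} (f : A ⟶ B) (g : B ⟶ D)
    (w : f ≫ g = 0) (n : ℕ) : threeTermD f g (n + 1) ≫ threeTermD f g n = 0 := by
  match n with
  | 0 => exact w
  | 1 => exact zero_comp
  | n + 2 => exact zero_comp

open HomologicalComplex in
-- A total cycle `(x0, x1, x2)` gives a cycle of the cone in degree `m - 1` whose image in `D`
-- bounds. Injectivity on homology in degree `m - 1` bounds the part in the cone, and surjectivity
-- in degree `m` corrects the cycle of `D` that remains. Since the homotopy `w` is zero, the map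
-- from the cone is `g` on the `B`-component.
lemma exists_of_quasiIso_homotopyCofiber_desc {A B D : ChainComplex AddCommGrpCat.{v} ℤ}
    (f : A ⟶ B) (g : B ⟶ D) (hfg : f ≫ g = 0) (w : Homotopy (f ≫ g) 0) (hw : w.hom = 0)
    (h : QuasiIso (homotopyCofiber.desc f g w)) (m : ℤ)
    (x0 : D.X m) (x1 : B.X (m - 1)) (x2 : A.X (m - 2))
    (e0 : (g.f (m - 1)).hom x1 + (D.d m (m - 1)).hom x0 = 0)
    (e1 : (f.f (m - 2)).hom x2 = (B.d (m - 1) (m - 2)).hom x1)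
    (e2 : (A.d (m - 2) (m - 3)).hom x2 = 0) :
    ∃ (y0 : D.X (m + 1)) (y1 : B.X m) (y2 : A.X (m - 1)),
      (g.f m).hom y1 + (D.d (m + 1) m).hom y0 = x0 ∧
      (f.f (m - 1)).hom y2 - (B.d m (m - 1)).hom y1 = x1 ∧
      (A.d (m - 1) (m - 2)).hom y2 = x2 := by
  rw [quasiIso_iff_mono_epi] at h
  obtain ⟨hmono, hepi⟩ := h
  have hdesc (j k : ℤ) (hjk : k + 1 = j) (c : (homotopyCofiber f).X j) :
      ((homotopyCofiber.desc f g w).f j).hom c =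
        (g.f j).hom ((homotopyCofiber.sndX f j).hom c) := by
    rw [homotopyCofiber.desc_f f g w j k hjk, hw]
    simp
  have hd1 {i j k : ℤ} (hij : j + 1 = i) (hjk : k + 1 = j) (c : (homotopyCofiber f).X i) :
      (homotopyCofiber.fstX f j k hjk).hom (((homotopyCofiber f).d i j).hom c) =
        -(A.d j k).hom ((homotopyCofiber.fstX f i j hij).hom c) := by
    have := congrArg (fun t => t.hom c) (homotopyCofiber.d_fstX f i j k hij hjk)
    simpa using this
  have hd2 {i j : ℤ} (hij : j + 1 = i) (c : (homotopyCofiber f).X i) :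
      (homotopyCofiber.sndX f j).hom (((homotopyCofiber f).d i j).hom c) =
        (f.f j).hom ((homotopyCofiber.fstX f i j hij).hom c) +
          (B.d i j).hom ((homotopyCofiber.sndX f i).hom c) := by
    have := congrArg (fun t => t.hom c) (homotopyCofiber.d_sndX f i j hij)
    simpa using this
  have hext {i j : ℤ} (hij : j + 1 = i) {c c' : (homotopyCofiber f).X i}
      (h1 : (homotopyCofiber.fstX f i j hij).hom c = (homotopyCofiber.fstX f i j hij).hom c')
      (h2 : (homotopyCofiber.sndX f i).hom c = (homotopyCofiber.sndX f i).hom c') : c = c' := by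
    have hid : 𝟙 ((homotopyCofiber f).X i) =
        homotopyCofiber.fstX f i j hij ≫ homotopyCofiber.inlX f j i hij +
          homotopyCofiber.sndX f i ≫ homotopyCofiber.inrX f i :=
      homotopyCofiber.ext_to_X f i j hij
        (by simp [homotopyCofiber.inlX_fstX f j i hij, homotopyCofiber.inrX_fstX f i j hij])
        (by simp [homotopyCofiber.inlX_sndX f j i hij])
    have hid' (t : (homotopyCofiber f).X i) :
        t = (homotopyCofiber.inlX f j i hij).hom ((homotopyCofiber.fstX f i j hij).hom t) +
          (homotopyCofiber.inrX f i).hom ((homotopyCofiber.sndX f i).hom t) :=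
      congrArg (fun g => g.hom t) hid
    rw [hid' c, hid' c', h1, h2]
  have hfst {i j : ℤ} (hij : j + 1 = i) (s : A.X j) (t : B.X i) :
      (homotopyCofiber.fstX f i j hij).hom ((homotopyCofiber.inlX f j i hij).hom s +
        (homotopyCofiber.inrX f i).hom t) = s := by
    rw [map_add]
    have h1 := congrArg (fun g => g.hom s) (homotopyCofiber.inlX_fstX f j i hij)
    have h2 := congrArg (fun g => g.hom t) (homotopyCofiber.inrX_fstX f i j hij)
    simp only [AddCommGrpCat.hom_comp, AddMonoidHom.comp_apply] at h1 h2
    rw [h1, h2]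
    simp
  have hsnd {i j : ℤ} (hij : j + 1 = i) (s : A.X j) (t : B.X i) :
      (homotopyCofiber.sndX f i).hom ((homotopyCofiber.inlX f j i hij).hom s +
        (homotopyCofiber.inrX f i).hom t) = t := by
    rw [map_add]
    have h1 := congrArg (fun g => g.hom s) (homotopyCofiber.inlX_sndX f j i hij)
    have h2 := congrArg (fun g => g.hom t) (homotopyCofiber.inrX_sndX f i)
    simp only [AddCommGrpCat.hom_comp, AddMonoidHom.comp_apply] at h1 h2
    rw [h1, h2]
    simp
  -- The sign of `x2` is forced by the cone differential, which is `-d` on the shifted copy of `A`.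
  obtain ⟨e, he⟩ := (mono_homologyMap_iff (homotopyCofiber.desc f g w)
    (show m - 1 + 1 = m by omega) (show m - 2 + 1 = m - 1 by omega)).1 (hmono (m - 1))
    ((homotopyCofiber.inlX f (m - 2) (m - 1) (show m - 2 + 1 = m - 1 by omega)).hom
        (-x2) + (homotopyCofiber.inrX f (m - 1)).hom x1) (-x0)
    (hext (show m - 3 + 1 = m - 2 by omega)
      (by rw [hd1 (show m - 2 + 1 = m - 1 by omega), hfst, map_neg, e2, map_zero, neg_zero,
        neg_zero])
      (by rw [hd2 (show m - 2 + 1 = m - 1 by omega), hfst, hsnd, map_neg, e1, map_zero,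
        neg_add_cancel]))
    (by rw [hdesc _ (m - 2) (by omega), hsnd (show m - 2 + 1 = m - 1 by omega), map_neg]
        exact eq_neg_of_add_eq_zero_left e0)
  have he1 := congrArg (homotopyCofiber.fstX f (m - 1) (m - 2) (show m - 2 + 1 = m - 1 by omega)).hom he
  have he2 := congrArg (homotopyCofiber.sndX f (m - 1)).hom he
  rw [hd1 (show m - 1 + 1 = m by omega), hfst, neg_inj] at he1
  rw [hd2 (show m - 1 + 1 = m by omega), hsnd (show m - 2 + 1 = m - 1 by omega)] at he2
  -- The chain `e` solves the equations for `x1` and `x2`; its image makes `x0` into a cycle of `D`.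
  -- Changing `e` by a cycle `e'` of the cone keeps those two equations.
  obtain ⟨e', z, he', hz⟩ := (epi_homologyMap_iff (homotopyCofiber.desc f g w)
    (show m + 1 = m + 1 from rfl) (show m - 1 + 1 = m by omega)).1 (hepi m)
    (x0 + (g.f m).hom ((homotopyCofiber.sndX f m).hom e)) (by
      have := congrArg (fun t => t.hom ((homotopyCofiber.sndX f m).hom e)) (g.comm m (m - 1))
      have h2 := congrArg (fun t => t.hom
        ((homotopyCofiber.fstX f m (m - 1) (show m - 1 + 1 = m by omega)).hom e))
        (congrArg (fun t => t.f (m - 1)) hfg)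
      simp only [AddCommGrpCat.hom_comp, AddMonoidHom.comp_apply, comp_f] at this h2
      rw [map_add, this, eq_sub_of_add_eq' he2, map_sub, h2, ← e0]
      simp [add_comm])
  have he1' := congrArg (homotopyCofiber.fstX f (m - 1) (m - 2) (show m - 2 + 1 = m - 1 by omega)).hom he'
  have he2' := congrArg (homotopyCofiber.sndX f (m - 1)).hom he'
  rw [hd1 (show m - 1 + 1 = m by omega), map_zero, neg_eq_zero] at he1'
  rw [hd2 (show m - 1 + 1 = m by omega), map_zero] at he2'
  rw [hdesc _ (m - 1) (by omega)] at hz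
  refine ⟨z, (homotopyCofiber.sndX f m).hom e' - (homotopyCofiber.sndX f m).hom e,
    (homotopyCofiber.fstX f m (m - 1) (show m - 1 + 1 = m by omega)).hom e -
      (homotopyCofiber.fstX f m (m - 1) (show m - 1 + 1 = m by omega)).hom e', ?_, ?_, ?_⟩
  · rw [map_sub, sub_add_eq_add_sub, ← hz, add_sub_cancel_right]
  · rw [map_sub, map_sub, ← he2, ← sub_eq_zero, ← neg_eq_zero, ← he2']
    abel
  · rw [map_sub, he1, he1', sub_zero]

lemma totExact_threeTerm {A B D : ChainComplex AddCommGrpCat.{v} ℤ} (f : A ⟶ B) (g : B ⟶ D)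
    (hfg : f ≫ g = 0) (w : Homotopy (f ≫ g) 0) (hw : w.hom = 0)
    (h : QuasiIso (HomologicalComplex.homotopyCofiber.desc f g w)) (m : ℤ) :
    TotExact (threeTerm A B D) (threeTermD f g) m := by
  intro x hb hdeg hx
  let x0 : Elt D := x 0
  let x1 : Elt B := x 1
  let x2 : Elt A := x 2
  have d0 : HasDegree m x0 := (hdeg 0).congr (by simp)
  have d1 : HasDegree (m - 1) x1 := (hdeg 1).congr (by simp)
  have d2 : HasDegree (m - 2) x2 := (hdeg 2).congr (by simp)
  have hx0 : map g x1 + (-1 : ℤ) ^ 0 • d _ x0 = 0 := hx 0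
  have hx1 : map f x2 + (-1 : ℤ) ^ 1 • d _ x1 = 0 := hx 1
  have hx2 : 0 + (-1 : ℤ) ^ 2 • d _ x2 = 0 := by
    have h3 : map (threeTermD f g 2) (x 3) = (0 : Elt A) := map_zero_hom (x 3)
    rw [← h3]
    exact hx 2
  rw [pow_zero, one_smul] at hx0
  rw [pow_one, neg_smul, one_smul, ← sub_eq_add_neg, sub_eq_zero] at hx1
  rw [neg_one_sq, one_smul, zero_add] at hx2
  obtain ⟨y0, y1, y2, h0, h1, h2⟩ := exists_of_quasiIso_homotopyCofiber_desc f g hfg w hw h m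
    (x0 m) (x1 (m - 1)) (x2 (m - 2))
    (by rw [← d_apply' x0 (by omega)]; exact congrFun hx0 (m - 1))
    (by rw [← d_apply' x1 (by omega)]; exact congrFun hx1 (m - 2))
    (by rw [← d_apply' x2 (by omega)]; exact congrFun hx2 (m - 3))
  refine ⟨fun n => match n with
    | 0 => single (A := D) (m + 1) y0
    | 1 => single (A := B) m y1
    | 2 => single (A := A) (m - 1) y2
    | n + 3 => 0, ⟨3, ?_⟩, ?_, ?_⟩
  · rintro (_ | _ | _ | n) hn
    · omega
    · omega
    · omega
    · rfl
  · rintro (_ | _ | _ | n)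
    · exact (single_hasDegree (m + 1) y0).congr (by simp)
    · exact (single_hasDegree m y1).congr (by simp)
    · exact (single_hasDegree (m - 1) y2).congr (by push_cast; ring)
    · exact HasDegree.zero _
  · rintro (_ | _ | _ | n)
    · change map g (single m y1) + (-1 : ℤ) ^ 0 • d _ (single (m + 1) y0) = x0
      rw [pow_zero, one_smul]
      refine HasDegree.ext (((single_hasDegree _ _).map _).add
        ((single_hasDegree _ _).d.congr (by ring))) d0 ?_
      rw [Pi.add_apply, map_apply, d_apply, single_same, single_same, h0]
    · change map f (single (m - 1) y2) + (-1 : ℤ) ^ 1 • d _ (single m y1) = x1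
      rw [pow_one, neg_smul, one_smul, ← sub_eq_add_neg]
      refine HasDegree.ext (((single_hasDegree _ _).map _).sub
        (single_hasDegree _ _).d) d1 ?_
      rw [Pi.sub_apply, map_apply, d_apply' _ (sub_add_cancel m 1), single_same, single_same, h1]
    · change map (0 : (HomologicalComplex.zero : ChainComplex AddCommGrpCat.{v} ℤ) ⟶ A) 0 +
        (-1 : ℤ) ^ 2 • d _ (single (m - 1) y2) = x2
      rw [neg_one_sq, one_smul, map_zero, zero_add]
      refine HasDegree.ext ((single_hasDegree _ _).d.congr (by ring)) d2 ?_
      rw [d_apply' _ (show m - 2 + 1 = m - 1 by omega), single_same, h2]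
    · funext i
      exact (AddCommGrpCat.subsingleton_of_isZero (isZero_zero _)).elim _ _

end HomologicalDescent

end

noncomputable section

namespace HomologicalDescent

open MorphismProperty

/-! ### Proper morphisms and fibre products -/

section SchProper

variable {S : Scheme.{u}}

instance (A B : SchProper S) (f : A ⟶ B) : IsProper f.left := f.prop_hom_left

/-- The source of a proper morphism to an object of `SchProper S`, as an object of `SchProper S`. -/
def ofProper (A : SchProper S) {T : Scheme.{u}} (g : T ⟶ A.left) [IsProper g] : SchProper S :=
  MorphismProperty.Over.mk _ (g ≫ A.hom) (by
    obtain ⟨⟨h1, h2⟩, h3⟩ := A.prop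
    have h1' : IsSeparated A.hom := h1
    have h2' : LocallyOfFiniteType A.hom := h2
    have h3' : QuasiCompact A.hom := h3
    exact ⟨⟨(inferInstance : IsSeparated (g ≫ A.hom)),
      (inferInstance : LocallyOfFiniteType (g ≫ A.hom))⟩,
      (inferInstance : QuasiCompact (g ≫ A.hom))⟩)

/-- A proper morphism as a morphism of `SchProper S`. -/
def ofProperHom (A : SchProper S) {T : Scheme.{u}} (g : T ⟶ A.left) [h : IsProper g] :
    ofProper A g ⟶ A :=
  MorphismProperty.Over.homMk g rfl h

/-- A factorisation of schemes of a morphism of `SchProper S` through another one, as a morphism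
of `SchProper S`. -/
def liftHom {A B C : SchProper S} (f : B ⟶ C) (t : A ⟶ C) (g : A.left ⟶ B.left)
    (h : g ≫ f.left = t.left) : A ⟶ B :=
  MorphismProperty.Over.homMk g (by
      rw [← MorphismProperty.Over.w t, ← MorphismProperty.Over.w f, reassoc_of% h])
    (by
      have : IsProper (g ≫ f.left) := by rw [h]; infer_instance
      exact IsProper.of_comp g f.left)

@[simp] lemma liftHom_comp {A B C : SchProper S} (f : B ⟶ C) (t : A ⟶ C) (g : A.left ⟶ B.left)
    (h : g ≫ f.left = t.left) : liftHom f t g h ≫ f = t :=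
  MorphismProperty.Over.Hom.ext h

/-- Morphisms into a fibre product of schemes are automatically proper here: their composite with
`fst` is proper and `fst` is separated. By uniqueness of fibre products the converse holds as well,
so that fibre products may be computed in schemes. -/
lemma isPullback_of_left {P A B C : SchProper S} {fst : P ⟶ A} {snd : P ⟶ B} {f : A ⟶ C}
    {g : B ⟶ C} (h : IsPullback fst.left snd.left f.left g.left) : IsPullback fst snd f g :=
  ⟨⟨MorphismProperty.Over.Hom.ext h.w⟩, ⟨PullbackCone.IsLimit.mk _
    (fun s => liftHom fst s.fst (h.lift s.fst.left s.snd.left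
      (congrArg (fun φ => φ.left) s.condition)) (h.lift_fst _ _ _))
    (fun _ => liftHom_comp _ _ _ _)
    (fun _ => MorphismProperty.Over.Hom.ext (h.lift_snd _ _ _))
    (fun _ _ h1 h2 => MorphismProperty.Over.Hom.ext (h.hom_ext
      ((congrArg (fun φ => φ.left) h1).trans (h.lift_fst _ _ _).symm)
      ((congrArg (fun φ => φ.left) h2).trans (h.lift_snd _ _ _).symm)))⟩⟩

lemma exists_isPullback {A B C : SchProper S} (f : A ⟶ C) (g : B ⟶ C) :
    ∃ (P : SchProper S) (fst : P ⟶ A) (snd : P ⟶ B),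
      IsPullback fst.left snd.left f.left g.left := by
  let e := ofProperHom A (pullback.fst f.left g.left)
  exact ⟨_, e, liftHom g (e ≫ f) (pullback.snd f.left g.left) pullback.condition.symm,
    IsPullback.of_hasPullback _ _⟩

instance : HasPullbacks (SchProper S) :=
  have (A B C : SchProper S) (f : A ⟶ C) (g : B ⟶ C) : HasPullback f g := by
    obtain ⟨P, fst, snd, h⟩ := exists_isPullback f g
    exact (isPullback_of_left h).hasPullback
  hasPullbacks_of_hasLimit_cospan _

/-- The forgetful functor from `SchProper S` to schemes. -/
abbrev toScheme (S : Scheme.{u}) : SchProper S ⥤ Scheme.{u} :=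
  MorphismProperty.Over.forget _ _ S ⋙ Over.forget S

lemma isPullback_left {P A B C : SchProper S} {fst : P ⟶ A} {snd : P ⟶ B} {f : A ⟶ C}
    {g : B ⟶ C} (h : IsPullback fst snd f g) :
    IsPullback fst.left snd.left f.left g.left := by
  obtain ⟨P', fst', snd', h'⟩ := exists_isPullback f g
  let e := h.isoIsPullback _ _ (isPullback_of_left h')
  refine IsPullback.of_iso h' ((toScheme S).mapIso e.symm) (Iso.refl _) (Iso.refl _) (Iso.refl _)
    ?_ ?_ (by simp) (by simp)
  · have := congrArg (fun φ => φ.left) (h.isoIsPullback_inv_fst _ _ (isPullback_of_left h'))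
    exact (Category.comp_id _).trans this.symm
  · have := congrArg (fun φ => φ.left) (h.isoIsPullback_inv_snd _ _ (isPullback_of_left h'))
    exact (Category.comp_id _).trans this.symm

end SchProper

end HomologicalDescent

end

noncomputable section

namespace HomologicalDescent

open MorphismProperty

/-! ### Proper cdh-covers -/

section CdhCover

/-- A homomorphism out of a field is injective, and `g` is surjective because `f ≫ g` is; so `g`,
and then `f`, is invertible. -/
lemma isIso_of_isIso_comp_field {A K L : CommRingCat.{u}} (hK : IsField K) [Nontrivial L]
    (f : A ⟶ K) (g : K ⟶ L) (h : IsIso (f ≫ g)) : IsIso f := by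
  let := hK.toField
  have hg : Function.Bijective g.hom := by
    refine ⟨RingHom.injective (R := K) g.hom, fun y => ?_⟩
    obtain ⟨x, hx⟩ := (ConcreteCategory.bijective_of_isIso (f ≫ g)).2 y
    exact ⟨f.hom x, hx⟩
  have : IsIso g := (ConcreteCategory.isIso_iff_bijective g).2 hg
  exact IsIso.of_isIso_comp_right f g

/-- Points with trivial residue field extension are lifts of `Spec k(x)`. In this form the cdh
condition is visibly stable under base change and passes to the second factor of a composite. -/
lemma IsProperCdhCover.exists_lift {X' X : Scheme.{u}} {f : X' ⟶ X} (h : IsProperCdhCover f)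
    (x : X) : ∃ s : Spec (X.residueField x) ⟶ X', s ≫ f = X.fromSpecResidueField x := by
  obtain ⟨x', rfl, h'⟩ := h.exists_point x
  refine ⟨Spec.map (inv (f.residueFieldMap x')) ≫ X'.fromSpecResidueField x', ?_⟩
  rw [Category.assoc, ← Scheme.Hom.SpecMap_residueFieldMap_fromSpecResidueField,
    ← Spec.map_comp_assoc, IsIso.hom_inv_id, Spec.map_id, Category.id_comp]

lemma exists_specMap_fromSpecResidueField {X : Scheme.{u}} (K : Type u) [Field K]
    (s : Spec (.of K) ⟶ X) :
    ∃ (x : X) (φ : X.residueField x ⟶ .of K), Spec.map φ ≫ X.fromSpecResidueField x = s :=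
  ⟨_, _, Scheme.descResidueField_stalkClosedPointTo_fromSpecResidueField K X s⟩

/-- The lift is given by a point `x'` and a map `k(x') ⟶ k(x)` whose composite with `k(x) ⟶ k(x')`
is an isomorphism; for fields this makes both maps isomorphisms. -/
lemma exists_isIso_residueFieldMap_of_lift {X' X : Scheme.{u}} (f : X' ⟶ X) (x : X)
    (s : Spec (X.residueField x) ⟶ X') (hs : s ≫ f = X.fromSpecResidueField x) :
    ∃ x' : X', f x' = x ∧ IsIso (f.residueFieldMap x') := by
  obtain ⟨x', φ, rfl⟩ := exists_specMap_fromSpecResidueField (X.residueField x) s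
  have hx : f x' = x := by
    have := congrArg (fun g => g (IsLocalRing.closedPoint (X.residueField x))) hs
    exact ((congrArg f (X'.fromSpecResidueField_apply x' _)).symm.trans this).trans
      (X.fromSpecResidueField_apply x _)
  refine ⟨x', hx, ?_⟩
  have h2 : f.residueFieldMap x' ≫ φ = (X.residueFieldCongr hx).hom := by
    rw [← Spec.map_inj, ← cancel_mono (X.fromSpecResidueField _),
      Scheme.residueFieldCongr_fromSpecResidueField, Spec.map_comp, Category.assoc,
      Scheme.Hom.SpecMap_residueFieldMap_fromSpecResidueField]
    exact (Category.assoc _ _ _).symm.trans hs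
  have h3 : IsIso (f.residueFieldMap x' ≫ φ) := by rw [h2]; exact Iso.isIso_hom _
  exact isIso_of_isIso_comp_field (Field.toIsField (X'.residueField x'))
    (L := X.residueField x) (f.residueFieldMap x') φ h3

lemma IsProperCdhCover.of_isPullback {X' X T' T : Scheme.{u}} {f : X' ⟶ X} {t : T ⟶ X}
    {t' : T' ⟶ X'} {g : T' ⟶ T} (h : IsPullback t' g f t) (hf : IsProperCdhCover f) :
    IsProperCdhCover g where
  isProper := MorphismProperty.of_isPullback (P := @IsProper) h hf.isProper
  exists_point τ := by
    obtain ⟨s, hs⟩ := hf.exists_lift (t τ)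
    exact exists_isIso_residueFieldMap_of_lift g τ
      (h.lift (Spec.map (t.residueFieldMap τ) ≫ s) (T.fromSpecResidueField τ)
        (by rw [Category.assoc, hs, Scheme.Hom.SpecMap_residueFieldMap_fromSpecResidueField]))
      (h.lift_snd _ _ _)

/-- The property of a morphism of `SchProper S` of being a proper cdh-cover. -/
def cdhCover (S : Scheme.{u}) : MorphismProperty (SchProper S) :=
  fun _ _ f => IsProperCdhCover f.left

instance (S : Scheme.{u}) : (cdhCover S).IsMultiplicative where
  id_mem X := ⟨inferInstanceAs (IsProper (𝟙 X : X ⟶ X).left), fun x => ⟨x, rfl, by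
    change IsIso (Scheme.Hom.residueFieldMap (𝟙 X.left) x)
    rw [Scheme.residueFieldMap_id]
    exact IsIso.id _⟩⟩
  comp_mem f g hf hg := ⟨inferInstanceAs (IsProper (f ≫ g).left), fun x => by
    obtain ⟨y, rfl, hy⟩ := hg.exists_point x
    obtain ⟨z, rfl, hz⟩ := hf.exists_point y
    refine ⟨z, Scheme.Hom.comp_apply f.left g.left z, ?_⟩
    change IsIso (Scheme.Hom.residueFieldMap (f.left ≫ g.left) z)
    rw [Scheme.residueFieldMap_comp]
    exact IsIso.comp_isIso' hy hz⟩

lemma cdhCover_of_comp {S : Scheme.{u}} {A B C : SchProper S} (f : A ⟶ B) (g : B ⟶ C)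
    (h : cdhCover S (f ≫ g)) : cdhCover S g where
  isProper := inferInstance
  exists_point x := by
    obtain ⟨s, hs⟩ := IsProperCdhCover.exists_lift h x
    exact exists_isIso_residueFieldMap_of_lift g.left x (s ≫ f.left) (by
      rw [Category.assoc]; exact hs)

end CdhCover

/-! ### Base change of abstract blow-up squares -/

section Blowup

/-- The restriction of `ρ` to `V` is a base change of the restriction of `π` to `U`. -/
lemma isIso_morphismRestrict_of_isPullback {X X' Y Y' : Scheme.{u}} {π : X' ⟶ X} {ρ : Y' ⟶ Y}
    {g' : Y' ⟶ X'} {g : Y ⟶ X} (h : IsPullback g' ρ π g) (U : X.Opens) [IsIso (π ∣_ U)]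
    (V : Y.Opens) (hV : V ≤ g ⁻¹ᵁ U) : IsIso (ρ ∣_ V) := by
  have hr : Set.range (V.ι ≫ g) ⊆ Set.range U.ι := by
    rintro _ ⟨y, rfl⟩
    rw [Scheme.Opens.range_ι]
    exact hV y.2
  have h1 := (isPullback_morphismRestrict ρ V).paste_vert h.flip
  rw [← IsOpenImmersion.lift_fac U.ι (V.ι ≫ g) hr] at h1
  exact (h1.of_bot' (isPullback_morphismRestrict π U)).isIso_fst_of_isIso

lemma range_of_isPullback {P X Y Z : Scheme.{u}} {fst : P ⟶ X} {snd : P ⟶ Y} {f : X ⟶ Z}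
    {g : Y ⟶ Z} (h : IsPullback fst snd f g) : Set.range fst = f ⁻¹' Set.range g := by
  ext x
  constructor
  · rintro ⟨p, rfl⟩
    exact ⟨snd p, by rw [← Scheme.Hom.comp_apply, ← h.w, Scheme.Hom.comp_apply]⟩
  · rintro ⟨y, hy⟩
    obtain ⟨p, hp, -⟩ := Scheme.exists_preimage_of_isPullback h x y hy.symm
    exact ⟨p, hp⟩

/-- In the cube over `g : Y ⟶ X`, three corners are base changes of those of the given square, and
pasting and cancelling pullbacks makes the new square cartesian. Stating this for arbitrary fibre
products lets it apply to the terms of a nerve without transport along isomorphisms. -/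
lemma IsAbstractBlowup.of_isPullback {S : Scheme.{u}} {X X' Z Z' Y Y' W W' : SchProper S}
    {q : Z' ⟶ X'} {p : Z' ⟶ Z} {π : X' ⟶ X} {i : Z ⟶ X} (h : IsAbstractBlowup q p π i)
    {q₂ : W' ⟶ Y'} {p₂ : W' ⟶ W} {π₂ : Y' ⟶ Y} {i₂ : W ⟶ Y} {g : Y ⟶ X} {b : Y' ⟶ X'}
    {c : W ⟶ Z} {d : W' ⟶ Z'} (hb : IsPullback b π₂ π g) (hc : IsPullback c i₂ i g)
    (hd : IsPullback d (q₂ ≫ π₂) (q ≫ π) g) (hq : d ≫ q = q₂ ≫ b) (hp : d ≫ p = p₂ ≫ c)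
    (hw : q₂ ≫ π₂ = p₂ ≫ i₂) : IsAbstractBlowup q₂ p₂ π₂ i₂ where
  isPullback := by
    have h1 : IsPullback d q₂ q b := hd.of_bot hq hb
    have h2 : IsPullback (p₂ ≫ c) q₂ (i) (b ≫ π) := by
      rw [← hp]
      exact h1.paste_horiz (isPullback_of_left h.isPullback).flip
    have h3 : IsPullback p₂ q₂ i₂ π₂ := by
      refine IsPullback.of_right (v₁₃ := i) (h₁₂ := c) (h₂₂ := g) ?_ hw.symm hc
      rw [← hb.w]
      exact h2
    exact isPullback_left h3.flip
  isClosedImmersion := MorphismProperty.of_isPullback (P := @IsClosedImmersion)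
    (isPullback_left hc) h.isClosedImmersion
  isIso_compl := by
    refine @isIso_morphismRestrict_of_isPullback _ _ _ _ _ _ _ _ (isPullback_left hb) _
      h.isIso_compl _ ?_
    intro y hy hy'
    refine hy ?_
    rw [range_of_isPullback (isPullback_left hc.flip)]
    exact hy'

end Blowup

end HomologicalDescent

end

noncomputable section

namespace HomologicalDescent

open AugSimp Elt

lemma TotExact.biprod {K L : ℕ → ChainComplex AddCommGrpCat.{v} ℤ} {del : ∀ n, K (n + 1) ⟶ K n}
    {del' : ∀ n, L (n + 1) ⟶ L n} {m : ℤ} (hK : TotExact K del m) (hL : TotExact L del' m) :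
    TotExact (fun n => K n ⊞ L n) (fun n => biprod.map (del n) (del' n)) m := by
  rintro x ⟨b, hb⟩ hdeg hx
  obtain ⟨y, ⟨b₁, hb₁⟩, hy, hy'⟩ := hK (fun n => map biprod.fst (x n))
    ⟨b, fun n hn => by simp [hb n hn]⟩ (fun n => (hdeg n).map _) (fun n => by
      have := congrArg (map biprod.fst) (hx n)
      simpa [map_d, ← map_comp, -map_smul] using this)
  obtain ⟨z, ⟨b₂, hb₂⟩, hz, hz'⟩ := hL (fun n => map biprod.snd (x n))
    ⟨b, fun n hn => by simp [hb n hn]⟩ (fun n => (hdeg n).map _) (fun n => by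
      have := congrArg (map biprod.snd) (hx n)
      simpa [map_d, ← map_comp, -map_smul] using this)
  refine ⟨fun n => map biprod.inl (y n) + map biprod.inr (z n), ⟨max b₁ b₂, fun n hn => ?_⟩,
    fun n => ((hy n).map _).add ((hz n).map _), fun n => ?_⟩
  · simp [hb₁ n (by omega), hb₂ n (by omega)]
  · have h1 := congrArg (map (biprod.inl : K n ⟶ K n ⊞ L n)) (hy' n)
    have h2 := congrArg (map (biprod.inr : L n ⟶ K n ⊞ L n)) (hz' n)
    rw [← map_comp] at h1 h2
    rw [← map_id (x n), ← biprod.total, map_add_hom, ← h1, ← h2]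
    simp only [map_add, map_zsmul, map_d, ← map_comp, biprod.inl_map, biprod.inr_map, smul_add]
    abel

/-! ### Base change of the Čech nerve -/

section RelCech

variable {C : Type*} [Category* C] [HasPullbacks C] {V X : C} (f : V ⟶ X)

/-- The base change along `t` of the augmented Čech nerve of `f`. -/
def relCech {T : C} (t : T ⟶ X) : AugSimp ⥤ C where
  obj a := pullback (cechBase f a) t
  map {a b} g := pullback.map _ _ _ _ ((cech f).map g) (𝟙 _) (𝟙 _)
    (by rw [cech_map_base, Category.comp_id]) (by simp)
  map_id a := by
    refine pullback.hom_ext ?_ ?_ <;> simp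
  map_comp {a b c} g h := by
    refine pullback.hom_ext ?_ ?_
    · refine (pullback.lift_fst _ _ _).trans ?_
      rw [Category.assoc]
      refine Eq.trans ?_ (congrArg _ (pullback.lift_fst _ _ _).symm)
      rw [← Category.assoc]
      refine Eq.trans ?_ (congrArg (· ≫ _) (pullback.lift_fst _ _ _).symm)
      rw [Functor.map_comp, Category.assoc]
    · refine (pullback.lift_snd _ _ _).trans ?_
      rw [Category.assoc]
      refine Eq.trans ?_ (congrArg _ (pullback.lift_snd _ _ _).symm)
      rw [← Category.assoc]
      refine Eq.trans ?_ (congrArg (· ≫ _) (pullback.lift_snd _ _ _).symm)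
      simp

variable {f}

/-- The projection of the base change of the Čech nerve to the Čech nerve. -/
def relCechFst {T : C} (t : T ⟶ X) (a : AugSimp) : (relCech f t).obj a ⟶ (cech f).obj a :=
  pullback.fst _ _

/-- The projection of the base change of the Čech nerve along `t : T ⟶ X` to `T`. -/
def relCechSnd {T : C} (t : T ⟶ X) (a : AugSimp) : (relCech f t).obj a ⟶ T :=
  pullback.snd _ _

lemma relCech_map_fst {T : C} (t : T ⟶ X) {a b : AugSimp} (g : a ⟶ b) :
    (relCech f t).map g ≫ relCechFst t b = relCechFst t a ≫ (cech f).map g :=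
  pullback.lift_fst _ _ _

lemma relCech_map_snd {T : C} (t : T ⟶ X) {a b : AugSimp} (g : a ⟶ b) :
    (relCech f t).map g ≫ relCechSnd t b = relCechSnd t a :=
  (pullback.lift_snd _ _ _).trans (Category.comp_id _)

lemma relCech_condition {T : C} (t : T ⟶ X) (a : AugSimp) :
    relCechFst t a ≫ cechBase f a = relCechSnd t a ≫ t := pullback.condition

lemma relCech_hom_ext {T W : C} {t : T ⟶ X} {a : AugSimp} {g h : W ⟶ (relCech f t).obj a}
    (h1 : g ≫ relCechFst t a = h ≫ relCechFst t a)
    (h2 : g ≫ relCechSnd t a = h ≫ relCechSnd t a) : g = h := pullback.hom_ext h1 h2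

/-- The projections of the base change of the Čech nerve of `f : V ⟶ X` to `V`. -/
def relCechπ {T : C} (t : T ⟶ X) (a : AugSimp) (j : Fin a.n) : (relCech f t).obj a ⟶ V :=
  relCechFst t a ≫ cechπ f a j

lemma relCech_map_π {T : C} (t : T ⟶ X) {a b : AugSimp} (g : a ⟶ b) (j : Fin b.n) :
    (relCech f t).map g ≫ relCechπ t b j = relCechπ t a (fn g j) := by
  rw [relCechπ, ← Category.assoc, relCech_map_fst, Category.assoc, cech_map_π, relCechπ]

lemma relCech_hom_ext' {T W : C} {t : T ⟶ X} {a : AugSimp} {g h : W ⟶ (relCech f t).obj a}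
    (h1 : g ≫ relCechSnd t a = h ≫ relCechSnd t a)
    (h2 : ∀ j, g ≫ relCechπ t a j = h ≫ relCechπ t a j) : g = h := by
  refine relCech_hom_ext (cech_hom_ext ?_ fun j => ?_) h1
  · rw [Category.assoc, Category.assoc, relCech_condition, ← Category.assoc, h1, Category.assoc]
  · rw [Category.assoc, Category.assoc]
    exact h2 j

lemma exists_relCech_cons {T : C} (t : T ⟶ X) (n : ℕ) (s : T ⟶ V) (hs : s ≫ f = t) :
    ∃ e : (relCech f t).obj (mk n) ⟶ (relCech f t).obj (mk (n + 1)),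
      e ≫ relCechSnd t _ = relCechSnd t _ ∧
      e ≫ relCechπ t _ (0 : Fin (n + 1)) = relCechSnd t _ ≫ s ∧
      ∀ j : Fin n, e ≫ relCechπ t _ j.succ = relCechπ t _ j := by
  obtain ⟨e, h1, h2, h3⟩ := exists_cech_cons n (relCechFst t (mk n)) (relCechSnd t (mk n) ≫ s)
    (by rw [Category.assoc, hs, relCech_condition])
  have h4 := h1.trans (relCech_condition t _)
  refine ⟨pullback.lift e (relCechSnd t (mk n)) h4, pullback.lift_snd _ _ _, ?_, fun j => ?_⟩
  · rw [← h2]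
    exact (Category.assoc _ _ _).symm.trans (congrArg (· ≫ _) (pullback.lift_fst _ _ h4))
  · refine Eq.trans ?_ (h3 j)
    exact (Category.assoc _ _ _).symm.trans (congrArg (· ≫ _) (pullback.lift_fst _ _ h4))

variable (f) in
/-- The functoriality of the base change of the Čech nerve. -/
def relCechMap {T' T : C} (r : T' ⟶ T) (t : T ⟶ X) (t' : T' ⟶ X) (h : r ≫ t = t')
    (a : AugSimp) : (relCech f t').obj a ⟶ (relCech f t).obj a :=
  pullback.map _ _ _ _ (𝟙 _) r (𝟙 _) (by simp) (by simp [h])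

section

variable {T' T : C} (r : T' ⟶ T) (t : T ⟶ X) (t' : T' ⟶ X) (h : r ≫ t = t')

lemma relCechMap_fst (a : AugSimp) : relCechMap f r t t' h a ≫ relCechFst t a = relCechFst t' a :=
  (pullback.lift_fst _ _ _).trans (Category.comp_id _)

lemma relCechMap_snd (a : AugSimp) :
    relCechMap f r t t' h a ≫ relCechSnd t a = relCechSnd t' a ≫ r :=
  pullback.lift_snd _ _ _

lemma relCechMap_naturality {a b : AugSimp} (g : a ⟶ b) :
    (relCech f t').map g ≫ relCechMap f r t t' h b =
      relCechMap f r t t' h a ≫ (relCech f t).map g := by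
  refine relCech_hom_ext ?_ ?_
  · rw [Category.assoc, Category.assoc, relCechMap_fst, relCech_map_fst, relCech_map_fst,
      ← Category.assoc, relCechMap_fst]
  · rw [Category.assoc, Category.assoc, relCechMap_snd, relCech_map_snd, relCechMap_snd,
      ← Category.assoc, relCech_map_snd]

lemma relCechMap_comp {T'' : C} (s : T'' ⟶ T') (t'' : T'' ⟶ X) (h' : s ≫ t' = t'')
    (a : AugSimp) :
    relCechMap f s t' t'' h' a ≫ relCechMap f r t t' h a =
      relCechMap f (s ≫ r) t t'' (by rw [Category.assoc, h, h']) a := by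
  refine relCech_hom_ext ?_ ?_
  · simp only [Category.assoc, relCechMap_fst]
  · rw [Category.assoc, relCechMap_snd, ← Category.assoc, relCechMap_snd, relCechMap_snd,
      Category.assoc]

/-- Each term of the base-changed nerve is a fibre product, so base change in stages shows that a
square over `T` pulls back to every simplicial degree. -/
lemma isPullback_relCechMap (a : AugSimp) :
    IsPullback (relCechSnd t' a) (relCechMap f r t t' h a) r (relCechSnd t a) := by
  have h1 : IsPullback (relCechSnd t a) (relCechFst t a) t (cechBase f a) :=
    (IsPullback.of_hasPullback _ _).flip
  have h2 : IsPullback (relCechSnd t' a) (relCechFst t' a) t' (cechBase f a) :=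
    (IsPullback.of_hasPullback _ _).flip
  refine IsPullback.of_bot (v₂₁ := relCechFst t a) (v₂₂ := t) (h₃₁ := cechBase f a) ?_
    (relCechMap_snd r t t' h a).symm h1
  rw [relCechMap_fst, h]
  exact h2

end

variable (F : C ⥤ ChainComplex AddCommGrpCat.{v} ℤ)

/-- `F` takes the base change along `t` of the augmented Čech nerve of `f` to an exact
augmented simplicial complex. -/
def CechAcyclic (f : V ⟶ X) {T : C} (t : T ⟶ X) : Prop := ∀ m, AltExact (relCech f t ⋙ F) m

variable {F}

/-- A factorisation through `f` is a section of the base-changed cover, hence provides an extra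
degeneracy. -/
lemma CechAcyclic.of_factorisation {T : C} {t : T ⟶ X} (s : T ⟶ V) (hs : s ≫ f = t) :
    CechAcyclic F f t := by
  choose e hsnd he0 heπ using fun n => exists_relCech_cons t n s hs
  intro m
  refine AltExact.of_contraction (fun n => F.map (e n)) (fun n => ?_) (fun n i => ?_) m
  · refine (F.map_comp _ _).symm.trans ((congrArg F.map ?_).trans (F.map_id _))
    refine relCech_hom_ext' ?_ fun j => ?_
    · rw [Category.assoc, relCech_map_snd, hsnd, Category.id_comp]
    · rw [Category.assoc, relCech_map_π, Category.id_comp]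
      exact heπ n j
  · rw [Functor.comp_map, Functor.comp_map, ← F.map_comp, ← F.map_comp]
    congr 1
    refine relCech_hom_ext' ?_ fun j => ?_
    · rw [Category.assoc, Category.assoc, relCech_map_snd, hsnd, hsnd, relCech_map_snd]
    · rw [Category.assoc, Category.assoc, relCech_map_π]
      change Fin (n + 1) at j
      induction j using Fin.cases with
      | zero =>
        have : fn (face i.succ) 0 = 0 := Fin.succ_succAbove_zero i
        rw [this, he0, he0, ← Category.assoc, relCech_map_snd]
      | succ j =>
        have : fn (face i.succ) j.succ = (fn (face i) j).succ := Fin.succ_succAbove_succ i j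
        rw [this, heπ, heπ, relCech_map_π]

end RelCech

end HomologicalDescent

end

noncomputable section

namespace HomologicalDescent

open AugSimp Elt

/-! ### Čech descent along abstract blow-up squares -/

section BlowupDescent

variable {S : Scheme.{u}} {F : SchProper S ⥤ ChainComplex AddCommGrpCat.{v} ℤ}

lemma HasBlowupTriangles.totExact (hF : HasBlowupTriangles F) {X X' Z Z' : SchProper S}
    {q : Z' ⟶ X'} {p : Z' ⟶ Z} {π : X' ⟶ X} {i : Z ⟶ X} (h : IsAbstractBlowup q p π i) (m : ℤ) :
    TotExact (threeTerm (F.obj Z') (F.obj X' ⊞ F.obj Z) (F.obj X))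
      (threeTermD (biprod.lift (F.map q) (-F.map p)) (biprod.desc (F.map π) (F.map i))) m :=
  totExact_threeTerm _ _ (by
    rw [biprod.lift_desc, Preadditive.neg_comp, ← F.map_comp, ← F.map_comp, h.w,
      add_neg_cancel]) _ rfl (hF q p π i h) m

section

section

variable {A : Type*} [Category* A] [Preadditive A] [HasBinaryBiproducts A] {X X' X'' Y Y' Y'' Z Z' : A}

lemma biprod_map_comp_map_eq_zero {f : X ⟶ X'} {f' : X' ⟶ X''} {g : Y ⟶ Y'} {g' : Y' ⟶ Y''}
    (hf : f ≫ f' = 0) (hg : g ≫ g' = 0) : biprod.map f g ≫ biprod.map f' g' = 0 := by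
  refine biprod.hom_ext _ _ ?_ ?_ <;> simp [hf, hg]

lemma biprod_map_comp_desc {f : X ⟶ X'} {g : Y ⟶ Y'} {c : X' ⟶ Z'} {c' : Y' ⟶ Z'} {d : Z ⟶ Z'}
    {c₁ : X ⟶ Z} {c₁' : Y ⟶ Z} (h : f ≫ c = c₁ ≫ d) (h' : g ≫ c' = c₁' ≫ d) :
    biprod.map f g ≫ biprod.desc c c' = biprod.desc c₁ c₁' ≫ d := by
  refine biprod.hom_ext' _ _ ?_ ?_ <;> simp [h, h']

lemma comp_biprod_lift_neg {f : X ⟶ X'} {g : Y ⟶ Y'} {a : Z' ⟶ X'} {b : Z' ⟶ Y'} {d : Z ⟶ Z'}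
    {a₁ : Z ⟶ X} {b₁ : Z ⟶ Y} (h : d ≫ a = a₁ ≫ f) (h' : d ≫ b = b₁ ≫ g) :
    d ≫ biprod.lift a (-b) = biprod.lift a₁ (-b₁) ≫ biprod.map f g := by
  refine biprod.hom_ext _ _ ?_ ?_ <;> simp [h, h']

end

/-- The differentials in the simplicial direction of a three-term complex of augmented simplicial
complexes. -/
def threeTermAltD (A B B' D : AugSimp ⥤ ChainComplex AddCommGrpCat.{v} ℤ) (n : ℕ) : ∀ q,
    threeTerm (A.obj (mk (n + 1))) (B.obj (mk (n + 1)) ⊞ B'.obj (mk (n + 1)))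
      (D.obj (mk (n + 1))) q ⟶
    threeTerm (A.obj (mk n)) (B.obj (mk n) ⊞ B'.obj (mk n)) (D.obj (mk n)) q
  | 0 => altD D n
  | 1 => biprod.map (altD B n) (altD B' n)
  | 2 => altD A n
  | _ + 3 => 0

/-- Two-out-of-three along a triangle: in the double complex with rows `D`, `B ⊞ B'`, `A` the
columns are exact by `h`, so exactness of the last two rows gives that of `D`. -/
lemma AltExact.of_threeTerm {A B B' D : AugSimp ⥤ ChainComplex AddCommGrpCat.{v} ℤ}
    (a : ∀ n, A.obj (mk n) ⟶ B.obj (mk n)) (b : ∀ n, A.obj (mk n) ⟶ B'.obj (mk n))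
    (c : ∀ n, B.obj (mk n) ⟶ D.obj (mk n)) (c' : ∀ n, B'.obj (mk n) ⟶ D.obj (mk n))
    (ha : ∀ n (i : Fin (n + 1)), A.map (face i) ≫ a n = a (n + 1) ≫ B.map (face i))
    (hb : ∀ n (i : Fin (n + 1)), A.map (face i) ≫ b n = b (n + 1) ≫ B'.map (face i))
    (hc : ∀ n (i : Fin (n + 1)), B.map (face i) ≫ c n = c (n + 1) ≫ D.map (face i))
    (hc' : ∀ n (i : Fin (n + 1)), B'.map (face i) ≫ c' n = c' (n + 1) ≫ D.map (face i))
    (hw : ∀ n, a n ≫ c n = b n ≫ c' n)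
    (h : ∀ n m, TotExact (threeTerm (A.obj (mk n)) (B.obj (mk n) ⊞ B'.obj (mk n)) (D.obj (mk n)))
      (threeTermD (biprod.lift (a n) (-b n)) (biprod.desc (c n) (c' n))) m)
    (hA : ∀ m, AltExact A m) (hB : ∀ m, AltExact B m) (hB' : ∀ m, AltExact B' m) (m : ℤ) :
    AltExact D m := by
  refine TotExact.of_double (K := fun n => threeTerm (A.obj (mk n))
    (B.obj (mk n) ⊞ B'.obj (mk n)) (D.obj (mk n))) (threeTermAltD A B B' D)
    (fun n => threeTermD (biprod.lift (a n) (-b n)) (biprod.desc (c n) (c' n)))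
    ?_ ?_ ?_ h m ?_
  · rintro n (_ | _ | _ | q)
    · exact altD_altD D n
    · exact biprod_map_comp_map_eq_zero (altD_altD B n) (altD_altD B' n)
    · exact altD_altD A n
    · exact comp_zero
  · exact fun n q => threeTermD_comp _ _ (by
      rw [biprod.lift_desc, Preadditive.neg_comp, hw, add_neg_cancel]) q
  · rintro n (_ | _ | q)
    · exact biprod_map_comp_desc (altD_naturality c hc n) (altD_naturality c' hc' n)
    · exact comp_biprod_lift_neg (altD_naturality a ha n) (altD_naturality b hb n)
    · exact comp_zero.trans zero_comp.symm
  · rintro (_ | _ | q)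
    · exact (hB _).biprod (hB' _)
    · exact hA _
    · exact TotExact.of_isZero fun n => HomologicalComplex.isZero_zero

end

/-- Base change to the `n`-th term of the nerve turns the square into an abstract blow-up square for
every `n`, so `F` yields a triangle of augmented simplicial complexes. -/
lemma CechAcyclic.of_isAbstractBlowup (hF : HasBlowupTriangles F) {V X T T' Z Z' : SchProper S}
    {f : V ⟶ X} {q : Z' ⟶ T'} {p : Z' ⟶ Z} {π : T' ⟶ T} {i : Z ⟶ T}
    (h : IsAbstractBlowup q p π i) {t : T ⟶ X} (hT' : CechAcyclic F f (π ≫ t))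
    (hZ : CechAcyclic F f (i ≫ t)) (hZ' : CechAcyclic F f (q ≫ π ≫ t)) : CechAcyclic F f t := by
  have hw : p ≫ i ≫ t = q ≫ π ≫ t := by rw [← Category.assoc, ← h.w, Category.assoc]
  refine AltExact.of_threeTerm
    (fun n => F.map (relCechMap f q (π ≫ t) (q ≫ π ≫ t) rfl (mk n)))
    (fun n => F.map (relCechMap f p (i ≫ t) (q ≫ π ≫ t) hw (mk n)))
    (fun n => F.map (relCechMap f π t (π ≫ t) rfl (mk n)))
    (fun n => F.map (relCechMap f i t (i ≫ t) rfl (mk n)))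
    ?_ ?_ ?_ ?_ ?_ ?_ hZ' hT' hZ
  iterate 4
    intro n i
    rw [Functor.comp_map, Functor.comp_map, ← F.map_comp, ← F.map_comp, relCechMap_naturality]
  · intro n
    rw [← F.map_comp, ← F.map_comp, relCechMap_comp, relCechMap_comp]
    congr 2
    exact h.w
  · intro n m
    refine hF.totExact (h.of_isPullback (isPullback_relCechMap π t _ rfl (mk n))
      (isPullback_relCechMap i t _ rfl (mk n)) (d := relCechSnd _ _) ?_ ?_ ?_ ?_) m
    · rw [relCechMap_comp]
      exact isPullback_relCechMap (q ≫ π) t _ (Category.assoc _ _ _) (mk n)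
    · exact (relCechMap_snd _ _ _ _ _).symm
    · exact (relCechMap_snd _ _ _ _ _).symm
    · rw [relCechMap_comp, relCechMap_comp]
      congr 1
      exact h.w

/-- The base change of the augmented Čech nerve along the identity. -/
lemma AltExact.of_cechAcyclic_id {V X : SchProper S} {f : V ⟶ X} (h : CechAcyclic F f (𝟙 X))
    (m : ℤ) : AltExact (cech f ⋙ F) m := by
  have (a : AugSimp) : IsIso (relCechFst (f := f) (𝟙 X) a) :=
    inferInstanceAs (IsIso (pullback.fst (cechBase f a) (𝟙 X)))
  refine AltExact.of_iso (Functor.isoWhiskerRight (NatIso.ofComponents (fun a =>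
    (asIso (relCechFst (𝟙 X) a) : (relCech f (𝟙 X)).obj a ≅ (cech f).obj a))
    (fun g => relCech_map_fst _ g)) F) (h m)

end BlowupDescent

end HomologicalDescent

end

noncomputable section

namespace HomologicalDescent

/-! ### Generic sections of proper cdh-covers -/

section GenericSection

/-- The cdh condition at the generic point of an irreducible component gives a lift of that point.
On a reduced scheme this is a section over the local scheme there, which spreads out to a
neighbourhood. -/
lemma IsProperCdhCover.exists_section {T V : Scheme.{u}} [IsLocallyNoetherian T] [IsReduced T]
    [Nonempty T] {f : V ⟶ T} (hf : IsProperCdhCover f) :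
    ∃ (U : T.Opens) (_ : Nonempty U) (s : U.toScheme ⟶ V), s ≫ f = U.ι := by
  have := hf.isProper
  have hirr := isIrreducible_irreducibleComponent (x := Classical.arbitrary T)
  let η : T := hirr.genericPoint
  have hη : closure {η} ∈ irreducibleComponents T := by
    rw [hirr.genericPoint_closure_eq, isClosed_irreducibleComponent.closure_eq]
    exact irreducibleComponent_mem_irreducibleComponents _
  have hfield := isField_stalk_of_closure_mem_irreducibleComponents T η hη
  -- The local ring at `η` is a field, so a lift of `Spec k(η)` is a lift of the spectrum of the
  -- local ring.
  have hres : IsIso (T.residue η) := by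
    rw [ConcreteCategory.isIso_iff_bijective]
    let := hfield.toField
    exact ⟨RingHom.injective (R := T.presheaf.stalk η) (S := T.residueField η)
      (T.residue η).hom, T.residue_surjective η⟩
  obtain ⟨l, hl⟩ := hf.exists_lift η
  obtain ⟨U, hU, s, -, hs⟩ := spread_out_of_isGermInjective' (𝟙 T) f (x := η)
    (Spec.map (inv (T.residue η)) ≫ l) (by
      rw [Category.assoc, hl, Scheme.fromSpecResidueField, ← Spec.map_comp_assoc,
        IsIso.hom_inv_id, Spec.map_id, Category.id_comp, Category.comp_id])
  exact ⟨U, ⟨⟨η, hU⟩⟩, s, by simpa using hs⟩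

/-- A section of a separated morphism is a closed immersion, so the image of `s` is closed in the
preimage of `U`. -/
lemma closure_range_inter_subset_of_section {T V : Scheme.{u}} {f : V ⟶ T} [IsSeparated f] {U : T.Opens}
    (s : U.toScheme ⟶ V) (hs : s ≫ f = U.ι) :
    closure (Set.range s) ∩ f ⁻¹ᵁ U ⊆ Set.range s := by
  let s' : U.toScheme ⟶ (f ⁻¹ᵁ U).toScheme := (isPullback_morphismRestrict f U).lift (𝟙 _) s
    (by rw [Category.id_comp, hs])
  have h1 : s' ≫ f ∣_ U = 𝟙 _ := IsPullback.lift_fst _ _ _ _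
  have h2 : s' ≫ (f ⁻¹ᵁ U).ι = s := IsPullback.lift_snd _ _ _ _
  have : IsClosedImmersion (s' ≫ f ∣_ U) := by rw [h1]; infer_instance
  have : IsClosedImmersion s' := IsClosedImmersion.of_comp s' (f ∣_ U)
  have h3 := s'.isClosedEmbedding.isClosed_range
  rintro y ⟨hy, hyU⟩
  have h4 : (⟨y, hyU⟩ : f ⁻¹ᵁ U) ∈ closure (Set.range s') := by
    rw [(f ⁻¹ᵁ U).ι.isOpenEmbedding.isInducing.closure_eq_preimage_closure_image,
      ← Set.range_comp]
    have h5 : ⇑(f ⁻¹ᵁ U).ι ∘ ⇑s' = s := by rw [← h2]; rfl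
    rw [h5]
    exact hy
  rw [h3.closure_eq] at h4
  obtain ⟨z, hz⟩ := h4
  refine ⟨z, ?_⟩
  rw [← h2, Scheme.Hom.comp_apply, hz]
  rfl

/-- Over `U` the scheme-theoretic image of `s` acquires no new points, and `s` identifies `U` with
this open part of the image. The restriction is thus a base change to `U` which is `U` itself. -/
lemma isIso_morphismRestrict_imageι {T V : Scheme.{u}} [IsLocallyNoetherian T] {f : V ⟶ T}
    [IsProper f] {U : T.Opens} (s : U.toScheme ⟶ V) (hs : s ≫ f = U.ι) :
    IsIso ((s.imageι ≫ f) ∣_ U) := by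
  have : IsImmersion (s ≫ f) := by rw [hs]; infer_instance
  have : IsImmersion s := IsImmersion.of_comp s f
  have : QuasiCompact (s ≫ f) := by rw [hs]; infer_instance
  have : QuasiCompact s := QuasiCompact.of_comp s f
  have h : IsPullback s.toImage (𝟙 U.toScheme) (s.imageι ≫ f) U.ι := by
    refine ⟨⟨by rw [Scheme.Hom.toImage_imageι_assoc, hs, Category.id_comp]⟩,
      ⟨PullbackCone.IsLimit.mk _ (fun c => c.snd) (fun c => ?_) (fun _ => Category.comp_id _)
        (fun c m _ h2 => by rw [← h2, Category.comp_id])⟩⟩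
    -- Points of the image lying over `U` avoid the boundary of the range of `s`, so the cone maps
    -- into the open subscheme in which `s` is closed.
    have hr : Set.range (c.fst ≫ s.imageι) ⊆ Set.range s.coborderRange.ι := by
      rintro _ ⟨x, rfl⟩
      rw [Scheme.Opens.range_ι]
      rintro ⟨hx, hx'⟩
      refine hx' (closure_range_inter_subset_of_section s hs ⟨hx, ?_⟩)
      change f ((c.fst ≫ s.imageι) x) ∈ U
      rw [← Scheme.Hom.comp_apply, Category.assoc, c.condition, Scheme.Hom.comp_apply]
      exact (c.snd x).2
    have h2 := IsImmersion.isPullback_toImage_liftCoborder s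
    have h3 : c.fst ≫ s.imageι = IsOpenImmersion.lift s.coborderRange.ι _ hr ≫
      s.coborderRange.ι := (IsOpenImmersion.lift_fac _ _ _).symm
    have h4 : h2.lift c.fst _ h3 = c.snd := by
      rw [← cancel_mono U.ι, ← c.condition]
      have h5 := congrArg (· ≫ s.imageι ≫ f) (h2.lift_fst c.fst _ h3)
      simpa only [Category.assoc, Scheme.Hom.toImage_imageι_assoc, hs] using h5
    rw [← h4, h2.lift_fst]
  have h2 := (isPullback_morphismRestrict (s.imageι ≫ f) U).flip.isoIsPullback_hom_snd _ _ h
  rw [← h2, Category.comp_id]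
  infer_instance

lemma isReduced_nilradical_subscheme (T : Scheme.{u}) : IsReduced T.nilradical.subscheme := by
  have (U : T.affineOpens) : IsReduced (T.nilradical.subschemeCover.openCover.X U) := by
    change IsReduced (Spec (.of (Γ(T, U) ⧸ T.nilradical.ideal U)))
    have : _root_.IsReduced (Γ(T, U) ⧸ T.nilradical.ideal U) :=
      (Ideal.isRadical_iff_quotient_reduced _).1 (Ideal.radical_isRadical _)
    infer_instance
  exact @IsReduced.of_openCover _ T.nilradical.subschemeCover.openCover this

end GenericSection

/-! ### Čech descent for proper cdh-covers -/

section CechDescent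

variable {S : Scheme.{u}} {F : SchProper S ⥤ ChainComplex AddCommGrpCat.{v} ℤ}

lemma isNoetherian_left [IsNoetherian S] (T : SchProper S) : IsNoetherian T.left := by
  obtain ⟨⟨-, h1⟩, h2⟩ := T.prop
  have h1 : LocallyOfFiniteType T.hom := h1
  have h2 : QuasiCompact T.hom := h2
  have : IsNoetherian ((Functor.fromPUnit S).obj T.right) := ‹IsNoetherian S›
  have : IsLocallyNoetherian T.left := LocallyOfFiniteType.isLocallyNoetherian T.hom
  have : CompactSpace T.left := QuasiCompact.compactSpace_of_compactSpace T.hom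
  exact {}

/-- The empty scheme maps to `V` over `X`. -/
lemma CechAcyclic.of_isEmpty {V X T : SchProper S} {f : V ⟶ X} (t : T ⟶ X) [IsEmpty T.left] :
    CechAcyclic F f t :=
  CechAcyclic.of_factorisation (liftHom f t ((isInitialOfIsEmpty (X := T.left)).to _)
    ((isInitialOfIsEmpty (X := T.left)).hom_ext _ _)) (liftHom_comp _ _ _ _)

/-- The reduced closed subscheme of an object of `SchProper S`. -/
abbrev reduced (T : SchProper S) : SchProper S := ofProper T T.left.nilradical.subschemeι

/-- The inclusion of the reduced closed subscheme. -/
abbrev reducedι (T : SchProper S) : reduced T ⟶ T := ofProperHom T T.left.nilradical.subschemeι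

instance (T : SchProper S) : IsClosedImmersion (reducedι T).left :=
  inferInstanceAs (IsClosedImmersion T.left.nilradical.subschemeι)

lemma range_reducedι (T : SchProper S) : Set.range (reducedι T).left = Set.univ := by
  change Set.range T.left.nilradical.subschemeι = _
  rw [Scheme.IdealSheafData.range_subschemeι]
  rfl

/-- The reduction is a closed immersion with empty complement, so together with the empty scheme in
the upper row it forms an abstract blow-up square. -/
lemma CechAcyclic.of_reduced (hF : HasBlowupTriangles F) {V X T : SchProper S} {f : V ⟶ X}
    (t : T ⟶ X) (h : CechAcyclic F f (reducedι T ≫ t)) : CechAcyclic F f t := by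
  let π := ofProperHom T (⊤ : T.left.IdealSheafData).subschemeι
  have he : IsEmpty (ofProper T (⊤ : T.left.IdealSheafData).subschemeι).left :=
    inferInstanceAs (IsEmpty (⊤ : T.left.IdealSheafData).subscheme)
  have he' : IsEmpty (pullback π (reducedι T)).left :=
    Function.isEmpty (pullback.fst π (reducedι T)).left
  refine CechAcyclic.of_isAbstractBlowup hF (q := pullback.fst π (reducedι T))
    (p := pullback.snd π (reducedι T)) (π := π) (i := reducedι T)
    ⟨isPullback_left (IsPullback.of_hasPullback _ _), inferInstance, ?_⟩ (.of_isEmpty _) h (.of_isEmpty _)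
  · have : IsEmpty (⟨(Set.range (reducedι T).left)ᶜ,
      (reducedι T).left.isClosedEmbedding.isClosed_range.isOpen_compl⟩ : T.left.Opens) :=
      ⟨fun x => x.2 ((range_reducedι T).ge (Set.mem_univ x.1))⟩
    exact isIso_of_isEmpty _

/-- `T'` is the scheme-theoretic image of a section of the base-changed cover over a nonempty open
`U`, and `Z` is the complement of `U`, with its reduced structure. By construction `T'` maps to `V`,
and `Z` is smaller than `T`. -/
lemma exists_isAbstractBlowup [IsNoetherian S] {V X T : SchProper S} {f : V ⟶ X}
    (hf : cdhCover S f) (t : T ⟶ X) [IsReduced T.left] [Nonempty T.left] :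
    ∃ (T' Z Z' : SchProper S) (q : Z' ⟶ T') (p : Z' ⟶ Z) (π : T' ⟶ T) (i : Z ⟶ T)
      (s : T' ⟶ V), IsAbstractBlowup q p π i ∧ s ≫ f = π ≫ t ∧ Set.range i.left ≠ Set.univ := by
  have := isNoetherian_left T
  have hg : IsProperCdhCover (pullback.snd f t).left :=
    IsProperCdhCover.of_isPullback (isPullback_left (IsPullback.of_hasPullback f t)) hf
  obtain ⟨U, ⟨x⟩, s, hs⟩ := hg.exists_section
  let I := Scheme.IdealSheafData.vanishingIdeal ⟨(U : Set T.left)ᶜ, U.2.isClosed_compl⟩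
  let i := ofProperHom T I.subschemeι
  have hi : Set.range i.left = (U : Set T.left)ᶜ := by
    change Set.range I.subschemeι = _
    rw [Scheme.IdealSheafData.range_subschemeι, Scheme.IdealSheafData.coe_support_vanishingIdeal]
    rfl
  let e := ofProperHom (pullback f t) s.imageι
  let π := e ≫ pullback.snd f t
  refine ⟨_, _, _, pullback.fst π i, pullback.snd π i, π, i, e ≫ pullback.fst f t,
    ⟨isPullback_left (IsPullback.of_hasPullback _ _), ?_, ?_⟩, ?_, ?_⟩
  · exact inferInstanceAs (IsClosedImmersion I.subschemeι)
  · have h := isIso_morphismRestrict_imageι s hs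
    refine @isIso_morphismRestrict_of_isPullback _ _ _ _ _ _ _ _
      (IsPullback.of_id_fst (f := π.left)) U h _ ?_
    intro y hy
    by_contra hyU
    exact hy (hi.ge hyU)
  · rw [Category.assoc, pullback.condition, Category.assoc]
  · rw [hi]
    intro h
    exact h.ge (Set.mem_univ x.1) x.2

/-- Noetherian induction on the underlying closed subset `c`, with `T` varying over all closed
subschemes supported on it. In the blow-up square, `T'` and `Z'` factor through `V`, and `Z` has
strictly smaller support. -/
lemma CechAcyclic.of_isClosedImmersion [IsNoetherian S] (hF : HasBlowupTriangles F)
    {V X : SchProper S} {f : V ⟶ X} (hf : cdhCover S f) (c : TopologicalSpace.Closeds X.left)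
    (T : SchProper S) (t : T ⟶ X) [IsClosedImmersion t.left] (hc : Set.range t.left = c) :
    CechAcyclic F f t := by
  have := isNoetherian_left X
  induction c using WellFoundedLT.induction generalizing T with
  | ind c ih =>
    refine CechAcyclic.of_reduced hF t ?_
    by_cases hT : Nonempty (reduced T).left
    · have : IsReduced (reduced T).left := isReduced_nilradical_subscheme T.left
      obtain ⟨T', Z, Z', q, p, π, i, s, h, hs, hi⟩ :=
        exists_isAbstractBlowup hf (reducedι T ≫ t)
      have hi' := h.isClosedImmersion
      have h2 : IsClosedImmersion (i ≫ reducedι T ≫ t).left :=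
        inferInstanceAs (IsClosedImmersion (i.left ≫ (reducedι T).left ≫ t.left))
      refine CechAcyclic.of_isAbstractBlowup hF h (.of_factorisation s hs)
        (ih ⟨_, (i ≫ reducedι T ≫ t).left.isClosedEmbedding.isClosed_range⟩ ?_ _ _ rfl)
        (.of_factorisation (q ≫ s) (by rw [Category.assoc, hs]))
      -- Equal supports would make `i` surjective, because the map from the reduction of `T` to `X`
      -- is injective on points.
      refine lt_of_le_of_ne ?_ fun hc' => hi (Set.eq_univ_of_forall fun z => ?_)
      · rintro _ ⟨z, rfl⟩
        exact hc.le ⟨(reducedι T).left (i.left z), rfl⟩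
      · have hz : t.left ((reducedι T).left z) ∈ Set.range (i ≫ reducedι T ≫ t).left :=
          (congrArg SetLike.coe hc').ge (hc.le ⟨_, rfl⟩)
        obtain ⟨w, hw⟩ := hz
        exact ⟨w, (reducedι T).left.isClosedEmbedding.injective
          (t.left.isClosedEmbedding.injective hw)⟩
    · rw [not_nonempty_iff] at hT
      exact .of_isEmpty _

lemma altExact_cech [IsNoetherian S] (hF : HasBlowupTriangles F) {V X : SchProper S} {f : V ⟶ X}
    (hf : cdhCover S f) (m : ℤ) : AltExact (cech f ⋙ F) m := by
  have : IsClosedImmersion (𝟙 X : X ⟶ X).left := inferInstanceAs (IsClosedImmersion (𝟙 X.left))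
  exact .of_cechAcyclic_id (.of_isClosedImmersion hF hf ⟨_,
    (𝟙 X : X ⟶ X).left.isClosedEmbedding.isClosed_range⟩ X (𝟙 X) rfl) m

end CechDescent

end HomologicalDescent

end

noncomputable section

namespace HomologicalDescent

open AugSimp

/-! ### Boundaries and maps to coskeleta -/

section Boundary

variable {C : Type*} [Category* C]

lemma AugSimp.exists_face_comp_of_forall_ne {n : ℕ} {b : AugSimp} (g : mk (n + 1) ⟶ b)
    (i : Fin (n + 1)) (hi : ∀ x, fn g x ≠ i) : ∃ ψ : mk n ⟶ b, face i ≫ ψ = g := by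
  choose ψ hψ using fun x => Fin.exists_succAbove_eq (hi x)
  refine ⟨ofFn ψ fun x y hxy => ?_, hom_ext hψ⟩
  rw [← (Fin.strictMono_succAbove i).le_iff_le, hψ, hψ]
  exact fn_monotone g hxy

/-- A map from at most `n` vertices to `n + 1` vertices misses one of them. -/
lemma AugSimp.exists_face_comp {n : ℕ} {b : AugSimp} (g : mk (n + 1) ⟶ b) (hb : b.n ≤ n) :
    ∃ (i : Fin (n + 1)) (ψ : mk n ⟶ b), face i ≫ ψ = g := by
  have : ¬ Function.Surjective (fn g) := fun h => by
    have := Fintype.card_le_of_surjective _ h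
    simp only [Fintype.card_fin] at this
    omega
  rw [Function.Surjective] at this
  push Not at this
  obtain ⟨i, hi⟩ := this
  exact ⟨i, exists_face_comp_of_forall_ne g i hi⟩

lemma AugSimp.face_cancel {n : ℕ} {b : AugSimp} (i : Fin (n + 1)) {g g' : mk n ⟶ b}
    (h : face i ≫ g = face i ≫ g') : g = g' :=
  hom_ext fun x => Fin.succAbove_right_injective (congrArg (fun k => fn k x) h)

variable {Y : AugSimp ⥤ C} {U : C} {n : ℕ} {y : Fin (n + 1) → (U ⟶ Y.obj (mk n))}

/-- A map which factors through two different faces misses two vertices, hence factors through the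
corresponding double face, where the boundary relation applies. So the value on a degenerate or
iterated face does not depend on the chosen face. -/
lemma IsBoundary.comp_eq (hy : IsBoundary Y n y) {b : AugSimp} (i j : Fin (n + 1))
    (g g' : mk n ⟶ b) (h : face i ≫ g = face j ≫ g') : y i ≫ Y.map g = y j ≫ Y.map g' := by
  wlog hij : i ≤ j generalizing i j g g'
  · exact (this j i g' g h.symm (le_of_not_ge hij)).symm
  obtain rfl | hij := hij.eq_or_lt
  · rw [face_cancel i h]
  cases n with
  | zero => omega
  | succ n =>
    obtain ⟨j, rfl⟩ := Fin.exists_succ_eq.2 (Fin.ne_zero_of_lt hij)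
    obtain ⟨i, rfl⟩ := Fin.exists_castSucc_eq.2 (Fin.ne_last_of_lt hij)
    have hij' : i ≤ j := Fin.castSucc_lt_succ_iff.1 hij
    obtain ⟨θ, rfl⟩ := exists_face_comp_of_forall_ne g j fun x hx => by
      have h1 : i.castSucc.succAbove (fn g x) = j.succ.succAbove (fn g' x) :=
        congrArg (fun k => fn k x) h
      rw [hx, Fin.succAbove_of_le_castSucc _ _ (Fin.castSucc_le_castSucc_iff.2 hij')] at h1
      exact Fin.succAbove_ne _ _ h1.symm
    obtain rfl : face i ≫ θ = g' := by
      refine face_cancel j.succ ?_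
      rw [← h, ← Category.assoc, ← Category.assoc, face_face hij']
    rw [Y.map_comp, Y.map_comp, ← Category.assoc, ← Category.assoc, hy i j hij']

/-- The relations between codimension-one faces already determine a compatible family on all maps
from at most `n` vertices; such a family is a cone over the limit which computes the coskeleton. -/
lemma IsBoundary.exists_family (hy : IsBoundary Y n y) :
    ∃ e : ∀ b : AugSimp, b.n ≤ n → (mk (n + 1) ⟶ b) → (U ⟶ Y.obj b),
      (∀ b hb i (ψ : mk n ⟶ b), e b hb (face i ≫ ψ) = y i ≫ Y.map ψ) ∧
      ∀ b hb b' hb' g (k : b ⟶ b'), e b hb g ≫ Y.map k = e b' hb' (g ≫ k) := by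
  have h (b : AugSimp) (hb : b.n ≤ n) (g : mk (n + 1) ⟶ b) :
      ∃ e : U ⟶ Y.obj b, ∀ i (ψ : mk n ⟶ b), face i ≫ ψ = g → y i ≫ Y.map ψ = e := by
    obtain ⟨i, ψ, rfl⟩ := exists_face_comp g hb
    exact ⟨y i ≫ Y.map ψ, fun j ψ' h' => hy.comp_eq _ _ _ _ h'⟩
  choose e he using h
  refine ⟨e, fun b hb i ψ => (he b hb _ i ψ rfl).symm, fun b hb b' hb' g k => ?_⟩
  obtain ⟨i, ψ, rfl⟩ := exists_face_comp g hb
  rw [← he b hb _ i ψ rfl, ← he b' hb' _ i (ψ ≫ k) (Category.assoc _ _ _).symm, Category.assoc,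
    Y.map_comp]

end Boundary

/-! ### From augmentations to functors on `AugSimp` -/

section Augment

variable {C : Type*} [Category* C] {X : C} {Y : SimplicialObject C}

/-- The objects of the augmented simplicial object `augment`. -/
def augmentObj (X : C) (Y : SimplicialObject C) : AugSimp → C
  | .mk 0 => X
  | .mk (n + 1) => Y.obj (op (SimplexCategory.mk n))

/-- The maps of the augmented simplicial object `augment`. -/
def augmentMap (a : Y ⟶ (SimplicialObject.const C).obj X) :
    ∀ b c : AugSimp, (b ⟶ c) → (augmentObj X Y b ⟶ augmentObj X Y c)
  | .mk 0, .mk 0, _ => 𝟙 X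
  | .mk (n + 1), .mk 0, _ => a.app (op (SimplexCategory.mk n))
  | .mk 0, .mk (m + 1), g => (fn g (0 : Fin (m + 1))).elim0
  | .mk (n + 1), .mk (m + 1), g => Y.map (SimplexCategory.mkHom (n := m) (m := n) g).op

/-- The functor on `AugSimp` given by an augmentation of a simplicial object. -/
def augment (a : Y ⟶ (SimplicialObject.const C).obj X) : AugSimp ⥤ C where
  obj := augmentObj X Y
  map := augmentMap a _ _
  map_id b := by
    obtain ⟨_ | n⟩ := b
    · rfl
    · exact Y.map_id _
  map_comp {b c d} f g := by
    obtain ⟨_ | n⟩ := b <;> obtain ⟨_ | m⟩ := c <;> obtain ⟨_ | k⟩ := d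
    · exact (Category.comp_id _).symm
    · exact (fn g (0 : Fin (k + 1))).elim0
    · exact (fn f (0 : Fin (m + 1))).elim0
    · exact (fn f (0 : Fin (m + 1))).elim0
    · exact (Category.comp_id _).symm
    · exact (fn g (0 : Fin (k + 1))).elim0
    · exact ((a.naturality (SimplexCategory.mkHom (n := m) (m := n) f).op).trans (Category.comp_id _)).symm
    · exact Y.map_comp (SimplexCategory.mkHom (n := m) (m := n) f).op
        (SimplexCategory.mkHom (n := k) (m := m) g).op

end Augment

/-- The limits in the pointwise formula are indexed by finite categories. The pointwise form gives
access to the coskeleton by cones. -/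
instance {C : Type*} [Category* C] [HasFiniteLimits C] (n : ℕ)
    (F : (SimplexCategory.Truncated n)ᵒᵖ ⥤ C) :
    (SimplexCategory.Truncated.inclusion n).op.HasPointwiseRightKanExtension F := by
  intro A
  have (b : (SimplexCategory.Truncated n)ᵒᵖ) :
      Finite (A ⟶ (SimplexCategory.Truncated.inclusion n).op.obj b) :=
    Finite.of_injective (fun f => f.unop) fun _ _ h => Quiver.Hom.unop_inj h
  have (b c : (SimplexCategory.Truncated n)ᵒᵖ) : Finite (b ⟶ c) :=
    Finite.of_injective (fun f => f.unop.hom) fun _ _ h =>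
      Quiver.Hom.unop_inj (ObjectProperty.hom_ext _ h)
  have : Finite (SimplexCategory.Truncated n)ᵒᵖ :=
    Finite.of_injective (fun b => (⟨b.unop.obj.len, Nat.lt_succ_of_le b.unop.property⟩ :
      Fin (n + 1))) fun b c h => Opposite.unop_injective
        (ObjectProperty.FullSubcategory.ext (SimplexCategory.ext (by simpa using h)))
  have : Finite (StructuredArrow A (SimplexCategory.Truncated.inclusion n).op) :=
    Finite.of_injective
      (β := Σ b, (A ⟶ (SimplexCategory.Truncated.inclusion n).op.obj b))
      (fun x => ⟨x.right, x.hom⟩) (by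
        rintro ⟨⟨⟨⟩⟩, x, f⟩ ⟨⟨⟨⟩⟩, y, g⟩ h
        simp only [Sigma.mk.injEq] at h
        obtain ⟨rfl, h⟩ := h
        obtain rfl := eq_of_heq h
        rfl)
  have (x y : StructuredArrow A (SimplexCategory.Truncated.inclusion n).op) :
      Finite (x ⟶ y) :=
    Finite.of_injective (fun f => f.right) fun _ _ h => StructuredArrow.ext _ _ h
  let : FinCategory (StructuredArrow A (SimplexCategory.Truncated.inclusion n).op) :=
    { fintypeObj := Fintype.ofFinite _
      fintypeHom := fun _ _ => Fintype.ofFinite _ }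
  exact (inferInstance : HasLimit
    (StructuredArrow.proj A (SimplexCategory.Truncated.inclusion n).op ⋙ F))

/-- The compatible family `l` is a cone over the diagram whose limit is the coskeleton at `m + 1`.
The conclusion states in terms of faces what it means for a simplex of `Z` to lie over `t`. -/
lemma exists_lift_cosk {C : Type*} [Category* C] [HasFiniteLimits C] (Z : SimplicialObject C)
    (m : ℕ) {T : C}
    (l : ∀ b : SimplexCategory, b.len ≤ m → (b ⟶ SimplexCategory.mk (m + 1)) →
      (T ⟶ Z.obj (op b)))
    (hl : ∀ b hb b' hb' (f : b ⟶ SimplexCategory.mk (m + 1)) (k : b' ⟶ b),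
      l b hb f ≫ Z.map k.op = l b' hb' (k ≫ f)) :
    ∃ t : T ⟶ ((SimplicialObject.Truncated.cosk m).obj
        ((SimplicialObject.truncation m).obj Z)).obj (op (SimplexCategory.mk (m + 1))),
      ∀ (W : C) (z : W ⟶ Z.obj (op (SimplexCategory.mk (m + 1)))) (c : W ⟶ T),
        z ≫ ((SimplicialObject.coskAdj m).unit.app Z).app _ = c ≫ t →
          ∀ i, z ≫ Z.map (SimplexCategory.δ i).op =
            c ≫ l (SimplexCategory.mk m) le_rfl (SimplexCategory.δ i) := by
  let s : Cone (StructuredArrow.proj (op (SimplexCategory.mk (m + 1)))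
      (SimplexCategory.Truncated.inclusion m).op ⋙ (SimplicialObject.truncation m).obj Z) :=
    { pt := T
      π :=
        { app := fun g => l g.right.unop.obj g.right.unop.property g.hom.unop
          naturality := fun g g' φ => by
            refine (Category.id_comp _).trans ?_
            refine Eq.trans ?_ (hl _ g.right.unop.property _ g'.right.unop.property
              g.hom.unop φ.right.unop.hom).symm
            exact congrArg (fun k => l _ g'.right.unop.property k.unop)
              (StructuredArrow.w φ).symm } }
  have : ((SimplicialObject.Truncated.cosk m).obj
      ((SimplicialObject.truncation m).obj Z)).IsRightKanExtension
      ((SimplicialObject.coskAdj m).counit.app ((SimplicialObject.truncation m).obj Z)) := by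
    dsimp only [SimplicialObject.Truncated.cosk, SimplicialObject.coskAdj]
    rw [Functor.ranAdjunction_counit]
    infer_instance
  have hlim := Functor.isPointwiseRightKanExtensionOfIsRightKanExtension _
    ((SimplicialObject.coskAdj m).counit.app ((SimplicialObject.truncation m).obj Z))
    (op (SimplexCategory.mk (m + 1)))
  refine ⟨hlim.lift s, fun W z c hz i => ?_⟩
  have h1 := hlim.fac s (StructuredArrow.mk (T := (SimplexCategory.Truncated.inclusion m).op)
    (Y := (op (⟨SimplexCategory.mk m, le_rfl⟩ : SimplexCategory.Truncated m)))
    (SimplexCategory.δ i).op)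
  -- By the triangle identity, the unit followed by the limit projection at a face is that face of
  -- `Z`.
  have h2 := congr_app ((SimplicialObject.coskAdj m).left_triangle_components Z)
    (op ⟨SimplexCategory.mk m, le_rfl⟩)
  refine Eq.trans ?_ (congrArg (c ≫ ·) h1)
  refine Eq.trans ?_ (Category.assoc _ _ _)
  refine Eq.trans ?_ (congrArg (· ≫ _) hz)
  refine (Category.comp_id _).symm.trans ?_
  refine (congrArg (fun k => (z ≫ Z.map (SimplexCategory.δ i).op) ≫ k) h2.symm).trans ?_
  refine (Category.assoc _ _ _).trans (Eq.trans ?_ (Category.assoc _ _ _).symm)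
  refine congrArg (z ≫ ·) ?_
  refine (Category.assoc _ _ _).symm.trans (Eq.trans ?_ (Category.assoc _ _ _))
  exact congrArg (· ≫ _) (NatTrans.naturality _ _)

/-! ### Hyperenvelopes as hypercovers -/

section Hypercover

variable {S : Scheme.{u}} {X : SchProper S} {Y : SimplicialObject (SchProper S)}
  {a : Y ⟶ (SimplicialObject.const (SchProper S)).obj X}

lemma exists_hom_cosk (m : ℕ) {U : SchProper S}
    (y : Fin (m + 2) → (U ⟶ (augment a).obj (mk (m + 1)))) (hy : IsBoundary (augment a) (m + 1) y) :
    ∃ (u : U ⟶ X) (t : Over.mk u.left ⟶ ((SimplicialObject.Truncated.cosk m).obj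
        ((SimplicialObject.truncation m).obj (toOver a))).obj (op (SimplexCategory.mk (m + 1)))),
      ∀ (W : Over X.left) (z : W ⟶ (toOver a).obj (op (SimplexCategory.mk (m + 1))))
        (c : W ⟶ Over.mk u.left),
        z ≫ ((SimplicialObject.coskAdj m).unit.app (toOver a)).app _ = c ≫ t →
          ∀ i, (z ≫ (toOver a).map (SimplexCategory.δ i).op).left =
            c.left ≫ (show U ⟶ Y.obj (op (SimplexCategory.mk m)) from y i).left := by
  obtain ⟨e, he, he'⟩ := hy.exists_family
  let bot (b : AugSimp) : b ⟶ mk 0 := ofFn Fin.elim0 fun i => i.elim0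
  -- The component at the empty ordinal; it makes `U` a scheme over `X`, as needed because the
  -- coskeleton is formed over `X`.
  let u : U ⟶ X := e (mk 0) (Nat.zero_le _) (bot _)
  let comp (b : SimplexCategory) (hb : b.len ≤ m) (f : b ⟶ SimplexCategory.mk (m + 1)) :
      U ⟶ Y.obj (op b) :=
    e (mk (b.len + 1)) (Nat.succ_le_succ hb) (SimplexCategory.Hom.toOrderHom f)
  have hcomp (b hb f) : comp b hb f ≫ a.app (op b) = u :=
    (he' (mk (b.len + 1)) (Nat.succ_le_succ hb) (mk 0)
      (Nat.zero_le _) (SimplexCategory.Hom.toOrderHom f) (bot _)).trans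
      (congrArg (e (mk 0) (Nat.zero_le _)) (hom_ext fun i => i.elim0))
  have hcomp' (b hb b' hb' f) (k : b' ⟶ b) : comp b hb f ≫ Y.map k.op = comp b' hb' (k ≫ f) :=
    he' (mk (b.len + 1)) (Nat.succ_le_succ hb) (mk (b'.len + 1)) (Nat.succ_le_succ hb')
      (SimplexCategory.Hom.toOrderHom f) (SimplexCategory.Hom.toOrderHom k)
  obtain ⟨t, ht⟩ := exists_lift_cosk (toOver a) m (T := Over.mk u.left)
    (fun b hb f => Over.homMk (comp b hb f).left (congrArg (fun k => k.left) (hcomp b hb f)))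
    (fun b hb b' hb' f k => Over.OverMorphism.ext
      (congrArg (fun k => k.left) (hcomp' b hb b' hb' f k)))
  refine ⟨u, t, fun W z c hz i => (congrArg (fun k => k.left) (ht W z c hz i)).trans ?_⟩
  have h4 : comp (SimplexCategory.mk m) le_rfl (SimplexCategory.δ i) = y i := by
    refine (he (mk (m + 1)) le_rfl i (𝟙 _)).trans ?_
    rw [CategoryTheory.Functor.map_id, Category.comp_id]
  exact congrArg (fun k : U ⟶ Y.obj (op (SimplexCategory.mk m)) => c.left ≫ k.left) h4

/-- A boundary on `U` is a morphism from `U` to the coskeleton. The cover on which it is filled is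
the base change along this morphism of the cover from the hyperenvelope condition, and the filler is
the other projection. -/
theorem IsHyperenvelope.isHypercover (ha : IsHyperenvelope a) :
    IsHypercover (cdhCover S) (augment a) := by
  intro n U y hy
  cases n with
  | zero =>
    let f : Y.obj (op (SimplexCategory.mk 0)) ⟶ X := a.app (op (SimplexCategory.mk 0))
    let y0 : U ⟶ X := y 0
    refine ⟨pullback y0 f, pullback.fst y0 f, IsProperCdhCover.of_isPullback
      (isPullback_left (IsPullback.of_hasPullback y0 f)).flip ha.zero,
      (pullback.snd y0 f : _), fun i => ?_⟩
    obtain rfl : i = 0 := Subsingleton.elim (α := Fin 1) _ _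
    exact pullback.condition.symm
  | succ m =>
    obtain ⟨u, t, ht⟩ := exists_hom_cosk m y hy
    let η := ((SimplicialObject.coskAdj m).unit.app (toOver a)).app (op (SimplexCategory.mk (m + 1)))
    have hη : IsProperCdhCover η.left := ha.succ m
    have hfst : IsProperCdhCover (pullback.fst t.left η.left) :=
      IsProperCdhCover.of_isPullback (IsPullback.of_hasPullback _ _).flip hη
    have := hfst.isProper
    let c : ofProper U (pullback.fst t.left η.left) ⟶ U := ofProperHom U _
    have hw : pullback.snd t.left η.left ≫ (a.app (op (SimplexCategory.mk (m + 1)))).left =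
        pullback.fst t.left η.left ≫ u.left := by
      refine (congrArg (pullback.snd t.left η.left ≫ ·) (Over.w η)).symm.trans ?_
      refine (Category.assoc _ _ _).symm.trans ?_
      refine (congrArg (· ≫ _) pullback.condition.symm).trans ?_
      refine (Category.assoc _ _ _).trans ?_
      exact congrArg (pullback.fst t.left η.left ≫ ·) (Over.w t)
    let z : ofProper U (pullback.fst t.left η.left) ⟶ Y.obj (op (SimplexCategory.mk (m + 1))) :=
      liftHom (a.app (op (SimplexCategory.mk (m + 1)))) (c ≫ u) (pullback.snd t.left η.left) hw
    refine ⟨_, c, hfst, (z : _), fun i => MorphismProperty.Over.Hom.ext ?_⟩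
    exact ht (Over.mk (pullback.fst t.left η.left ≫ u.left))
      (Over.homMk (pullback.snd t.left η.left) hw) (Over.homMk (pullback.fst t.left η.left))
      (Over.OverMorphism.ext pullback.condition.symm) i

end Hypercover

end HomologicalDescent

end

noncomputable section

namespace HomologicalDescent

open Elt AugSimp

/-! ### Elements of total complexes -/

section Total

variable (D : HomologicalComplex₂ AddCommGrpCat.{v} (ComplexShape.down ℕ) (ComplexShape.down ℤ))

/-- The components of the total complex of a double complex. -/
def totalProj (m : ℤ) (p : ℕ) (i : ℤ) :
    (D.total (ComplexShape.down ℤ)).X m ⟶ (D.X p).X i :=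
  D.totalDesc fun p' q' _ =>
    if h : p' = p ∧ q' = i then eqToHom (by rw [h.1, h.2]) else 0

lemma ι_totalProj_self (m : ℤ) (p : ℕ) (i : ℤ) (h : (p : ℤ) + i = m) :
    D.ιTotal (ComplexShape.down ℤ) p i m h ≫ totalProj D m p i = 𝟙 _ := by
  rw [totalProj, HomologicalComplex₂.ι_totalDesc, dif_pos ⟨rfl, rfl⟩, eqToHom_refl]

lemma ι_totalProj_of_ne (m : ℤ) (p p' : ℕ) (i i' : ℤ) (h : (p' : ℤ) + i' = m)
    (hne : ¬ (p' = p ∧ i' = i)) :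
    D.ιTotal (ComplexShape.down ℤ) p' i' m h ≫ totalProj D m p i = 0 := by
  rw [totalProj, HomologicalComplex₂.ι_totalDesc, dif_neg hne]

lemma totalProj_eq_zero (m : ℤ) (p : ℕ) (i : ℤ) (h : (p : ℤ) + i ≠ m) : totalProj D m p i = 0 := by
  refine HomologicalComplex₂.total.hom_ext _ fun p' i' h' => ?_
  have h'' : (p' : ℤ) + i' = m := h'
  rw [comp_zero]
  refine ι_totalProj_of_ne D _ _ _ _ _ h'' ?_
  rintro ⟨rfl, rfl⟩
  exact h h''

lemma total_d_comp_totalProj (m m' : ℤ) (hm : m' + 1 = m) (p : ℕ) (i : ℤ) :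
    (D.total (ComplexShape.down ℤ)).d m m' ≫ totalProj D m' p i =
      totalProj D m (p + 1) i ≫ (D.d (p + 1) p).f i +
        (-1 : ℤ) ^ p • totalProj D m p (i + 1) ≫ (D.X p).d (i + 1) i := by
  refine HomologicalComplex₂.total.hom_ext _ fun p' i' h' => ?_
  have h'' : (p' : ℤ) + i' = m := h'
  have hi : (ComplexShape.down ℤ).Rel i' (i' - 1) := by simp
  rw [HomologicalComplex₂.total_d, Preadditive.add_comp, Preadditive.comp_add,
    Preadditive.comp_add, HomologicalComplex₂.ι_D₁_assoc, HomologicalComplex₂.ι_D₂_assoc,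
    HomologicalComplex₂.d₂_eq D _ p' hi m' (show (p' : ℤ) + (i' - 1) = m' by omega)]
  congr 1
  · cases p' with
    | zero =>
      rw [HomologicalComplex₂.d₁_eq_zero _ _ _ _ _ (by simp), zero_comp, ← Category.assoc,
        ι_totalProj_of_ne D _ _ _ _ _ h'' (by omega), zero_comp]
    | succ p' =>
      rw [HomologicalComplex₂.d₁_eq D _
        (show (ComplexShape.down ℕ).Rel (p' + 1) p' by simp) i' m'
          (show (p' : ℤ) + i' = m' by push_cast at h''; omega)]
      have hε : ComplexShape.ε₁ (ComplexShape.down ℕ) (ComplexShape.down ℤ)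
          (ComplexShape.down ℤ) (p' + 1, i') = 1 := rfl
      rw [hε, one_smul, Category.assoc]
      by_cases h : p' = p ∧ i' = i
      · obtain ⟨rfl, rfl⟩ := h
        rw [ι_totalProj_self, Category.comp_id, ← Category.assoc, ι_totalProj_self,
          Category.id_comp]
      · rw [ι_totalProj_of_ne D _ _ _ _ _ _ h, comp_zero, ← Category.assoc,
          ι_totalProj_of_ne D _ _ _ _ _ h'' (by omega), zero_comp]
  · have hε : ComplexShape.ε₂ (ComplexShape.down ℕ) (ComplexShape.down ℤ)
        (ComplexShape.down ℤ) (p', i') = (p' : ℤ).negOnePow := rfl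
    rw [hε, Linear.units_smul_comp, Category.assoc, Preadditive.comp_zsmul]
    by_cases h : p' = p ∧ i' = i + 1
    · obtain ⟨rfl, rfl⟩ := h
      have h1 (j : ℤ) (hj : j = i) (h : (p' : ℤ) + j = m') : (D.X p').d (i + 1) j ≫
          D.ιTotal (ComplexShape.down ℤ) p' j m' h ≫ totalProj D m' p' i =
            (D.X p').d (i + 1) i := by
        subst hj
        rw [ι_totalProj_self, Category.comp_id]
      rw [h1 _ (by omega), ← Category.assoc, ι_totalProj_self, Category.id_comp,
        Int.negOnePow_def, zpow_natCast, Units.smul_def]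
      push_cast
      rfl
    · rw [ι_totalProj_of_ne D _ _ _ _ _ _ (by omega), comp_zero, smul_zero, ← Category.assoc,
        ι_totalProj_of_ne D _ _ _ _ _ h'' h, zero_comp, smul_zero]

/-- The components of an element of the total complex. -/
def totElt (m : ℤ) : (D.total (ComplexShape.down ℤ)).X m →+ ∀ p : ℕ, Elt (D.X p) where
  toFun t p i := (totalProj D m p i).hom t
  map_zero' := by funext p i; exact map_zero _
  map_add' x y := by funext p i; exact map_add _ _ _

lemma totElt_apply (m : ℤ) (t : (D.total (ComplexShape.down ℤ)).X m) (p : ℕ) (i : ℤ) :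
    totElt D m t p i = (totalProj D m p i).hom t := rfl

lemma totElt_hasDegree (m : ℤ) (t : (D.total (ComplexShape.down ℤ)).X m) (p : ℕ) :
    HasDegree (m - p) (totElt D m t p) := fun i hi => by
  rw [totElt_apply, totalProj_eq_zero D _ _ _ (by omega)]
  rfl

lemma totElt_d {m m' : ℤ} (hm : m' + 1 = m) (t : (D.total (ComplexShape.down ℤ)).X m) (p : ℕ) :
    totElt D m' (((D.total (ComplexShape.down ℤ)).d m m').hom t) p =
      map (D.d (p + 1) p) (totElt D m t (p + 1)) + (-1 : ℤ) ^ p • d _ (totElt D m t p) := by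
  funext i
  have h := congrArg (fun g => g.hom t) (total_d_comp_totalProj D m m' hm p i)
  simp only [AddCommGrpCat.hom_comp, AddCommGrpCat.hom_add, AddCommGrpCat.hom_zsmul,
    AddMonoidHom.comp_apply, AddMonoidHom.add_apply, AddMonoidHom.smul_apply] at h
  exact h

/-- With `totElt_bounded` and `totElt_injective`, this identifies the elements of the total complex
with finitely supported homogeneous families, the language of `TotExact`. -/
lemma exists_totElt_eq (m : ℤ) (x : ∀ p : ℕ, Elt (D.X p)) (hx : ∀ p : ℕ, HasDegree (m - p) (x p))
    (hb : ∃ b, ∀ p, b ≤ p → x p = 0) : ∃ t, totElt D m t = x := by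
  obtain ⟨b, hb⟩ := hb
  refine ⟨∑ p ∈ Finset.range b, (D.ιTotal (ComplexShape.down ℤ) p (m - p) m
    (add_sub_cancel (p : ℤ) m)).hom (x p (m - p)), ?_⟩
  funext p
  refine HasDegree.ext (totElt_hasDegree D m _ p) (hx p) ?_
  have h1 (p' : ℕ) : (totalProj D m p (m - p)).hom ((D.ιTotal (ComplexShape.down ℤ) p' (m - p') m
      (add_sub_cancel (p' : ℤ) m)).hom (x p' (m - p'))) =
      if p' = p then x p (m - p) else 0 := by
    split_ifs with h
    · subst h
      exact congrArg (fun g => g.hom (x p' (m - p')))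
        (ι_totalProj_self D m p' (m - p') (add_sub_cancel (p' : ℤ) m))
    · exact congrArg (fun g => g.hom (x p' (m - p')))
        (ι_totalProj_of_ne D m p p' (m - p) (m - p') (add_sub_cancel (p' : ℤ) m)
          (fun h' => h h'.1))
  rw [totElt_apply, map_sum, Finset.sum_congr rfl fun p' _ => h1 p', Finset.sum_ite_eq']
  split_ifs with h
  · rfl
  · rw [hb p (by simpa using h)]
    rfl

/-- The elements with this property form a subgroup `H` containing the image of every summand. The
quotient map by `H` vanishes on all summands, hence is zero. Allowing every `b' ≥ b` lets two
elements share a bound. -/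
lemma total_eq_sum (m : ℤ) (t : (D.total (ComplexShape.down ℤ)).X m) :
    ∃ b : ℕ, ∀ b', b ≤ b' → t = ∑ p ∈ Finset.range b', (D.ιTotal (ComplexShape.down ℤ) p (m - p) m
      (add_sub_cancel (p : ℤ) m)).hom (totElt D m t p (m - p)) := by
  let H : AddSubgroup ((D.total (ComplexShape.down ℤ)).X m) :=
    { carrier := {t | ∃ b : ℕ, ∀ b', b ≤ b' → t = ∑ p ∈ Finset.range b',
        (D.ιTotal (ComplexShape.down ℤ) p (m - p) m
          (add_sub_cancel (p : ℤ) m)).hom (totElt D m t p (m - p))}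
      zero_mem' := ⟨0, fun b' _ => by simp⟩
      add_mem' := by
        rintro x y ⟨b, hb⟩ ⟨c, hc⟩
        refine ⟨max b c, fun b' hb' => ?_⟩
        conv_lhs => rw [hb b' (by omega), hc b' (by omega)]
        simp [Finset.sum_add_distrib]
      neg_mem' := by
        rintro x ⟨b, hb⟩
        refine ⟨b, fun b' hb' => ?_⟩
        conv_lhs => rw [hb b' hb']
        simp }
  have h : AddCommGrpCat.ofHom (QuotientAddGroup.mk' H) = 0 := by
    refine HomologicalComplex₂.total.hom_ext _ fun p' i' h' => ?_
    have h'' : (p' : ℤ) + i' = m := h'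
    obtain rfl : i' = m - p' := by omega
    rw [comp_zero]
    ext x
    refine (QuotientAddGroup.eq_zero_iff _).2 ⟨p' + 1, fun b' hb' => ?_⟩
    rw [Finset.sum_eq_single p']
    · refine congrArg _ ?_
      exact (congrArg (fun g => g.hom x) (ι_totalProj_self D m p' (m - p') h'')).symm
    · intro p _ hp
      refine (congrArg _ ?_).trans (map_zero _)
      exact congrArg (fun g => g.hom x)
        (ι_totalProj_of_ne D m p p' (m - p) (m - p') h'' (fun h => hp h.1.symm))
    · intro h
      exact absurd (Finset.mem_range.2 (by omega)) h
  exact (QuotientAddGroup.eq_zero_iff _).1 (congrArg (fun g => g.hom t) h)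

lemma totElt_bounded (m : ℤ) (t : (D.total (ComplexShape.down ℤ)).X m) :
    ∃ b, ∀ p, b ≤ p → totElt D m t p = 0 := by
  obtain ⟨b, hb⟩ := total_eq_sum D m t
  refine ⟨b, fun p hp => HasDegree.ext (totElt_hasDegree D m t p) (HasDegree.zero _) ?_⟩
  rw [hb b le_rfl, totElt_apply, map_sum]
  refine Finset.sum_eq_zero fun p' hp' => ?_
  have hne : p' ≠ p := by have := Finset.mem_range.1 hp'; omega
  exact congrArg (fun g => g.hom (totElt D m t p' (m - p')))
    (ι_totalProj_of_ne D m p p' (m - p) (m - p') (add_sub_cancel (p' : ℤ) m) (fun h => hne h.1))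

lemma totElt_injective (m : ℤ) : Function.Injective (totElt D m) := by
  intro t t' h
  obtain ⟨b, hb⟩ := total_eq_sum D m t
  obtain ⟨b', hb'⟩ := total_eq_sum D m t'
  rw [hb (max b b') (le_max_left _ _), hb' (max b b') (le_max_right _ _), h]

end Total

/-! ### The augmentation of a total complex -/

section Augmentation

variable {K : SimplicialObject (ChainComplex AddCommGrpCat.{v} ℤ)}
  {L : ChainComplex AddCommGrpCat.{v} ℤ}
  (ε : K ⟶ (SimplicialObject.const (ChainComplex AddCommGrpCat.{v} ℤ)).obj L)

lemma augmentationMap_f (m : ℤ) : (augmentationMap ε).f m =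
    totalProj (doubleComplex K) m 0 m ≫ (ε.app (op (SimplexCategory.mk 0))).f m := by
  refine HomologicalComplex₂.total.hom_ext _ fun p q h => ?_
  have h' : (p : ℤ) + q = m := h
  match p, h, h' with
  | 0, h, h' =>
    obtain rfl : q = m := by simpa using h'
    rw [← Category.assoc, ι_totalProj_self, Category.id_comp]
    refine ((doubleComplex K).ι_totalDesc _ _ _ h).trans ?_
    simp
  | p + 1, h, h' =>
    rw [← Category.assoc, ι_totalProj_of_ne _ _ _ _ _ _ h' (by omega), zero_comp]
    exact (doubleComplex K).ι_totalDesc _ _ _ h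

/-- The augmentation in degree zero. -/
def augZero : K.obj (op (SimplexCategory.mk 0)) ⟶ L := ε.app (op (SimplexCategory.mk 0))

lemma augmentationMap_apply (m : ℤ) (t : (totalComplex K).X m) :
    ((augmentationMap ε).f m).hom t =
      map (augZero ε) (totElt (doubleComplex K) m t 0) m := by
  rw [augmentationMap_f]
  rfl

/-- The sequence of complexes of an augmented simplicial complex. -/
def augSeq (L : ChainComplex AddCommGrpCat.{v} ℤ)
    (K : SimplicialObject (ChainComplex AddCommGrpCat.{v} ℤ)) :
    ℕ → ChainComplex AddCommGrpCat.{v} ℤ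
  | 0 => L
  | p + 1 => K.obj (op (SimplexCategory.mk p))

/-- The maps in the sequence of complexes of an augmented simplicial complex. -/
def augSeqD : ∀ n, augSeq L K (n + 1) ⟶ augSeq L K n
  | 0 => augZero ε
  | p + 1 => (doubleComplex K).d (p + 1) p

variable {ε}

/-- Up to sign, the total complex of the augmented sequence is the cone of the augmentation map, and
its exactness gives injectivity and surjectivity on homology. -/
lemma quasiIso_augmentationMap (h : ∀ m, TotExact (augSeq L K) (augSeqD ε) m) :
    QuasiIso (augmentationMap ε) := by
  rw [quasiIso_iff_mono_epi]
  -- Both halves are instances of this: injectivity is the case of a cycle `x` whose image is the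
  -- boundary of `x₀`, and surjectivity is the case `x = 0` with `x₀` a cycle.
  have hex (m m' : ℤ) (hm : m' + 1 = m) (x₀ : L.X m) (x : ∀ p : ℕ, Elt ((doubleComplex K).X p))
      (hb : ∃ b, ∀ p, b ≤ p → x p = 0) (hx : ∀ p : ℕ, HasDegree (m' - p) (x p))
      (h0 : map (augZero ε) (x 0) = d _ (single m x₀))
      (h1 : ∀ p, map ((doubleComplex K).d (p + 1) p) (x (p + 1)) + (-1 : ℤ) ^ p • d _ (x p) = 0) :
      ∃ (y₀ : L.X (m + 1)) (z : (totalComplex K).X m),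
        ((augmentationMap ε).f m).hom z = (L.d (m + 1) m).hom y₀ + x₀ ∧
        totElt (doubleComplex K) m' (((totalComplex K).d m m').hom z) = x := by
    obtain ⟨b, hb⟩ := hb
    have hsgn (p : ℕ) : (-1 : ℤ) ^ (p + 1) * -1 = (-1) ^ p := by ring
    -- Column `p` of the total complex is column `p + 1` of the augmented sequence; twisting by `-1`
    -- compensates for this shift in the signs.
    obtain ⟨y, ⟨c, hc⟩, hy, hy'⟩ := (h m).twist (-1) (by norm_num) (fun n => match n with
      | 0 => single (A := L) m x₀
      | p + 1 => x p) ⟨b + 1, by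
        rintro (_ | p) hp
        · omega
        · exact hb p (by omega)⟩ (by
        rintro (_ | p)
        · exact (single_hasDegree m x₀).congr (by simp)
        · exact (hx p).congr (by push_cast; linarith)) (by
        rintro (_ | p)
        · have h2 (z w : Elt L) (hz : z = w) : z + ((-1 : ℤ) ^ 0 * -1) • w = 0 := by
            simp [hz]
          exact h2 _ _ h0
        · change map ((doubleComplex K).d (p + 1) p) (x (p + 1)) +
            ((-1 : ℤ) ^ (p + 1) * -1) • d _ (x p) = 0
          rw [hsgn, h1])
    obtain ⟨z, hz⟩ := exists_totElt_eq (doubleComplex K) m (fun p => y (p + 1))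
      (fun p => (hy (p + 1)).congr (by push_cast; ring)) ⟨c, fun p hp => hc _ (by omega)⟩
    refine ⟨y 0 (m + 1), z, ?_, ?_⟩
    · let y₀ : Elt L := y 0
      let y₁ : Elt (K.obj (op (SimplexCategory.mk 0))) := y 1
      have h2 : map (augZero ε) y₁ + ((-1 : ℤ) ^ 0 * -1) • d L y₀ = single m x₀ := hy' 0
      have h3 := congrFun h2 m
      rw [single_same, pow_zero, one_mul, neg_one_zsmul, ← sub_eq_add_neg,
        Pi.sub_apply, sub_eq_iff_eq_add'] at h3
      rw [augmentationMap_apply, hz]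
      exact h3
    · funext p
      rw [totElt_d _ hm, hz, ← hsgn]
      exact hy' (p + 1)
  refine ⟨fun m => ?_, fun m => ?_⟩
  · have hx0 (x : (totalComplex K).X m) : HasDegree m (totElt (doubleComplex K) m x 0) :=
      (totElt_hasDegree (doubleComplex K) m x 0).congr (by simp)
    rw [mono_homologyMap_iff _ rfl (sub_add_cancel m 1)]
    intro x y hx hxy
    obtain ⟨_, z, -, hz⟩ := hex (m + 1) m rfl y (totElt (doubleComplex K) m x)
      (totElt_bounded _ _ _) (totElt_hasDegree _ _ _)
      (HasDegree.ext (HasDegree.map (hx0 x) (augZero ε))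
        ((single_hasDegree _ _).d.congr (by ring)) (by
        rw [d_apply, single_same, ← hxy, augmentationMap_apply]))
      (fun p => by
        rw [← totElt_d _ (sub_add_cancel m 1)]
        refine (congrFun (congrArg (totElt (doubleComplex K) (m - 1)) hx) p).trans ?_
        rw [map_zero]
        rfl)
    exact ⟨z, totElt_injective _ _ hz⟩
  · rw [epi_homologyMap_iff _ rfl (sub_add_cancel m 1)]
    intro y hy
    obtain ⟨y₀, z, h1, h2⟩ := hex m (m - 1) (sub_add_cancel m 1) y 0 ⟨0, fun _ _ => rfl⟩
      (fun _ => HasDegree.zero _)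
      (HasDegree.ext ((HasDegree.zero _).map _) (single_hasDegree _ _).d (by
        rw [d_apply' _ (sub_add_cancel m 1), single_same, hy, Pi.zero_apply, map_zero]
        rfl))
      (fun p => by simp)
    refine ⟨z, -y₀, totElt_injective _ _ (h2.trans (map_zero _).symm), ?_⟩
    rw [h1, map_neg]
    abel

end Augmentation

end HomologicalDescent

end

noncomputable section

namespace HomologicalDescent

open Elt AugSimp

/-! ### Comparison of the two forms of the augmented complex -/

section

variable {C : Type*} [Category* C] {X : C} {Y : SimplicialObject C}
  (a : Y ⟶ (SimplicialObject.const C).obj X) (F : C ⥤ ChainComplex AddCommGrpCat.{v} ℤ)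
  (ε : Y ⋙ F ⟶ (SimplicialObject.const (ChainComplex AddCommGrpCat.{v} ℤ)).obj (F.obj X))

lemma altD_augment_zero : altD (augment a ⋙ F) 0 = F.map (a.app (op (SimplexCategory.mk 0))) := by
  refine (Fin.sum_univ_one _).trans ?_
  rw [Fin.val_zero, pow_zero, one_smul]
  rfl

lemma altD_augment_succ (p : ℕ) :
    altD (augment a ⋙ F) (p + 1) = (doubleComplex (Y ⋙ F)).d (p + 1) p := by
  refine Eq.trans ?_ (AlgebraicTopology.alternatingFaceMapComplex_obj_d (Y ⋙ F) p).symm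
  rfl

/-- The two sequences have the same terms and differentials, but their definitions by cases agree
only after splitting off column zero. -/
lemma totExact_augSeq_of_altExact
    (hε : ε.app (op (SimplexCategory.mk 0)) = F.map (a.app (op (SimplexCategory.mk 0)))) {m : ℤ}
    (h : AltExact (augment a ⋙ F) m) : TotExact (augSeq (F.obj X) (Y ⋙ F)) (augSeqD ε) m := by
  refine TotExact.of_levelwise_iso (fun n => match n with
    | 0 => Iso.refl (F.obj X)
    | p + 1 => Iso.refl (F.obj (Y.obj (op (SimplexCategory.mk p))))) ?_ h
  rintro (_ | p)
  · refine (Category.id_comp _).trans ((hε.trans ?_).trans (Category.comp_id _).symm)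
    exact (altD_augment_zero a F).symm
  · refine (Category.id_comp _).trans (Eq.trans ?_ (Category.comp_id _).symm)
    exact (altD_augment_succ a F p).symm

end

end HomologicalDescent

end

open HomologicalDescent in
/-- Homological descent for hyperenvelopes. -/
theorem theorem1p1 (S : Scheme.{u}) [IsNoetherian S]
    (F : SchProper S ⥤ ChainComplex AddCommGrpCat.{v} ℤ)
    (N : ℤ) (hN : ∀ (X : SchProper S) (i : ℤ), i < N → IsZero ((F.obj X).homology i))
    (hF : HasBlowupTriangles F)
    (X : SchProper S) (Y : SimplicialObject (SchProper S))
    (a : Y ⟶ (SimplicialObject.const (SchProper S)).obj X) (ha : IsHyperenvelope a) :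
    QuasiIso (descentMap F a) := by
  have hdesc (m : ℤ) : AltExact (augment a ⋙ F) m :=
    altExact_of_isHypercover (J := cdhCover S) cdhCover_of_comp F N
      (fun Z i hi => exists_d_eq_of_isZero_homology (hN Z i hi))
      (fun f hf m => altExact_cech hF hf m) ha.isHypercover m
  exact quasiIso_augmentationMap fun m => totExact_augSeq_of_altExact a F _ rfl (hdesc m)
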